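/- Notation. For $\tau$ in the upper half-plane $\mathcal H$ put $q=e^{2\pi i\tau}$ and $\zeta_c^a=e^{2\pi i a/c}$; square roots of complex numbers are principal. Put $(z;q)_n=\prod_{j=0}^{n-1}(1-zq^j)$, $(z;q)_\infty=\prod_{j\ge0}(1-zq^j)$, $[z;q]_\infty=(z;q)_\infty(q/z;q)_\infty$. Let $$\mathcal O(z;\tau)=\sum_{n\ge0}\frac{(-1;q)_n\,q^{n(n+1)/2}}{(zq;q)_n(z^{-1}q;q)_n}$$ be the generating function of overpartitions by rank and size. Define $$\vartheta(z;\tau)=\sum_{n\in\mathbb Z+\frac12}e^{\pi i n^2\tau+2\pi i n(z+\frac12)},\qquad \mu(u,v;\tau)=\frac{e^{\pi i u}}{\vartheta(v;\tau)}\sum_{n\in\mathbb Z}\frac{(-1)^n e^{\pi i n(n+1)\tau+2\pi i n v}}{1-e^{2\pi i n\tau+2\pi i u}}\quad(u,v\notin\mathbb Z+\tau\mathbb Z),$$ $$E(x)=2\int_0^x e^{-\pi w^2}\,dw,\qquad R(u;\tau)=\sum_{n\in\mathbb Z+\frac12}\Bigl(\operatorname{sgn}(n)-E\bigl((n+\tfrac{\operatorname{Im}u}{\operatorname{Im}\tau})\sqrt{2\operatorname{Im}\tau}\bigr)\Bigr)(-1)^{n-\frac12}e^{-\pi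 i n^2\tau-2\pi i n u},$$ $\tilde\mu(u,v;\tau)=\mu(u,v;\tau)+\frac i2R(u-v;\tau)$, and $g_{a,b}(\tau)=\sum_{n\in\mathbb Z+a}n\,e^{\pi i n^2\tau+2\pi i n b}$. For integers $a,c$ with $c>0$ and $c\nmid 2a$ set $$N(a,c;\tau)=q^{-1/4}\,\tilde\mu\bigl(\tfrac{2a}{c},\tau;2\tau\bigr)\ \ (q^{-1/4}=e^{-\pi i\tau/2}),\qquad P(a,c;\tau)=\frac{(-q;q)_\infty\,(q^2;q^2)_\infty^2}{(q;q)_\infty\,[\zeta_c^{2a};q^2]_\infty},$$ $$\mathcal M(a,c;\tau)=\mathcal O(\zeta_c^a;\tau)-i\sqrt2\,\frac{1-\zeta_c^a}{1+\zeta_c^a}\int_{-\overline\tau}^{i\infty}\frac{g_{0,\frac12-\frac{2a}{c}}(2z)}{\sqrt{-i(z+\tau)}}\,dz,$$ the integral being taken along the vertical half-line. For $A=\begin{pmatrix}\alpha&\beta\\\gamma&\delta\end{pmatrix}\in\mathrm{SL}_2(\mathbb Z)$ let $A\tau=\frac{\alpha\tau+\beta}{\gamma\tau+\delta}$ and let $\nu(A)$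 be the $\eta$-multiplier, defined by $\eta(A\tau)=\nu(A)\sqrt{\gamma\tau+\delta}\,\eta(\tau)$, where $\eta(\tau)=e^{\pi i\tau/12}(q;q)_\infty$; for $\gamma$ even let ${}^2A=\begin{pmatrix}\alpha&2\beta\\\gamma/2&\delta\end{pmatrix}$. Theorem. Let $a,c$ be integers with $c>0$ and $c\nmid 2a$, and let $A=\begin{pmatrix}\alpha&\beta\\\gamma&\delta\end{pmatrix}\in\Gamma_0(2)\cap\Gamma_0(c^2)\cap\Gamma_1(c)$. Then for every $\tau\in\mathcal H$: $$N(a,c;A\tau)=\nu({}^2A)^{-3}(-1)^{\beta+\frac{\alpha-1}2}\,i^{-\alpha\beta}\sqrt{\gamma\tau+\delta}\;N(a,c;\tau),$$ $$P(a,c;A\tau)=\frac{\nu({}^2A)}{\nu(A)^2}\sqrt{\gamma\tau+\delta}\;P(a,c;\tau)=\nu({}^2A)^{-3}(-1)^{\beta+\frac{\alpha-1}2}\,i^{-\alpha\beta}\sqrt{\gamma\tau+\delta}\;P(a,c;\tau),$$ $$\mathcal M(a,c;A\tau)=\nu({}^2A)^{-3}(-1)^{\beta+\frac{\alpha-1}2}\,i^{-\alpha\beta}\sqrt{\gamma\tau+\delta}\;\mathcal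 M(a,c;\tau).$$ -/

import Mathlib

open Complex CongruenceSubgroup
open UpperHalfPlane hiding I
open scoped MatrixGroups

noncomputable section

namespace OverpartitionRank

/-! ### `q`-products -/

/-- The finite product `(z; q)_n = ∏_{j < n} (1 - z q ^ j)`. -/
def qPoch (z q : ℂ) (n : ℕ) : ℂ := ∏ j ∈ Finset.range n, (1 - z * q ^ j)

/-- The infinite product `(z; q)_∞ = ∏_{j ≥ 0} (1 - z q ^ j)`. -/
def qPochInf (z q : ℂ) : ℂ := ∏' j : ℕ, (1 - z * q ^ j)

/-- The product `[z; q]_∞ = (z; q)_∞ (q / z; q)_∞`. -/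
def jacProd (z q : ℂ) : ℂ := qPochInf z q * qPochInf (q / z) q

/-- `q = exp(2 π i τ)`. -/
def nome (τ : ℂ) : ℂ := cexp (2 * Real.pi * I * τ)

/-- The root of unity `ζ_c ^ a = exp(2 π i a / c)`. -/
def zeta (a : ℤ) (c : ℕ) : ℂ := cexp (2 * Real.pi * I * ((a : ℂ) / (c : ℂ)))

/-! ### The overpartition rank function -/

/-- `O(z; τ) = ∑_{n ≥ 0} (-1; q)_n q ^ (n (n + 1) / 2) / ((z q; q)_n (z⁻¹ q; q)_n)`, the
two-variable generating function of overpartitions by rank (the exponent of `z`) and size (the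
exponent of `q`). -/
def rankGen (z : ℂ) (τ : ℍ) : ℂ :=
  ∑' n : ℕ, qPoch (-1) (nome τ) n * nome τ ^ (n * (n + 1) / 2) /
    (qPoch (z * nome τ) (nome τ) n * qPoch (z⁻¹ * nome τ) (nome τ) n)

/-! ### Zwegers' functions -/

/-- `ϑ(z; τ) = ∑_{n ∈ ℤ + 1/2} exp(π i n² τ + 2 π i n (z + 1/2))`. -/
def theta (z τ : ℂ) : ℂ :=
  ∑' k : ℤ, cexp (Real.pi * I * ((k : ℂ) + 1 / 2) ^ 2 * τ +
    2 * Real.pi * I * ((k : ℂ) + 1 / 2) * (z + 1 / 2))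

/-- `μ(u, v; τ)`, for `u, v ∉ ℤ + τ ℤ`. -/
def mu (u v τ : ℂ) : ℂ :=
  cexp (Real.pi * I * u) / theta v τ *
    ∑' n : ℤ, (-1 : ℂ) ^ n *
        cexp (Real.pi * I * n * ((n : ℂ) + 1) * τ + 2 * Real.pi * I * n * v) /
      (1 - cexp (2 * Real.pi * I * n * τ + 2 * Real.pi * I * u))

/-- `E(x) = 2 ∫_0^x exp(-π w²) dw`, which is only needed at real arguments. -/
def errE (x : ℝ) : ℝ := 2 * ∫ w in (0 : ℝ)..x, Real.exp (-Real.pi * w ^ 2)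

/-- `R(u; τ) = ∑_{n ∈ ℤ + 1/2} (sgn n - E((n + a) √(2 y))) (-1) ^ (n - 1/2)
exp(-π i n² τ - 2 π i n u)`, where `y = Im τ` and `a = Im u / Im τ`; here `n = k + 1/2`. -/
def zwegersR (u τ : ℂ) : ℂ :=
  ∑' k : ℤ,
    ((Real.sign ((k : ℝ) + 1 / 2)
        - errE (((k : ℝ) + 1 / 2 + u.im / τ.im) * Real.sqrt (2 * τ.im)) : ℝ) : ℂ) *
      (-1 : ℂ) ^ k *
      cexp (-Real.pi * I * ((k : ℂ) + 1 / 2) ^ 2 * τ - 2 * Real.pi * I * ((k : ℂ) + 1 / 2) * u)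

/-- The completed function `μ̃(u, v; τ) = μ(u, v; τ) + (i / 2) R(u - v; τ)`. -/
def muTilde (u v τ : ℂ) : ℂ := mu u v τ + I / 2 * zwegersR (u - v) τ

/-- `g_{a,b}(τ) = ∑_{n ∈ ℤ + a} n exp(π i n² τ + 2 π i n b)`. -/
def unaryTheta (a b : ℝ) (τ : ℂ) : ℂ :=
  ∑' k : ℤ, ((k : ℂ) + a) *
    cexp (Real.pi * I * ((k : ℂ) + a) ^ 2 * τ + 2 * Real.pi * I * ((k : ℂ) + a) * b)

/-! ### The functions `N(a, c; τ)`, `P(a, c; τ)` and `ℳ(a, c; τ)` -/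

/-- `N(a, c; τ) = q ^ (-1/4) μ̃(2 a / c, τ; 2 τ)`. -/
def N (a : ℤ) (c : ℕ) (τ : ℍ) : ℂ :=
  cexp (-(2 * Real.pi * I * τ) / 4) * muTilde (2 * (a : ℂ) / (c : ℂ)) τ (2 * τ)

/-- `P(a, c; τ) = (-q; q)_∞ (q²; q²)_∞² / ((q; q)_∞ [ζ_c ^ (2 a); q²]_∞)`. -/
def P (a : ℤ) (c : ℕ) (τ : ℍ) : ℂ :=
  qPochInf (-nome τ) (nome τ) * qPochInf (nome τ ^ 2) (nome τ ^ 2) ^ 2 /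
    (qPochInf (nome τ) (nome τ) * jacProd (zeta (2 * a) c) (nome τ ^ 2))

/-- The integral of `g_{0, 1/2 - 2a/c}(2 z) / √(-i (z + τ))` in `z`, along the vertical half-line
`z = -τ̄ + i t`, `t > 0`, from `-τ̄` to `i ∞` (so that `dz = i dt`). -/
def periodIntegral (a : ℤ) (c : ℕ) (τ : ℍ) : ℂ :=
  ∫ t in Set.Ioi (0 : ℝ),
    unaryTheta 0 (1 / 2 - 2 * (a : ℝ) / (c : ℝ)) (2 * (-(starRingEnd ℂ) (τ : ℂ) + I * t)) /
      Complex.sqrt (-I * ((-(starRingEnd ℂ) (τ : ℂ) + I * t) + τ)) * I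

/-- The completion of the overpartition rank function at `z = ζ_c ^ a`:
`ℳ(a, c; τ) = O(ζ_c ^ a; τ) - i √2 (1 - ζ_c ^ a) / (1 + ζ_c ^ a) ·
∫_{-τ̄}^{i∞} g_{0, 1/2 - 2a/c}(2 z) / √(-i (z + τ)) dz`. -/
def M (a : ℤ) (c : ℕ) (τ : ℍ) : ℂ :=
  rankGen (zeta a c) τ -
    I * (Real.sqrt 2 : ℂ) * ((1 - zeta a c) / (1 + zeta a c)) * periodIntegral a c τ

/-! ### The multiplier -/

/-- `√(γ τ + δ)` (principal branch) for `A = (α, β; γ, δ)`. -/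
def sqrtDenom (A : SL(2, ℤ)) (τ : ℍ) : ℂ := Complex.sqrt ((A 1 0 : ℂ) * τ + (A 1 1 : ℂ))

/-- The `η`-multiplier `ν(A)`, given by `η(A τ) = ν(A) √(γ τ + δ) η(τ)`. The quotient does not
depend on `τ` (see `eta_smul`), and is evaluated at `τ = i` here. -/
def nu (A : SL(2, ℤ)) : ℂ :=
  ModularForm.eta ((A • UpperHalfPlane.I : ℍ) : ℂ) /
    (sqrtDenom A UpperHalfPlane.I * ModularForm.eta (UpperHalfPlane.I : ℂ))

lemma denom_mem (A : SL(2, ℤ)) :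
    (∀ τ : ℍ, ((A 1 0 : ℂ) * τ + (A 1 1 : ℂ)) ∈ slitPlane) ∨
      ∀ τ τ' : ℍ, ((A 1 0 : ℂ) * τ + (A 1 1 : ℂ)) = ((A 1 0 : ℂ) * τ' + (A 1 1 : ℂ)) := by
  by_cases h : A 1 0 = 0
  · right
    intro τ τ'
    simp [h]
  · left
    intro τ
    rw [mem_slitPlane_iff]
    right
    have := τ.im_pos.ne'
    simp [h, this]

lemma denom_ne (A : SL(2, ℤ)) (τ : ℍ) : ((A 1 0 : ℂ) * τ + (A 1 1 : ℂ)) ≠ 0 := by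
  have := UpperHalfPlane.denom_ne_zero A τ
  simpa [ModularGroup.denom_apply] using this

/-- The defining property of the `η`-multiplier. -/
theorem eta_smul (A : SL(2, ℤ)) (τ : ℍ) :
    ModularForm.eta ((A • τ : ℍ) : ℂ) = nu A * sqrtDenom A τ * ModularForm.eta (τ : ℂ) := by
  have hs : ∀ τ : ℍ, sqrtDenom A τ ≠ 0 := by
    intro τ
    simpa [sqrtDenom, Complex.sqrt] using denom_ne A τ
  have hη : ∀ τ : ℍ, ModularForm.eta (τ : ℂ) ≠ 0 := fun τ => ModularForm.eta_ne_zero τ.2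
  have hηc : Continuous fun τ : ℍ => ModularForm.eta (τ : ℂ) := by
    rw [continuous_iff_continuousAt]
    intro τ
    exact (ModularForm.differentiableAt_eta_of_mem_upperHalfPlaneSet τ.2).continuousAt.comp
      UpperHalfPlane.continuous_coe.continuousAt
  have hsc : Continuous (sqrtDenom A) := by
    rcases denom_mem A with h | h
    · rw [continuous_iff_continuousAt]
      intro τ
      have h1 : ContinuousAt (fun τ : ℍ => ((A 1 0 : ℂ) * τ + (A 1 1 : ℂ))) τ := by
        have := UpperHalfPlane.continuous_coe
        fun_prop
      exact ContinuousAt.comp (g := Complex.sqrt)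
        (differentiableAt_sqrt (h τ)).continuousAt h1
    · have : sqrtDenom A = fun _ => sqrtDenom A UpperHalfPlane.I := by
        funext τ
        simp only [sqrtDenom]
        rw [h τ UpperHalfPlane.I]
      rw [this]
      exact continuous_const
  set f : ℍ → ℂ := fun τ =>
    ModularForm.eta ((A • τ : ℍ) : ℂ) / (sqrtDenom A τ * ModularForm.eta (τ : ℂ)) with hf
  have hfc : Continuous f := by
    refine Continuous.div (hηc.comp (show Continuous fun τ : ℍ => A • τ from
      continuous_const_smul (A : GL (Fin 2) ℝ))) (hsc.mul hηc) fun τ => ?_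
    exact mul_ne_zero (hs τ) (hη τ)
  have h24 : ∀ τ, f τ ^ 24 = 1 := by
    intro τ
    have hΔ := congrFun (SlashInvariantForm.slash_action_generators_SL2Z ModularForm.discriminant_S_invariant
      ModularForm.discriminant_T_invariant A) τ
    rw [ModularForm.SL_slash_apply, ModularGroup.denom_apply] at hΔ
    simp only [ModularForm.discriminant] at hΔ
    have hd := denom_ne A τ
    have hsq : sqrtDenom A τ ^ 24 = ((A 1 0 : ℂ) * τ + (A 1 1 : ℂ)) ^ 12 := by
      have h2 : sqrtDenom A τ ^ 2 = ((A 1 0 : ℂ) * τ + (A 1 1 : ℂ)) := by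
        simp [sqrtDenom, Complex.sqrt]
      rw [← h2]
      ring
    rw [hf]
    simp only [div_pow, mul_pow]
    rw [hsq, div_eq_one_iff_eq (mul_ne_zero (pow_ne_zero _ hd) (pow_ne_zero _ (hη τ))), ← hΔ,
      zpow_neg]
    have : ((A 1 0 : ℂ) * τ + (A 1 1 : ℂ)) ^ (12 : ℤ) = ((A 1 0 : ℂ) * τ + (A 1 1 : ℂ)) ^ 12 := by
      norm_cast
    rw [this]
    field_simp
  have hfin : {z : ℂ | z ^ 24 = 1}.Finite := by
    have := (Polynomial.nthRoots 24 (1 : ℂ)).toFinset.finite_toSet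
    refine this.subset fun z hz => ?_
    simpa [Polynomial.mem_nthRoots] using hz
  have hconst : f τ = f UpperHalfPlane.I := by
    exact isPreconnected_univ.constant_of_mapsTo hfin.isDiscrete hfc.continuousOn
      (fun x _ => h24 x) (Set.mem_univ _) (Set.mem_univ _)
  have h1 : nu A = f τ := by
    rw [hconst]
    rfl
  rw [h1, hf]
  have := hs τ
  have := hη τ
  field_simp

/-- The matrix `²A = (α, 2 β; γ / 2, δ)` of `A = (α, β; γ, δ)` with `γ` even. -/
def upTwo (A : SL(2, ℤ)) (h : A ∈ Gamma0 2) : SL(2, ℤ) :=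
  ⟨!![A 0 0, 2 * A 0 1; A 1 0 / 2, A 1 1], by
    have h2 : (2 : ℤ) ∣ A 1 0 := (ZMod.intCast_zmod_eq_zero_iff_dvd _ 2).mp (Gamma0_mem.mp h)
    have hd := A.det_coe
    rw [Matrix.det_fin_two] at hd
    rw [Matrix.det_fin_two_of]
    have h3 : 2 * (A 1 0 / 2) = A 1 0 := Int.mul_ediv_cancel' h2
    linear_combination hd - A 0 1 * h3⟩

/-- The multiplier `ν(²A) ^ (-3) (-1) ^ (β + (α - 1) / 2) i ^ (-α β)`; here `γ` is even, so that
`α` is odd and `(α - 1) / 2` is an integer. -/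
def multiplier (A : SL(2, ℤ)) (h : A ∈ Gamma0 2) : ℂ :=
  nu (upTwo A h) ^ (-3 : ℤ) * (-1 : ℂ) ^ (A 0 1 + (A 0 0 - 1) / 2) * I ^ (-(A 0 0 * A 0 1))

end OverpartitionRank

end

noncomputable section

namespace OverpartitionRank

open Filter Topology MeasureTheory

/-! ### `q`-Pochhammer symbols -/

section QPochhammer

variable {q : ℂ}

/-! The heart of the proof is the identity `M_eq`: `M = 2ζ (1 - ζ)/(1 + ζ) (P - iN)` with `ζ = zeta
a c`. The factor in front does not depend on `τ`, so the law for `M` follows once `N` and `P` are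
known to transform with the same multiplier.

For `M_eq`, the product `1/((zq;q)_n (q/z;q)_n)` is expanded in partial fractions
(`partialFraction`). The sum over `n` is then evaluated in closed form (`rankKernel_eq`), and the
resulting bilateral series is split into a theta quotient, a constant and an Appell sum in `z²` to
the base `q²` (`tsum_rank_eq_appell`). The theta quotient is `P`, and the Appell sum is `μ(2a/c, τ;
2τ)` up to elementary factors, because `ϑ(τ; 2τ)` is an eta quotient. Integrated term by term, the
period integral is the series for `R(2a/c - τ; 2τ)` without the half of its term `k = 0` that comes
from `sgn`; that missing half is the constant (`zwegersR_half_period`, `N_eq`).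

For `N`, Zwegers' theorem is proved: `μ̃` is a two-variable Jacobi-type form. The elliptic laws hold
because the inhomogeneous terms of `μ` and `R` cancel. For `τ ↦ -1/τ`, the defect is holomorphic off
the lattice since the `∂̄`-derivatives of the `R` terms cancel, its pole at `0` cancels, and
multiplied by `ϑ(u - v)` it is elliptic, so constant, and zero at `u = v` (`muTilde_S`). Cocycles
built from `η` then carry the law from the generators to `SL₂(ℤ)` (`muTilde_smul`, `theta_smul`).

Applied to `²A` and the modulus `2τ`, these laws move `2a/c` and `τ` by lattice vectors only, and
the congruences on `A` make the remaining phases trivial or part of the multiplier (`N_smul`,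
`P_smul`). The two multipliers agree because `ϑ(τ; 2τ)` can be transformed either as a theta value
or as an eta quotient (`multiplier_eq`). -/

lemma summable_norm_geometric_mul (hq : ‖q‖ < 1) (z : ℂ) : Summable fun j : ℕ => ‖-(z * q ^ j)‖ := by
  simpa using (summable_geometric_of_lt_one (norm_nonneg _) hq).mul_left ‖z‖

lemma multipliable_qPochInf (hq : ‖q‖ < 1) (z : ℂ) : Multipliable fun j : ℕ => 1 - z * q ^ j := by
  simpa [sub_eq_add_neg] using multipliable_one_add_of_summable (summable_norm_geometric_mul hq z)

lemma tendsto_qPoch (hq : ‖q‖ < 1) (z : ℂ) :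
    Tendsto (qPoch z q) atTop (𝓝 (qPochInf z q)) :=
  (multipliable_qPochInf hq z).hasProd.tendsto_prod_nat

lemma qPochInf_ne_zero (hq : ‖q‖ < 1) {z : ℂ} (hz : ∀ j : ℕ, 1 - z * q ^ j ≠ 0) :
    qPochInf z q ≠ 0 := by
  have := tprod_one_add_ne_zero_of_summable (f := fun j : ℕ => -(z * q ^ j))
    (fun j => by simpa [sub_eq_add_neg] using hz j) (summable_norm_geometric_mul hq z)
  simpa [qPochInf, sub_eq_add_neg] using this

lemma one_sub_ne_zero_of_norm_lt {x : ℂ} (hx : ‖x‖ < 1) : 1 - x ≠ 0 := by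
  intro h
  rw [sub_eq_zero] at h
  simp [← h] at hx

lemma norm_mul_pow_lt_one (hq : ‖q‖ < 1) {z : ℂ} (hz : ‖z‖ < 1) (j : ℕ) : ‖z * q ^ j‖ < 1 := by
  rw [norm_mul, norm_pow]
  exact (mul_le_of_le_one_right (norm_nonneg _) (pow_le_one₀ (norm_nonneg _) hq.le)).trans_lt hz

lemma qPochInf_ne_zero_of_norm_lt (hq : ‖q‖ < 1) {z : ℂ} (hz : ‖z‖ < 1) : qPochInf z q ≠ 0 :=
  qPochInf_ne_zero hq fun j => one_sub_ne_zero_of_norm_lt (norm_mul_pow_lt_one hq hz j)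

lemma one_sub_zpow_ne_zero (hq : ‖q‖ < 1) {m : ℤ} (hm : 0 < m) : 1 - q ^ m ≠ 0 := by
  lift m to ℕ using hm.le
  apply one_sub_ne_zero_of_norm_lt
  rw [zpow_natCast, norm_pow]
  exact pow_lt_one₀ (norm_nonneg _) hq (by omega)

lemma qPoch_succ (z q : ℂ) (n : ℕ) : qPoch z q (n + 1) = qPoch z q n * (1 - z * q ^ n) :=
  Finset.prod_range_succ _ _

lemma qPoch_zero (z q : ℂ) : qPoch z q 0 = 1 := Finset.prod_range_zero _

lemma qPoch_succ' (z q : ℂ) (n : ℕ) : qPoch z q (n + 1) = (1 - z) * qPoch (z * q) q n := by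
  simp only [qPoch, Finset.prod_range_succ' _ n]
  rw [mul_comm]
  congr 1
  · simp
  · exact Finset.prod_congr rfl fun j _ => by ring

lemma qPochInf_eq_mul (hq : ‖q‖ < 1) (z : ℂ) : qPochInf z q = (1 - z) * qPochInf (z * q) q := by
  have h1 := (tendsto_qPoch hq z).comp (tendsto_add_atTop_nat 1)
  have h2 := (tendsto_qPoch hq (z * q)).const_mul (1 - z)
  refine tendsto_nhds_unique h1 (h2.congr fun n => ?_)
  simp [qPoch_succ']

/-- `1 / (q; q)_m`, extended by zero to negative `m`. -/
def qInvFac (q : ℂ) (m : ℤ) : ℂ := if m < 0 then 0 else (qPoch q q m.toNat)⁻¹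

lemma qInvFac_of_neg {m : ℤ} (hm : m < 0) : qInvFac q m = 0 := if_pos hm

lemma qInvFac_natCast (m : ℕ) : qInvFac q m = (qPoch q q m)⁻¹ := by simp [qInvFac]

lemma qInvFac_zero : qInvFac q 0 = 1 := by
  simpa [qPoch_zero] using qInvFac_natCast (q := q) 0

/-- Extension by zero makes the recurrence uniform in `m`: at `m = 0` the factor `1 - q ^ 0`
vanishes. Sums over `ℤ` can therefore be shifted without boundary terms. -/
lemma qInvFac_sub_one (hq : ‖q‖ < 1) (m : ℤ) : qInvFac q (m - 1) = (1 - q ^ m) * qInvFac q m := by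
  rcases lt_trichotomy m 0 with h | h | h
  · rw [qInvFac_of_neg h, qInvFac_of_neg (by omega), mul_zero]
  · subst h
    rw [qInvFac_of_neg (by omega)]
    simp
  · obtain ⟨k, rfl⟩ : ∃ k : ℕ, m = k + 1 := ⟨(m - 1).toNat, by omega⟩
    have h1 : ((k : ℤ) + 1 - 1) = (k : ℕ) := by ring
    have h2 : ((k : ℤ) + 1) = ((k + 1 : ℕ) : ℤ) := by push_cast; ring
    have h3 : (1 : ℂ) - q ^ (k + 1) ≠ 0 := by
      have := one_sub_zpow_ne_zero hq h
      rwa [h2, zpow_natCast] at this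
    rw [h1, h2, qInvFac_natCast, qInvFac_natCast, qPoch_succ, zpow_natCast, ← pow_succ',
      mul_inv, mul_comm (qPoch q q k)⁻¹, ← mul_assoc, mul_inv_cancel₀ h3, one_mul]

lemma tendsto_qInvFac (hq : ‖q‖ < 1) :
    Tendsto (fun n : ℕ => qInvFac q n) atTop (𝓝 (qPochInf q q)⁻¹) := by
  simp only [qInvFac_natCast]
  exact (tendsto_qPoch hq q).inv₀ (qPochInf_ne_zero_of_norm_lt hq hq)

lemma tendsto_qInvFac_atTop (hq : ‖q‖ < 1) :
    Tendsto (qInvFac q) atTop (𝓝 (qPochInf q q)⁻¹) := by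
  rw [← Nat.map_cast_int_atTop, tendsto_map'_iff]
  exact tendsto_qInvFac hq

lemma exists_norm_qInvFac_le (hq : ‖q‖ < 1) : ∃ C : ℝ, 0 ≤ C ∧ ∀ m, ‖qInvFac q m‖ ≤ C := by
  obtain ⟨C, hC⟩ := (Metric.isBounded_range_of_tendsto _ (tendsto_qInvFac hq)).exists_norm_le
  have h0 : 0 ≤ C := (norm_nonneg _).trans (hC _ ⟨0, rfl⟩)
  refine ⟨C, h0, fun m => ?_⟩
  by_cases hm : m < 0
  · simpa [qInvFac_of_neg hm]
  · lift m to ℕ using not_lt.mp hm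
    exact hC _ ⟨m, rfl⟩

end QPochhammer

/-! ### Triangular numbers and Gaussian sums over `ℤ` -/

/-- The triangular number `r (r - 1) / 2`. -/
def tri (r : ℤ) : ℤ := r * (r - 1) / 2

lemma two_mul_tri (r : ℤ) : 2 * tri r = r * (r - 1) :=
  Int.mul_ediv_cancel' (by simpa [mul_comm] using (Int.even_mul_succ_self (r - 1)).two_dvd)

lemma tri_add_one (r : ℤ) : tri (r + 1) = tri r + r := by
  have := two_mul_tri r
  have := two_mul_tri (r + 1)
  linarith

lemma tri_one_sub (r : ℤ) : tri (1 - r) = tri r := by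
  have := two_mul_tri r
  have := two_mul_tri (1 - r)
  linarith

lemma tri_neg (r : ℤ) : tri (-r) = tri r + r := by
  have := two_mul_tri r
  have := two_mul_tri (-r)
  linarith

lemma summable_zpow_tri_mul {Q Z : ℝ} (hQ : 0 < Q) (hQ1 : Q < 1) (hZ : 0 < Z) :
    Summable fun r : ℤ => Q ^ tri r * Z ^ r := by
  have key : ∀ W : ℝ, 0 < W → Summable fun n : ℕ => Q ^ tri n * W ^ n := by
    intro W hW
    refine summable_of_ratio_test_tendsto_lt_one (l := 0) zero_lt_one
      (Eventually.of_forall fun n => by positivity) ?_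
    have h : Tendsto (fun n : ℕ => Q ^ n * W) atTop (𝓝 0) := by
      simpa using (tendsto_pow_atTop_nhds_zero_of_lt_one hQ.le hQ1).mul_const W
    refine h.congr fun n => ?_
    have h1 : Q ^ tri n * W ^ n ≠ 0 := by positivity
    rw [Real.norm_of_nonneg (by positivity), Real.norm_of_nonneg (by positivity),
      eq_div_iff h1]
    push_cast
    rw [tri_add_one, zpow_add₀ hQ.ne', zpow_natCast]
    ring
  refine Summable.of_nat_of_neg ?_ ?_
  · simpa using key Z hZ
  -- Since `tri (-n) = tri n + n`, the negative half is the positive half with `Z` replaced by `Q /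
  -- Z`.
  · refine (key (Q / Z) (by positivity)).congr fun n => ?_
    rw [tri_neg, zpow_add₀ hQ.ne', zpow_neg, div_pow, zpow_natCast, zpow_natCast]
    ring

lemma exists_norm_le_of_tendsto_int {f : ℤ → ℂ} {a b : ℂ}
    (ha : Tendsto (fun n : ℕ => f n) atTop (𝓝 a))
    (hb : Tendsto (fun n : ℕ => f (-n)) atTop (𝓝 b)) : ∃ C : ℝ, 0 ≤ C ∧ ∀ n, ‖f n‖ ≤ C := by
  obtain ⟨C, hC⟩ := (Metric.isBounded_range_of_tendsto _ ha).exists_norm_le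
  obtain ⟨C', hC'⟩ := (Metric.isBounded_range_of_tendsto _ hb).exists_norm_le
  refine ⟨max C C', ((norm_nonneg _).trans (hC _ ⟨0, rfl⟩)).trans (le_max_left _ _), fun n => ?_⟩
  rcases Int.eq_nat_or_neg n with ⟨k, rfl | rfl⟩
  · exact (hC _ ⟨k, rfl⟩).trans (le_max_left _ _)
  · exact (hC' _ ⟨k, rfl⟩).trans (le_max_right _ _)

/-- The sequence has limits `1` and `0` at the two ends. No non-vanishing is assumed: an index with
zero denominator contributes `0⁻¹ = 0`. -/
lemma exists_norm_inv_one_sub_le {q : ℂ} (hq : ‖q‖ < 1) {z : ℂ} (hz : z ≠ 0)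
    (hq0 : q ≠ 0) : ∃ C : ℝ, 0 ≤ C ∧ ∀ n : ℤ, ‖(1 - z * q ^ n)⁻¹‖ ≤ C := by
  refine exists_norm_le_of_tendsto_int (a := 1) (b := 0) ?_ ?_
  · have h : Tendsto (fun n : ℕ => 1 - z * q ^ n) atTop (𝓝 1) := by
      simpa using ((tendsto_pow_atTop_nhds_zero_of_norm_lt_one hq).const_mul z).const_sub 1
    simpa using h.inv₀ one_ne_zero
  · have h : Tendsto (fun n : ℕ => (q ^ n - z)) atTop (𝓝 (-z)) := by
      simpa using (tendsto_pow_atTop_nhds_zero_of_norm_lt_one hq).sub_const z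
    have h2 := (tendsto_pow_atTop_nhds_zero_of_norm_lt_one hq).mul (h.inv₀ (neg_ne_zero.mpr hz))
    rw [zero_mul] at h2
    refine h2.congr fun n => ?_
    have : q ^ n ≠ 0 := pow_ne_zero _ hq0
    rw [zpow_neg, zpow_natCast]
    have h3 : (1 - z * (q ^ n)⁻¹) = (q ^ n)⁻¹ * (q ^ n - z) := by field_simp
    rw [h3, mul_inv, inv_inv]

/-! ### Finite identities -/

section Finite

variable {q : ℂ}

/-- `1 / ((q; q)_{n - r} (q; q)_{n + r})`. -/
def baileyKernel (q : ℂ) (n r : ℤ) : ℂ := qInvFac q (n - r) * qInvFac q (n + r)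

lemma baileyKernel_eq_zero {n r : ℤ} (h : n < |r|) : baileyKernel q n r = 0 := by
  rw [baileyKernel]
  rcases lt_abs.mp h with h | h
  · rw [qInvFac_of_neg (by omega : n - r < 0), zero_mul]
  · rw [qInvFac_of_neg (by omega : n + r < 0), mul_zero]

lemma baileyKernel_neg (n r : ℤ) : baileyKernel q n (-r) = baileyKernel q n r := by
  rw [baileyKernel, baileyKernel, mul_comm, sub_neg_eq_add, ← sub_eq_add_neg]

lemma summable_mul_baileyKernel (f : ℤ → ℂ) (n : ℤ) :
    Summable fun r => f r * baileyKernel q n r := by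
  refine summable_of_hasFiniteSupport ((Set.finite_Icc (-n) n).subset fun r hr => ?_)
  rw [Set.mem_Icc, ← abs_le]
  by_contra h
  exact hr (by simp [baileyKernel_eq_zero (not_le.mp h)])

lemma baileyKernel_sub_one (hq : ‖q‖ < 1) (n r : ℤ) :
    baileyKernel q (n - 1) r = (1 - q ^ (n - r)) * (1 - q ^ (n + r)) * baileyKernel q n r := by
  rw [baileyKernel, baileyKernel, show n - 1 - r = n - r - 1 by ring,
    show n - 1 + r = n + r - 1 by ring, qInvFac_sub_one hq, qInvFac_sub_one hq]
  ring

end Finite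

/-! ### The Jacobi triple product and partial fractions, from finite versions. -/

section TripleProduct

variable {q : ℂ}

/-- The general term `(-1) ^ r q ^ (r (r - 1) / 2) z ^ r` of the Jacobi triple product. -/
def tripleTerm (q z : ℂ) (r : ℤ) : ℂ := (-1) ^ r * q ^ tri r * z ^ r

lemma tripleTerm_add_one (hq0 : q ≠ 0) {z : ℂ} (hz : z ≠ 0) (r : ℤ) :
    tripleTerm q z (r + 1) = -(q ^ r * z) * tripleTerm q z r := by
  rw [tripleTerm, tripleTerm, tri_add_one, zpow_add₀ hq0, zpow_add₀ hz,
    zpow_add₀ (by norm_num : (-1 : ℂ) ≠ 0)]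
  simp only [zpow_one]
  ring

lemma norm_tripleTerm (q z : ℂ) (r : ℤ) : ‖tripleTerm q z r‖ = ‖q‖ ^ tri r * ‖z‖ ^ r := by
  simp [tripleTerm]

lemma summable_norm_tripleTerm (hq : ‖q‖ < 1) (hq0 : q ≠ 0) {z : ℂ} (hz : z ≠ 0) :
    Summable fun r => ‖tripleTerm q z r‖ := by
  simp only [norm_tripleTerm]
  exact summable_zpow_tri_mul (norm_pos_iff.mpr hq0) hq (norm_pos_iff.mpr hz)

lemma summable_tripleTerm (hq : ‖q‖ < 1) (hq0 : q ≠ 0) {z : ℂ} (hz : z ≠ 0) :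
    Summable (tripleTerm q z) := (summable_norm_tripleTerm hq hq0 hz).of_norm

/-- Pascal's rule for `q`-binomial coefficients, used twice: up to `(q;q)_{2n}` the kernel is the
coefficient of `2n` over `n - r`. Each kernel at `n - 1` is a polynomial multiple of the kernel at
`n`, so only a polynomial identity remains. -/
lemma baileyKernel_pascal (hq : ‖q‖ < 1) (hq0 : q ≠ 0) (n r : ℤ) :
    (1 - q ^ (2 * n)) * (1 - q ^ (2 * n - 1)) * baileyKernel q n r =
      (1 + q ^ (2 * n - 1)) * baileyKernel q (n - 1) r +
        q ^ (n - r) * baileyKernel q (n - 1) (r - 1) +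
        q ^ (n + r) * baileyKernel q (n - 1) (r + 1) := by
  have h1 : baileyKernel q (n - 1) (r - 1) =
      (1 - q ^ (n + r - 1)) * (1 - q ^ (n + r)) * baileyKernel q n r := by
    rw [baileyKernel, baileyKernel, show n - 1 - (r - 1) = n - r by ring,
      show n - 1 + (r - 1) = n + r - 1 - 1 by ring, qInvFac_sub_one hq, qInvFac_sub_one hq]
    ring
  have h2 : baileyKernel q (n - 1) (r + 1) =
      (1 - q ^ (n - r - 1)) * (1 - q ^ (n - r)) * baileyKernel q n r := by
    rw [baileyKernel, baileyKernel, show n - 1 + (r + 1) = n + r by ring,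
      show n - 1 - (r + 1) = n - r - 1 - 1 by ring, qInvFac_sub_one hq, qInvFac_sub_one hq]
    ring
  rw [h1, h2, baileyKernel_sub_one hq]
  have hn : q ^ n ≠ 0 := zpow_ne_zero _ hq0
  have hr : q ^ r ≠ 0 := zpow_ne_zero _ hq0
  simp only [two_mul, zpow_add₀ hq0, zpow_sub₀ hq0, zpow_one]
  field_simp
  ring

/-- Shifting `r` in the two outer terms of `baileyKernel_pascal` yields the factors `-z q^(n-1)` and
`-q^n / z`; together with `1 + q^(2n-1)` they factor as on the right. -/
lemma finite_triple_step (hq : ‖q‖ < 1) (hq0 : q ≠ 0) {z : ℂ} (hz : z ≠ 0) (n : ℤ) :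
    (1 - q ^ (2 * n)) * (1 - q ^ (2 * n - 1)) * ∑' r, tripleTerm q z r * baileyKernel q n r =
      (1 - z * q ^ (n - 1)) * (1 - q ^ n / z) *
        ∑' r, tripleTerm q z r * baileyKernel q (n - 1) r := by
  have e1 : ∑' r, tripleTerm q z r * q ^ (n - r) * baileyKernel q (n - 1) (r - 1) =
      -(z * q ^ (n - 1)) * ∑' r, tripleTerm q z r * baileyKernel q (n - 1) r := by
    rw [← (Equiv.addRight (1 : ℤ)).tsum_eq, ← tsum_mul_left]
    refine tsum_congr fun r => ?_
    have hr : q ^ r ≠ 0 := zpow_ne_zero _ hq0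
    simp only [Equiv.coe_addRight, tripleTerm_add_one hq0 hz, add_sub_cancel_right,
      show n - (r + 1) = (n - 1) - r by ring, zpow_sub₀ hq0]
    field_simp
  have e2 : ∑' r, tripleTerm q z r * q ^ (n + r) * baileyKernel q (n - 1) (r + 1) =
      -(q ^ n / z) * ∑' r, tripleTerm q z r * baileyKernel q (n - 1) r := by
    rw [← (Equiv.addRight (1 : ℤ)).tsum_eq (fun r => tripleTerm q z r * baileyKernel q (n - 1) r),
      ← tsum_mul_left]
    refine tsum_congr fun r => ?_
    simp only [Equiv.coe_addRight, tripleTerm_add_one hq0 hz, zpow_add₀ hq0]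
    field_simp
  have s1 : Summable fun r => tripleTerm q z r * q ^ (n - r) * baileyKernel q (n - 1) (r - 1) := by
    have := summable_mul_baileyKernel (q := q)
      (fun r => tripleTerm q z (r + 1) * q ^ (n - (r + 1))) (n - 1)
    rw [← (Equiv.addRight (1 : ℤ)).summable_iff]
    simpa [Function.comp_def] using this
  have s2 : Summable fun r => tripleTerm q z r * q ^ (n + r) * baileyKernel q (n - 1) (r + 1) := by
    have := summable_mul_baileyKernel (q := q)
      (fun r => tripleTerm q z (r - 1) * q ^ (n + (r - 1))) (n - 1)
    rw [← (Equiv.subRight (1 : ℤ)).summable_iff]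
    simpa [Function.comp_def] using this
  have s0 := summable_mul_baileyKernel (q := q) (tripleTerm q z) (n - 1)
  have h : ∀ r, (1 - q ^ (2 * n)) * (1 - q ^ (2 * n - 1)) *
      (tripleTerm q z r * baileyKernel q n r) =
      (1 + q ^ (2 * n - 1)) * (tripleTerm q z r * baileyKernel q (n - 1) r) +
        tripleTerm q z r * q ^ (n - r) * baileyKernel q (n - 1) (r - 1) +
        tripleTerm q z r * q ^ (n + r) * baileyKernel q (n - 1) (r + 1) := by
    intro r
    linear_combination tripleTerm q z r * baileyKernel_pascal hq hq0 n r
  rw [← tsum_mul_left, tsum_congr h, ((s0.mul_left _).add s1).tsum_add s2,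
    (s0.mul_left _).tsum_add s1, tsum_mul_left, e1, e2,
    show 2 * n - 1 = (n - 1) + n by ring, zpow_add₀ hq0]
  field_simp
  ring

/-- Cauchy's finite form of the triple product; letting `n → ∞` gives the infinite one. -/
lemma finite_triple (hq : ‖q‖ < 1) (hq0 : q ≠ 0) {z : ℂ} (hz : z ≠ 0) (n : ℕ) :
    ∑' r, tripleTerm q z r * baileyKernel q n r =
      qPoch z q n * qPoch (q / z) q n * qInvFac q (2 * n) := by
  induction n with
  | zero =>
    rw [tsum_eq_single 0]
    · simp [tripleTerm, tri, baileyKernel, qInvFac_zero, qPoch_zero]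
    · intro r hr
      rw [baileyKernel_eq_zero (by simpa using hr), mul_zero]
  | succ n ih =>
    have h := finite_triple_step hq hq0 hz (n + 1)
    have h1 : (1 : ℂ) - q ^ (2 * ((n : ℤ) + 1)) ≠ 0 := one_sub_zpow_ne_zero hq (by omega)
    have h2 : (1 : ℂ) - q ^ (2 * ((n : ℤ) + 1) - 1) ≠ 0 := one_sub_zpow_ne_zero hq (by omega)
    rw [add_sub_cancel_right, ih] at h
    have h3 := qInvFac_sub_one hq (2 * ((n : ℤ) + 1))
    have h4 := qInvFac_sub_one hq (2 * ((n : ℤ) + 1) - 1)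
    rw [h3, show 2 * ((n : ℤ) + 1) - 1 - 1 = 2 * n by ring] at h4
    have h5 : (q : ℂ) ^ ((n : ℤ) + 1) = q ^ n * q := by
      rw [zpow_add₀ hq0, zpow_natCast, zpow_one]
    rw [h4, h5, zpow_natCast] at h
    push_cast
    apply mul_left_cancel₀ (mul_ne_zero h1 h2)
    rw [h, qPoch_succ, qPoch_succ]
    ring

lemma tendsto_tsum_mul_baileyKernel (hq : ‖q‖ < 1) {f : ℤ → ℂ} (hf : Summable fun r => ‖f r‖) :
    Tendsto (fun n : ℕ => ∑' r, f r * baileyKernel q n r) atTop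
      (𝓝 ((∑' r, f r) * (qPochInf q q)⁻¹ ^ 2)) := by
  obtain ⟨C, hC0, hC⟩ := exists_norm_qInvFac_le hq
  rw [← tsum_mul_right]
  refine tendsto_tsum_of_dominated_convergence (bound := fun r => ‖f r‖ * (C * C))
    (hf.mul_right _) ?_ ?_
  · intro r
    rw [pow_two]
    refine Tendsto.const_mul _ (Tendsto.mul ?_ ?_)
    · refine (tendsto_qInvFac_atTop hq).comp ?_
      exact tendsto_atTop_add_const_right _ (-r) tendsto_natCast_atTop_atTop
    · refine (tendsto_qInvFac_atTop hq).comp ?_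
      exact tendsto_atTop_add_const_right _ r tendsto_natCast_atTop_atTop
  · refine Eventually.of_forall fun n r => ?_
    rw [norm_mul, baileyKernel, norm_mul]
    gcongr <;> apply hC

/-- The Jacobi triple product. -/
theorem tsum_tripleTerm (hq : ‖q‖ < 1) (hq0 : q ≠ 0) {z : ℂ} (hz : z ≠ 0) :
    ∑' r, tripleTerm q z r = jacProd z q * qPochInf q q := by
  have h1 := tendsto_tsum_mul_baileyKernel hq (summable_norm_tripleTerm hq hq0 hz)
  have h2 := ((tendsto_qPoch hq z).mul (tendsto_qPoch hq (q / z))).mul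
    ((tendsto_qInvFac_atTop hq).comp
      (tendsto_natCast_atTop_atTop.const_mul_atTop' (zero_lt_two : (0 : ℤ) < 2)))
  have h3 := tendsto_nhds_unique h1 (h2.congr fun n => (finite_triple hq hq0 hz n).symm)
  have h0 := qPochInf_ne_zero_of_norm_lt hq hq
  rw [jacProd]
  field_simp at h3
  linear_combination h3

/-! ### The partial fraction expansion -/

/-- Writing `1 - q^(2n) = (1 - q^(n+r)) + q^(n+r) (1 - q^(n-r))` turns the sum into `U - q^n U`, and
`U = 0` because its summand is odd under `r ↦ 1 - r`. -/
lemma tsum_alternating_baileyKernel (hq : ‖q‖ < 1) (hq0 : q ≠ 0) {n : ℤ} (hn : 0 < n) :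
    ∑' r, tripleTerm q 1 r * baileyKernel q n r = 0 := by
  have s : Summable fun r => tripleTerm q 1 r * (qInvFac q (n - r) * qInvFac q (n + r - 1)) := by
    refine (summable_mul_baileyKernel (q := q) (fun r => tripleTerm q 1 r * (1 - q ^ (n + r)))
      n).congr fun r => ?_
    rw [baileyKernel, qInvFac_sub_one hq]
    ring
  set U := ∑' r, tripleTerm q 1 r * (qInvFac q (n - r) * qInvFac q (n + r - 1)) with hU
  have hU0 : U = 0 := by
    have : U = -U := by
      conv_lhs => rw [hU, ← (Equiv.subLeft (1 : ℤ)).tsum_eq]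
      rw [hU, ← tsum_neg]
      refine tsum_congr fun r => ?_
      have h1 : tripleTerm q 1 (1 - r) = -tripleTerm q 1 r := by
        rw [tripleTerm, tripleTerm, tri_one_sub, zpow_sub₀ (by norm_num : (-1 : ℂ) ≠ 0)]
        rcases neg_one_pow_eq_or ℂ r.natAbs with h | h <;>
        rcases Int.even_or_odd r with h' | h' <;> simp [h'.neg_one_zpow]
      rw [Equiv.subLeft_apply, h1, show n - (1 - r) = n + r - 1 by ring,
        show n + (1 - r) - 1 = n - r by ring]
      ring
    linear_combination this / 2
  have e1 : ∑' r, tripleTerm q 1 r * q ^ (n + r) * (qInvFac q (n - r - 1) * qInvFac q (n + r)) =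
      -q ^ n * U := by
    rw [hU, ← (Equiv.addRight (1 : ℤ)).tsum_eq
      (fun r => tripleTerm q 1 r * (qInvFac q (n - r) * qInvFac q (n + r - 1))), ← tsum_mul_left]
    refine tsum_congr fun r => ?_
    simp only [Equiv.coe_addRight, tripleTerm_add_one hq0 one_ne_zero, zpow_add₀ hq0]
    rw [show n - (r + 1) = n - r - 1 by ring, show n + (r + 1) - 1 = n + r by ring]
    ring
  have s1 : Summable fun r =>
      tripleTerm q 1 r * q ^ (n + r) * (qInvFac q (n - r - 1) * qInvFac q (n + r)) := by
    refine (summable_mul_baileyKernel (q := q)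
      (fun r => tripleTerm q 1 r * q ^ (n + r) * (1 - q ^ (n - r))) n).congr fun r => ?_
    rw [baileyKernel, qInvFac_sub_one hq (n - r)]
    ring
  have h : (1 - q ^ (2 * n)) * ∑' r, tripleTerm q 1 r * baileyKernel q n r = 0 := by
    rw [← tsum_mul_left]
    have : ∀ r, (1 - q ^ (2 * n)) * (tripleTerm q 1 r * baileyKernel q n r) =
        tripleTerm q 1 r * (qInvFac q (n - r) * qInvFac q (n + r - 1)) +
        tripleTerm q 1 r * q ^ (n + r) * (qInvFac q (n - r - 1) * qInvFac q (n + r)) := by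
      intro r
      rw [baileyKernel, qInvFac_sub_one hq, qInvFac_sub_one hq,
        show 2 * n = (n + r) + (n - r) by ring, zpow_add₀ hq0]
      ring
    rw [tsum_congr this, s.tsum_add s1, e1, ← hU, hU0]
    ring
  exact (mul_eq_zero.mp h).resolve_left (one_sub_zpow_ne_zero hq (by omega))

lemma one_sub_inv_mul_ne_zero {z : ℂ} (hz : z ≠ 0) (hzq : ∀ r : ℤ, 1 - z * q ^ r ≠ 0) (r : ℤ) :
    1 - q ^ r / z ≠ 0 := by
  intro h
  apply hzq (-r)
  rw [zpow_neg]
  have h1 : q ^ r = z := by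
    field_simp at h
    linear_combination -h
  rw [h1, mul_inv_cancel₀ hz, sub_self]

/-- The difference `(1 - z q^n)(1 - q^n/z) - (1 - q^(n-r))(1 - q^(n+r))` equals `q^n (1 - z
q^r)(q^(-r) - 1/z)`. The denominator cancels in it, and what is left are two alternating kernel sums
that vanish. -/
lemma partialFraction_step (hq : ‖q‖ < 1) (hq0 : q ≠ 0) {z : ℂ} (hz : z ≠ 0)
    (hzq : ∀ r : ℤ, 1 - z * q ^ r ≠ 0) {n : ℤ} (hn : 0 < n) :
    (1 - z * q ^ n) * (1 - q ^ n / z) *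
        ∑' r, tripleTerm q q r / (1 - z * q ^ r) * baileyKernel q n r =
      ∑' r, tripleTerm q q r / (1 - z * q ^ r) * baileyKernel q (n - 1) r := by
  have hqq : ∀ r, tripleTerm q q r = q ^ r * tripleTerm q 1 r := by
    intro r
    rw [tripleTerm, tripleTerm, one_zpow]
    ring
  have hz1 : ∑' r, tripleTerm q q r * baileyKernel q n r = 0 := by
    rw [← (Equiv.neg ℤ).tsum_eq, ← tsum_alternating_baileyKernel hq hq0 hn]
    refine tsum_congr fun r => ?_
    rw [Equiv.neg_apply, baileyKernel_neg, tripleTerm, tripleTerm, tri_neg, one_zpow,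
      zpow_neg (-1 : ℂ), ← inv_zpow, zpow_add₀ hq0, zpow_neg]
    have := zpow_ne_zero r hq0
    field_simp
  have hstep : ∀ r, (1 - z * q ^ n) * (1 - q ^ n / z) *
        (tripleTerm q q r / (1 - z * q ^ r) * baileyKernel q n r) =
      tripleTerm q q r / (1 - z * q ^ r) * baileyKernel q (n - 1) r +
      (q ^ n * (tripleTerm q 1 r * baileyKernel q n r) -
        q ^ n / z * (tripleTerm q q r * baileyKernel q n r)) := by
    intro r
    rw [baileyKernel_sub_one hq, hqq]
    have h1 := hzq r
    have hn : q ^ n ≠ 0 := zpow_ne_zero _ hq0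
    have hr : q ^ r ≠ 0 := zpow_ne_zero _ hq0
    simp only [zpow_add₀ hq0, zpow_sub₀ hq0]
    field_simp
    ring
  rw [← tsum_mul_left, tsum_congr hstep, Summable.tsum_add (summable_mul_baileyKernel _ _)
    (((summable_mul_baileyKernel _ _).mul_left _).sub
      ((summable_mul_baileyKernel _ _).mul_left _)), Summable.tsum_sub
      ((summable_mul_baileyKernel _ _).mul_left _)
      ((summable_mul_baileyKernel _ _).mul_left _), tsum_mul_left, tsum_mul_left, hz1,
    tsum_alternating_baileyKernel hq hq0 hn]
  ring

/-- This makes the dependence of the rank series on `z` explicit: all poles in `z` are simple, and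
`n` enters only through the kernel, so the sum over `n` can be done separately. -/
lemma partialFraction (hq : ‖q‖ < 1) (hq0 : q ≠ 0) {z : ℂ} (hz : z ≠ 0)
    (hzq : ∀ r : ℤ, 1 - z * q ^ r ≠ 0) (n : ℕ) :
    (1 - z) * ∑' r, tripleTerm q q r / (1 - z * q ^ r) * baileyKernel q n r =
      1 / (qPoch (z * q) q n * qPoch (z⁻¹ * q) q n) := by
  induction n with
  | zero =>
    rw [tsum_eq_single 0]
    · have := hzq 0
      rw [zpow_zero, mul_one] at this
      simp [tripleTerm, tri, baileyKernel, qInvFac_zero, qPoch_zero]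
      field_simp
    · intro r hr
      rw [baileyKernel_eq_zero (by simpa using hr), mul_zero]
  | succ n ih =>
    have h := partialFraction_step hq hq0 hz hzq (n := n + 1) (by omega)
    rw [add_sub_cancel_right] at h
    rw [← h] at ih
    have h5 : (q : ℂ) ^ ((n : ℤ) + 1) = q ^ n * q := by
      rw [zpow_add₀ hq0, zpow_natCast, zpow_one]
    have h1 := hzq (n + 1)
    have h2 := one_sub_inv_mul_ne_zero hz hzq (n + 1)
    rw [h5] at ih h1 h2
    rw [qPoch_succ, qPoch_succ]
    have e1 : 1 - z * q * q ^ n = 1 - z * (q ^ n * q) := by ring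
    have e2 : 1 - z⁻¹ * q * q ^ n = 1 - q ^ n * q / z := by ring
    rw [e1, e2]
    push_cast
    apply mul_left_cancel₀ (mul_ne_zero h1 h2)
    rw [show ∀ a b c d : ℂ, a * b * (c * d) = c * (a * b * d) by intros; ring, ih]
    rw [mul_mul_mul_comm (qPoch _ _ _), mul_one_div, mul_comm (qPoch _ _ _ * qPoch _ _ _),
      ← div_div (_ * _) (_ * _) (_ * _), div_self (mul_ne_zero h1 h2)]

lemma summable_norm_tripleTerm_div (hq : ‖q‖ < 1) (hq0 : q ≠ 0) {z w : ℂ} (hz : z ≠ 0)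
    (hw : w ≠ 0) : Summable fun r => ‖tripleTerm q w r / (1 - z * q ^ r)‖ := by
  obtain ⟨C, -, hC⟩ := exists_norm_inv_one_sub_le hq hz hq0
  refine Summable.of_nonneg_of_le (fun _ => norm_nonneg _) (fun r => ?_)
    ((summable_norm_tripleTerm hq hq0 hw).mul_right C)
  rw [div_eq_mul_inv, norm_mul]
  gcongr
  exact hC r

/-- The partial fraction expansion of the reciprocal of the theta product. -/
theorem tsum_tripleTerm_div (hq : ‖q‖ < 1) (hq0 : q ≠ 0) {z : ℂ} (hz : z ≠ 0)
    (hzq : ∀ r : ℤ, 1 - z * q ^ r ≠ 0) :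
    ∑' r, tripleTerm q q r / (1 - z * q ^ r) = qPochInf q q ^ 2 / jacProd z q := by
  have h1 := (tendsto_tsum_mul_baileyKernel hq
    (summable_norm_tripleTerm_div hq hq0 hz hq0)).const_mul (1 - z)
  have n1 : qPochInf (z * q) q ≠ 0 := qPochInf_ne_zero hq fun j => by
    have := hzq (j + 1)
    rwa [zpow_add₀ hq0, zpow_natCast, zpow_one, mul_comm _ q, ← mul_assoc] at this
  have n2 : qPochInf (z⁻¹ * q) q ≠ 0 := qPochInf_ne_zero hq fun j => by
    have := one_sub_inv_mul_ne_zero hz hzq (j + 1)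
    rw [zpow_add₀ hq0, zpow_natCast, zpow_one] at this
    rwa [show z⁻¹ * q * q ^ j = q ^ j * q / z by ring]
  have h2 := ((tendsto_qPoch hq (z * q)).mul (tendsto_qPoch hq (z⁻¹ * q))).inv₀ (mul_ne_zero n1 n2)
  have h3 := tendsto_nhds_unique h1 (h2.congr fun n => by
    rw [partialFraction hq hq0 hz hzq n, one_div])
  have h0 := qPochInf_ne_zero_of_norm_lt hq hq
  have hz1 := hzq 0
  rw [zpow_zero, mul_one] at hz1
  rw [jacProd, qPochInf_eq_mul hq z, show q / z = z⁻¹ * q by ring]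
  field_simp at h3 ⊢
  linear_combination h3

end TripleProduct

/-! ### The overpartition rank series as an Appell sum. -/

section RankIdentity

variable {q : ℂ}

lemma qPochInf_neg_mul_self (hq : ‖q‖ < 1) :
    qPochInf (-q) q * qPochInf q q = qPochInf (q ^ 2) (q ^ 2) := by
  rw [qPochInf, qPochInf, qPochInf, ← Multipliable.tprod_mul (multipliable_qPochInf hq _)
    (multipliable_qPochInf hq _)]
  exact tprod_congr fun j => by ring

lemma norm_sq_lt_one (hq : ‖q‖ < 1) : ‖q ^ 2‖ < 1 := by
  rw [norm_pow]
  exact pow_lt_one₀ (norm_nonneg _) hq two_ne_zero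

lemma qPochInf_odd_mul_even (hq : ‖q‖ < 1) :
    qPochInf q (q ^ 2) * qPochInf (q ^ 2) (q ^ 2) = qPochInf q q := by
  have h1 := multipliable_qPochInf (norm_sq_lt_one hq) q
  have h2 := multipliable_qPochInf (norm_sq_lt_one hq) (q ^ 2)
  rw [qPochInf, qPochInf, qPochInf, ← tprod_even_mul_odd (f := fun j => 1 - q * q ^ j)
    (h1.congr fun j => by ring) (h2.congr fun j => by ring)]
  congr 1 <;> exact tprod_congr fun j => by ring

/-- Euler's identity between partitions into distinct parts and into odd parts. -/
lemma qPochInf_neg_mul_odd (hq : ‖q‖ < 1) : qPochInf (-q) q * qPochInf q (q ^ 2) = 1 := by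
  have h0 := qPochInf_ne_zero_of_norm_lt (norm_sq_lt_one hq) (norm_sq_lt_one hq)
  apply mul_right_cancel₀ h0
  rw [mul_assoc, qPochInf_odd_mul_even hq, qPochInf_neg_mul_self hq, one_mul]

/-- Gauss's product for `∑ (-1) ^ r q ^ (r ^ 2)`. -/
lemma tsum_alternating_sq (hq : ‖q‖ < 1) (hq0 : q ≠ 0) :
    qPochInf (-q) q * ∑' r, tripleTerm (q ^ 2) q r = qPochInf q q := by
  rw [tsum_tripleTerm (norm_sq_lt_one hq) (pow_ne_zero 2 hq0) hq0, jacProd,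
    show q ^ 2 / q = q by field_simp, ← qPochInf_odd_mul_even hq]
  linear_combination (qPochInf q (q ^ 2) * qPochInf (q ^ 2) (q ^ 2)) * qPochInf_neg_mul_odd hq

/-- `(-1; q)_n q ^ (n (n + 1) / 2)`. -/
def rankWeight (q : ℂ) (n : ℕ) : ℂ := qPoch (-1) q n * q ^ (n * (n + 1) / 2)

lemma choose_triangle_succ (n : ℕ) : (n + 1) * (n + 1 + 1) / 2 = n * (n + 1) / 2 + (n + 1) := by
  rw [show (n + 1) * (n + 1 + 1) = n * (n + 1) + (n + 1) * 2 by ring,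
    Nat.add_mul_div_right _ _ two_pos]

lemma triangle_add (m r : ℕ) :
    (m + r) * (m + r + 1) / 2 = r * (r + 1) / 2 + (m * (m + 1) / 2 + m * r) := by
  induction m with
  | zero => simp
  | succ m ih =>
    rw [show m + 1 + r = m + r + 1 by ring, choose_triangle_succ, ih, choose_triangle_succ]
    ring

lemma le_triangle (n : ℕ) : n ≤ n * (n + 1) / 2 := by
  rcases n with _ | n
  · simp
  · rw [choose_triangle_succ]
    omega

lemma rankWeight_succ (n : ℕ) :
    rankWeight q (n + 1) = rankWeight q n * ((1 + q ^ n) * q ^ (n + 1)) := by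
  rw [rankWeight, rankWeight, qPoch_succ, choose_triangle_succ, pow_add q (n * (n + 1) / 2)]
  ring

lemma exists_norm_qPoch_le (hq : ‖q‖ < 1) (z : ℂ) : ∃ C : ℝ, 0 ≤ C ∧ ∀ n, ‖qPoch z q n‖ ≤ C := by
  obtain ⟨C, hC⟩ := (Metric.isBounded_range_of_tendsto _ (tendsto_qPoch hq z)).exists_norm_le
  exact ⟨C, (norm_nonneg _).trans (hC _ ⟨0, rfl⟩), fun n => hC _ ⟨n, rfl⟩⟩

lemma summable_norm_rankWeight (hq : ‖q‖ < 1) : Summable fun n => ‖rankWeight q n‖ := by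
  obtain ⟨C, hC0, hC⟩ := exists_norm_qPoch_le hq (-1)
  refine Summable.of_nonneg_of_le (fun _ => norm_nonneg _) (fun n => ?_)
    ((summable_geometric_of_lt_one (norm_nonneg _) hq).mul_left C)
  rw [rankWeight, norm_mul, norm_pow]
  exact mul_le_mul (hC n) (pow_le_pow_of_le_one (norm_nonneg _) hq.le (le_triangle n))
    (by positivity) hC0

lemma summable_rankWeight_mul (hq : ‖q‖ < 1) {f : ℕ → ℂ} {C : ℝ} (hf : ∀ n, ‖f n‖ ≤ C) :
    Summable fun n => rankWeight q n * f n := by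
  refine Summable.of_norm_bounded ((summable_norm_rankWeight hq).mul_right C) fun n => ?_
  rw [norm_mul]
  gcongr
  exact hf n

lemma exists_norm_qInvFac_mul_le (hq : ‖q‖ < 1) :
    ∃ C : ℝ, ∀ m m' : ℤ, ‖qInvFac q m * qInvFac q m'‖ ≤ C := by
  obtain ⟨C, hC0, hC⟩ := exists_norm_qInvFac_le hq
  refine ⟨C * C, fun m m' => ?_⟩
  rw [norm_mul]
  exact mul_le_mul (hC _) (hC _) (norm_nonneg _) hC0

/-- The series `∑_n (-1; q)_n q ^ (n (n + 1) / 2) / ((q; q)_{n - r} (q; q)_{n + r})`. -/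
def rankKernel (q : ℂ) (r : ℤ) : ℂ := ∑' n : ℕ, rankWeight q n * baileyKernel q n r

lemma summable_rankWeight_mul_baileyKernel (hq : ‖q‖ < 1) (r : ℤ) :
    Summable fun n : ℕ => rankWeight q n * baileyKernel q n r := by
  obtain ⟨C, hC⟩ := exists_norm_qInvFac_mul_le hq
  exact summable_rankWeight_mul hq fun n => hC _ _

/-- Creative telescoping: the combination of the two summands is `G (n + 1) - G n`. The boundary
terms vanish, since `G` tends to `0` and `G 0` contains `1/(q;q)` at the negative index `-r - 1`. -/
lemma rankKernel_succ (hq : ‖q‖ < 1) (hq0 : q ≠ 0) (r : ℕ) :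
    (1 + q ^ (r + 1)) * rankKernel q (r + 1 : ℕ) = q ^ (r + 1) * ((1 + q ^ r) * rankKernel q r) := by
  obtain ⟨C, hC⟩ := exists_norm_qInvFac_mul_le hq
  set G : ℕ → ℂ := fun n => (1 - q ^ (2 * (r : ℤ) + 1)) *
    (rankWeight q n * (qInvFac q (n - r - 1) * qInvFac q (n + r))) with hG
  have sG : Summable fun n : ℕ => rankWeight q n * (qInvFac q (n - r - 1) * qInvFac q (n + r)) :=
    summable_rankWeight_mul hq fun n => hC _ _
  have hG0 : Tendsto G atTop (𝓝 0) := by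
    simpa using sG.tendsto_atTop_zero.const_mul (1 - q ^ (2 * (r : ℤ) + 1))
  have hterm : ∀ n : ℕ, q ^ (r + 1) * (1 + q ^ r) * (rankWeight q n * baileyKernel q n r) -
      (1 + q ^ (r + 1)) * (rankWeight q n * baileyKernel q n (r + 1 : ℕ)) = G (n + 1) - G n := by
    intro n
    have h1 : baileyKernel q n r =
        (1 - q ^ ((n : ℤ) + r + 1)) * (qInvFac q (n - r) * qInvFac q (n + r + 1)) := by
      rw [baileyKernel, show (n : ℤ) + r = n + r + 1 - 1 by ring, qInvFac_sub_one hq,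
        show (n : ℤ) + r + 1 - 1 + 1 = n + r + 1 by ring]
      ring
    have h2 : baileyKernel q n (r + 1 : ℕ) =
        (1 - q ^ ((n : ℤ) - r)) * (qInvFac q (n - r) * qInvFac q (n + r + 1)) := by
      push_cast
      rw [baileyKernel, show (n : ℤ) - (r + 1) = n - r - 1 by ring, qInvFac_sub_one hq,
        ← add_assoc]
      ring
    have h3 : qInvFac q (n - r - 1) * qInvFac q (n + r) = (1 - q ^ ((n : ℤ) - r)) *
        (1 - q ^ ((n : ℤ) + r + 1)) * (qInvFac q (n - r) * qInvFac q (n + r + 1)) := by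
      rw [show (n : ℤ) + r = n + r + 1 - 1 by ring, qInvFac_sub_one hq, qInvFac_sub_one hq,
        show (n : ℤ) + r + 1 - 1 + 1 = n + r + 1 by ring]
      ring
    simp only [hG, h3]
    rw [h1, h2]
    push_cast
    rw [rankWeight_succ, show (n : ℤ) + 1 - r - 1 = n - r by ring,
      show (n : ℤ) + 1 + r = n + r + 1 by ring]
    have hn : q ^ n ≠ 0 := pow_ne_zero _ hq0
    have hr : q ^ r ≠ 0 := pow_ne_zero _ hq0
    simp only [two_mul, zpow_add₀ hq0, zpow_sub₀ hq0, zpow_one, pow_succ, zpow_natCast]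
    field_simp
    ring
  have s1 := (summable_rankWeight_mul_baileyKernel hq (r : ℤ)).mul_left (q ^ (r + 1) * (1 + q ^ r))
  have s2 := (summable_rankWeight_mul_baileyKernel hq (r + 1 : ℕ)).mul_left (1 + q ^ (r + 1))
  have h1 := (s1.sub s2).hasSum.tendsto_sum_nat
  simp only [hterm, Finset.sum_range_sub] at h1
  have h2 := tendsto_nhds_unique h1 (hG0.sub_const (G 0))
  have h3 : G 0 = 0 := by
    simp only [hG]
    rw [qInvFac_of_neg (by push_cast; omega)]
    ring
  rw [← tsum_congr hterm, s1.tsum_sub s2, tsum_mul_left, tsum_mul_left, h3] at h2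
  rw [rankKernel, rankKernel]
  linear_combination -h2

lemma rankKernel_nat_aux (hq : ‖q‖ < 1) (hq0 : q ≠ 0) (r : ℕ) :
    (1 + q ^ r) * rankKernel q r = q ^ (r * (r + 1) / 2) * (2 * rankKernel q 0) := by
  induction r with
  | zero => norm_num
  | succ r ih =>
    rw [rankKernel_succ hq hq0, ih, choose_triangle_succ, pow_add q (r * (r + 1) / 2)]
    ring

/-- The recurrence expresses the value at `0` through the value at every `r`, so it can be read off
in the limit `r → ∞`, where a single term survives. -/
lemma two_mul_rankKernel_zero (hq : ‖q‖ < 1) (hq0 : q ≠ 0) :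
    2 * rankKernel q 0 = 2 * (qPochInf (-q) q / qPochInf q q) := by
  obtain ⟨C, hC0, hC⟩ := exists_norm_qPoch_le hq (-1)
  obtain ⟨C', hC'⟩ := exists_norm_qInvFac_mul_le hq
  have hpow := tendsto_pow_atTop_nhds_zero_of_norm_lt_one hq
  -- The terms with `n < r` vanish; put `n = m + r` and cancel `q ^ (r (r + 1) / 2)`. As `r → ∞` the
  -- remaining power `q ^ (m r)` kills every `m > 0`.
  have h1 : ∀ r : ℕ, (1 + q ^ r) * ∑' m : ℕ, qPoch (-1) q (m + r) * q ^ (m * (m + 1) / 2 + m * r) *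
      (qInvFac q m * qInvFac q (m + 2 * r)) = 2 * rankKernel q 0 := by
    intro r
    have hr : q ^ (r * (r + 1) / 2) ≠ 0 := pow_ne_zero _ hq0
    apply mul_left_cancel₀ hr
    rw [← rankKernel_nat_aux hq hq0, rankKernel,
      ← (summable_rankWeight_mul_baileyKernel hq r).sum_add_tsum_nat_add r,
      Finset.sum_eq_zero, zero_add, mul_left_comm]
    · rw [← tsum_mul_left]
      congr 1
      refine tsum_congr fun m => ?_
      rw [rankWeight, triangle_add, baileyKernel, pow_add q (r * (r + 1) / 2)]
      push_cast
      rw [add_sub_cancel_right, show (m : ℤ) + r + r = m + 2 * r by ring]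
      ring
    · intro n hn
      rw [baileyKernel_eq_zero, mul_zero]
      have := Finset.mem_range.mp hn
      simpa using this
  have h2 : Tendsto (fun r : ℕ => ∑' m : ℕ, qPoch (-1) q (m + r) * q ^ (m * (m + 1) / 2 + m * r) *
      (qInvFac q m * qInvFac q (m + 2 * r))) atTop
      (𝓝 (∑' m : ℕ, if m = 0 then qPochInf (-1) q * (qPochInf q q)⁻¹ else 0)) := by
    refine tendsto_tsum_of_dominated_convergence (bound := fun m => C * ‖q‖ ^ m * C')
      (((summable_geometric_of_lt_one (norm_nonneg _) hq).mul_left C).mul_right C') ?_ ?_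
    · intro m
      have hP : Tendsto (fun r => qPoch (-1) q (m + r)) atTop (𝓝 (qPochInf (-1) q)) :=
        (tendsto_qPoch hq (-1)).comp (tendsto_atTop_mono (fun r => Nat.le_add_left r m) tendsto_id)
      have hI : Tendsto (fun r : ℕ => qInvFac q (m + 2 * r)) atTop (𝓝 (qPochInf q q)⁻¹) :=
        (tendsto_qInvFac_atTop hq).comp (tendsto_atTop_add_const_left _ _
          (tendsto_natCast_atTop_atTop.const_mul_atTop' (zero_lt_two : (0 : ℤ) < 2)))
      split_ifs with hm
      · subst hm
        simpa [qInvFac_zero] using hP.mul (by simpa using hI)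
      · have hz : Tendsto (fun r : ℕ => q ^ (m * (m + 1) / 2 + m * r)) atTop (𝓝 0) :=
          hpow.comp (tendsto_atTop_mono (fun r => (Nat.le_mul_of_pos_left r
            (Nat.pos_of_ne_zero hm)).trans (Nat.le_add_left _ _)) tendsto_id)
        simpa using (hP.mul hz).mul (hI.const_mul (qInvFac q m))
    · refine Eventually.of_forall fun r m => ?_
      rw [norm_mul, norm_mul, norm_pow]
      have : ‖q‖ ^ (m * (m + 1) / 2 + m * r) ≤ ‖q‖ ^ m :=
        pow_le_pow_of_le_one (norm_nonneg _) hq.le ((le_triangle m).trans (Nat.le_add_right _ _))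
      gcongr
      · exact hC _
      · exact hC' _ _
  rw [tsum_ite_eq] at h2
  have h3 := (hpow.const_add 1).mul h2
  rw [tendsto_nhds_unique (tendsto_const_nhds.congr fun r => (h1 r).symm) h3,
    qPochInf_eq_mul hq (-1), neg_one_mul]
  ring

lemma one_add_zpow_ne_zero (hq : ‖q‖ < 1) (hq0 : q ≠ 0) (r : ℤ) : 1 + q ^ r ≠ 0 := by
  intro h
  have h1 : ‖q‖ ^ r = 1 := by
    rw [← norm_zpow, ← norm_neg, show -q ^ r = 1 by linear_combination -h, norm_one]
  rcases lt_trichotomy r 0 with h0 | h0 | h0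
  · exact (one_lt_zpow_of_neg₀ (norm_pos_iff.mpr hq0) hq h0).ne' h1
  · subst h0
    norm_num at h
  · exact (zpow_lt_one₀ (norm_pos_iff.mpr hq0) hq h0).ne h1

lemma rankKernel_eq (hq : ‖q‖ < 1) (hq0 : q ≠ 0) (r : ℤ) :
    rankKernel q r = 2 * q ^ (tri r + r) / (1 + q ^ r) * (qPochInf (-q) q / qPochInf q q) := by
  have key : ∀ n : ℕ, rankKernel q n =
      2 * q ^ (tri n + n) / (1 + q ^ n) * (qPochInf (-q) q / qPochInf q q) := by
    intro n
    have h := rankKernel_nat_aux hq hq0 n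
    rw [two_mul_rankKernel_zero hq hq0] at h
    have h1 : (q : ℂ) ^ (tri n + n) = q ^ (n * (n + 1) / 2) := by
      rw [← zpow_natCast]
      congr 1
      rw [← tri_add_one, tri]
      push_cast
      ring_nf
    have h2 := one_add_zpow_ne_zero hq hq0 n
    rw [zpow_natCast] at h2
    rw [h1, div_mul_eq_mul_div, eq_div_iff h2]
    linear_combination h
  rcases Int.eq_nat_or_neg r with ⟨n, rfl | rfl⟩
  · rw [key, zpow_natCast]
  · have h0 : rankKernel q (-n) = rankKernel q n := by
      simp only [rankKernel, baileyKernel_neg]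
    have h2 := one_add_zpow_ne_zero hq hq0 n
    have h3 : q ^ n ≠ 0 := pow_ne_zero _ hq0
    rw [h0, key, tri_neg]
    rw [zpow_natCast] at h2
    simp only [zpow_add₀ hq0, zpow_neg, zpow_natCast]
    congr 1
    rw [div_eq_div_iff h2 (by
      rw [show (1 : ℂ) + (q ^ n)⁻¹ = (1 + q ^ n) / q ^ n by field_simp; ring]
      exact div_ne_zero h2 h3)]
    field_simp
    ring

/-- The generating series of overpartition ranks as a series over `ℤ`. -/
lemma tsum_rank_eq (hq : ‖q‖ < 1) (hq0 : q ≠ 0) {z : ℂ} (hz : z ≠ 0)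
    (hzq : ∀ r : ℤ, 1 - z * q ^ r ≠ 0) :
    ∑' n : ℕ, rankWeight q n / (qPoch (z * q) q n * qPoch (z⁻¹ * q) q n) =
      (1 - z) * ∑' r, tripleTerm q q r / (1 - z * q ^ r) * rankKernel q r := by
  obtain ⟨C, hC⟩ := exists_norm_qInvFac_mul_le hq
  have h1 : ∀ n : ℕ, rankWeight q n / (qPoch (z * q) q n * qPoch (z⁻¹ * q) q n) =
      (1 - z) * ∑' r, rankWeight q n * (tripleTerm q q r / (1 - z * q ^ r)) *
        baileyKernel q n r := by
    intro n
    rw [div_eq_mul_one_div, ← partialFraction hq hq0 hz hzq n, mul_left_comm]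
    simp only [mul_assoc, tsum_mul_left]
  rw [tsum_congr h1, tsum_mul_left]
  congr 1
  have hs : Summable (Function.uncurry fun (n : ℕ) (r : ℤ) =>
      rankWeight q n * (tripleTerm q q r / (1 - z * q ^ r)) * baileyKernel q n r) := by
    refine Summable.of_norm_bounded (((summable_norm_rankWeight hq).mul_of_nonneg
      (summable_norm_tripleTerm_div hq hq0 hz hq0) (fun _ => norm_nonneg _)
      (fun _ => norm_nonneg _)).mul_right C) ?_
    rintro ⟨n, r⟩
    simp only [Function.uncurry, norm_mul (_ * _)]
    rw [norm_mul (rankWeight _ _)]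
    gcongr
    exact hC _ _
  rw [← hs.tsum_comm]
  refine tsum_congr fun r => ?_
  rw [rankKernel, ← tsum_mul_left]
  exact tsum_congr fun n => by ring

lemma tripleTerm_sq (hq0 : q ≠ 0) (k : ℕ) (r : ℤ) :
    tripleTerm (q ^ 2) (q ^ k) r = (-1) ^ r * q ^ (r * (r - 1) + k * r) := by
  rw [tripleTerm, ← two_mul_tri, zpow_add₀ hq0, zpow_mul, zpow_mul, mul_assoc]
  norm_cast

/-- By `rankKernel_eq` the summand has denominator `(1 - z q^r)(1 + q^r)`, whose reciprocal is
`(z/(1 - z q^r) + 1/(1 + q^r))/(1 + z)`. Then `z/(1 - z q^r) = (z + z² q^r)/(1 - z² q^(2r))`: the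
part with `z` is a reciprocal theta product, the part with `z²` is the Appell sum. -/
theorem tsum_rank_eq_appell (hq : ‖q‖ < 1) (hq0 : q ≠ 0) {z : ℂ} (hz : z ≠ 0)
    (hzq : ∀ r : ℤ, 1 - z * q ^ r ≠ 0) (hzq' : ∀ r : ℤ, 1 + z * q ^ r ≠ 0) :
    ∑' n : ℕ, rankWeight q n / (qPoch (z * q) q n * qPoch (z⁻¹ * q) q n) =
      (1 - z) / (1 + z) * (2 * z * (qPochInf (-q) q * qPochInf (q ^ 2) (q ^ 2) ^ 2 /
        (qPochInf q q * jacProd (z ^ 2) (q ^ 2))) + 1 +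
        2 * z ^ 2 * (qPochInf (-q) q / qPochInf q q) *
          ∑' r, tripleTerm (q ^ 2) (q ^ 3) r / (1 - z ^ 2 * (q ^ 2) ^ r)) := by
  have hq2 := norm_sq_lt_one hq
  have hq20 : q ^ 2 ≠ 0 := pow_ne_zero 2 hq0
  have hq30 : q ^ 3 ≠ 0 := pow_ne_zero 3 hq0
  have hz20 : z ^ 2 ≠ 0 := pow_ne_zero 2 hz
  have hsq : ∀ r : ℤ, (1 - z * q ^ r) * (1 + z * q ^ r) = 1 - z ^ 2 * (q ^ 2) ^ r := by
    intro r
    rw [show (q ^ 2) ^ r = (q ^ r) ^ 2 by rw [← zpow_natCast q, ← zpow_mul, mul_comm, zpow_mul]; rfl]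
    ring
  have hz2 : ∀ r : ℤ, 1 - z ^ 2 * (q ^ 2) ^ r ≠ 0 := fun r =>
    (hsq r) ▸ mul_ne_zero (hzq r) (hzq' r)
  have hκ0 := qPochInf_ne_zero_of_norm_lt hq hq
  set κ := qPochInf (-q) q / qPochInf q q with hκ
  have hz1 : 1 + z ≠ 0 := by simpa using hzq' 0
  have t1 : ∀ r : ℤ, q ^ r * (tripleTerm (q ^ 2) q r) = tripleTerm (q ^ 2) (q ^ 2) r := by
    intro r
    have := tripleTerm_sq hq0 1 r
    rw [pow_one] at this
    rw [tripleTerm_sq hq0, this, mul_left_comm, ← zpow_add₀ hq0]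
    push_cast
    ring_nf
  have t2 : ∀ r : ℤ, q ^ r * (tripleTerm (q ^ 2) (q ^ 2) r) = tripleTerm (q ^ 2) (q ^ 3) r := by
    intro r
    rw [tripleTerm_sq hq0, tripleTerm_sq hq0, mul_left_comm, ← zpow_add₀ hq0]
    push_cast
    ring_nf
  -- the part independent of `z`
  have sL : Summable fun r : ℤ => tripleTerm (q ^ 2) (q ^ 2) r / (1 + q ^ r) := by
    have := (summable_norm_tripleTerm_div (z := -1) (w := q ^ 2) hq2 hq20
      (by norm_num) hq20).of_norm
    obtain ⟨C, -, hC⟩ := exists_norm_inv_one_sub_le hq (z := -1) (by norm_num) hq0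
    refine Summable.of_norm_bounded ((summable_norm_tripleTerm hq2 hq20 hq20).mul_right C)
      fun r => ?_
    rw [div_eq_mul_inv, norm_mul]
    gcongr
    simpa using hC r
  have sL' : Summable fun r : ℤ => tripleTerm (q ^ 2) q r / (1 + q ^ r) := by
    obtain ⟨C, -, hC⟩ := exists_norm_inv_one_sub_le hq (z := -1) (by norm_num) hq0
    refine Summable.of_norm_bounded ((summable_norm_tripleTerm hq2 hq20 hq0).mul_right C)
      fun r => ?_
    rw [div_eq_mul_inv, norm_mul]
    gcongr
    simpa using hC r
  -- Adding the sum to its image under `r ↦ -r` removes the denominator and leaves Gauss's series `∑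
  -- (-1)^r q^(r²) = 1/κ`.
  have hL : 2 * κ * ∑' r : ℤ, tripleTerm (q ^ 2) (q ^ 2) r / (1 + q ^ r) = 1 := by
    have h1 : ∑' r : ℤ, tripleTerm (q ^ 2) (q ^ 2) r / (1 + q ^ r) =
        ∑' r : ℤ, tripleTerm (q ^ 2) q r / (1 + q ^ r) := by
      rw [← (Equiv.neg ℤ).tsum_eq]
      refine tsum_congr fun r => ?_
      have h2 := one_add_zpow_ne_zero hq hq0 r
      have h3 : q ^ r ≠ 0 := zpow_ne_zero _ hq0
      have h4 : tripleTerm (q ^ 2) (q ^ 2) (-r) = (q ^ r)⁻¹ * tripleTerm (q ^ 2) q r := by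
        have := tripleTerm_sq hq0 1 r
        rw [pow_one] at this
        rw [tripleTerm_sq hq0, this, zpow_neg (-1 : ℂ), ← inv_zpow, ← zpow_neg, mul_left_comm,
          ← zpow_add₀ hq0, show (-1 : ℂ)⁻¹ = -1 by norm_num]
        congr 2
        push_cast
        ring
      rw [Equiv.neg_apply, h4, zpow_neg,
        show (1 : ℂ) + (q ^ r)⁻¹ = (1 + q ^ r) / q ^ r by field_simp; ring]
      field_simp
    have h2 : 2 * ∑' r : ℤ, tripleTerm (q ^ 2) (q ^ 2) r / (1 + q ^ r) =
        ∑' r : ℤ, tripleTerm (q ^ 2) q r := by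
      rw [two_mul]
      nth_rewrite 2 [h1]
      rw [← sL.tsum_add sL']
      refine tsum_congr fun r => ?_
      rw [← t1]
      have h2 := one_add_zpow_ne_zero hq hq0 r
      field_simp
      ring
    have h3 := tsum_alternating_sq hq hq0
    rw [← h2] at h3
    rw [hκ]
    field_simp
    linear_combination h3
  have s1 := (summable_norm_tripleTerm_div hq2 hq20 hz20 hq20).of_norm
  have s2 := (summable_norm_tripleTerm_div hq2 hq20 hz20 hq30).of_norm
  have hA := tsum_tripleTerm_div hq2 hq20 hz20 hz2
  have hterm : ∀ r : ℤ, tripleTerm q q r / (1 - z * q ^ r) * rankKernel q r =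
      (2 * κ / (1 + z)) * ((z * (tripleTerm (q ^ 2) (q ^ 2) r / (1 - z ^ 2 * (q ^ 2) ^ r)) +
        z ^ 2 * (tripleTerm (q ^ 2) (q ^ 3) r / (1 - z ^ 2 * (q ^ 2) ^ r))) +
        tripleTerm (q ^ 2) (q ^ 2) r / (1 + q ^ r)) := by
    intro r
    have e : tripleTerm q q r * q ^ (tri r + r) = tripleTerm (q ^ 2) (q ^ 2) r := by
      rw [tripleTerm_sq hq0, tripleTerm, mul_assoc, mul_assoc, ← zpow_add₀ hq0, ← zpow_add₀ hq0]
      congr 2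
      push_cast
      linarith [two_mul_tri r]
    rw [rankKernel_eq hq hq0, ← hκ, ← t2, ← e, ← hsq]
    have h1 := hzq r
    have h2 := hzq' r
    have h3 := one_add_zpow_ne_zero hq hq0 r
    field_simp
    ring
  rw [tsum_rank_eq hq hq0 hz hzq, tsum_congr hterm, tsum_mul_left,
    ((s1.mul_left _).add (s2.mul_left _)).tsum_add sL, (s1.mul_left _).tsum_add (s2.mul_left _),
    tsum_mul_left, tsum_mul_left, hA, mul_div_mul_comm, ← hκ]
  linear_combination ((1 - z) / (1 + z)) * hL

end RankIdentity

/-! ### The theta function -/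

lemma theta_eq_jacobiTheta₂ (z τ : ℂ) :
    theta z τ = cexp (Real.pi * I * τ / 4 + Real.pi * I * (z + 1 / 2)) *
      jacobiTheta₂ (z + 1 / 2 + τ / 2) τ := by
  rw [theta, jacobiTheta₂, ← tsum_mul_left]
  refine tsum_congr fun k => ?_
  rw [jacobiTheta₂_term, ← Complex.exp_add]
  congr 1
  ring

lemma differentiable_theta {τ : ℂ} (hτ : 0 < τ.im) : Differentiable ℂ fun z => theta z τ := by
  intro z
  simp only [theta_eq_jacobiTheta₂]
  refine DifferentiableAt.mul (by fun_prop) ?_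
  exact (differentiableAt_jacobiTheta₂_fst _ hτ).comp z
    (f := fun z => z + 1 / 2 + τ / 2) (by fun_prop)

lemma exp_pi_mul_I_odd (k : ℤ) : cexp (Real.pi * I * (2 * k + 1)) = -1 := by
  rw [mul_add, Complex.exp_add, mul_one, Complex.exp_pi_mul_I,
    show Real.pi * I * (2 * (k : ℂ)) = k * (2 * Real.pi * I) by ring,
    Complex.exp_int_mul_two_pi_mul_I, one_mul]

lemma exp_neg_pi_mul_I_odd (k : ℤ) : cexp (-(Real.pi * I * (2 * k + 1))) = -1 := by
  rw [Complex.exp_neg, exp_pi_mul_I_odd]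
  norm_num

lemma exp_two_pi_mul_I_int (k : ℤ) : cexp (2 * Real.pi * I * k) = 1 := by
  rw [mul_comm, Complex.exp_int_mul_two_pi_mul_I]

lemma exp_pi_mul_I_int (k : ℤ) : cexp (Real.pi * I * k) = (-1) ^ k := by
  rw [mul_comm, Complex.exp_int_mul, Complex.exp_pi_mul_I]

lemma exp_pi_mul_I_mul_succ (k : ℤ) : cexp (Real.pi * I * (k * (k + 1))) = 1 := by
  obtain ⟨m, hm⟩ := (Int.even_mul_succ_self k).two_dvd
  have : (k : ℂ) * (k + 1) = 2 * m := by exact_mod_cast hm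
  rw [this, show Real.pi * I * (2 * (m : ℂ)) = 2 * Real.pi * I * m by ring, exp_two_pi_mul_I_int]

lemma exp_pi_mul_I_half : cexp (Real.pi * I * (1 / 2)) = I := by
  rw [show Real.pi * I * (1 / 2) = Real.pi / 2 * I by ring, Complex.exp_pi_div_two_mul_I]

lemma theta_add_one (z τ : ℂ) : theta (z + 1) τ = -theta z τ := by
  rw [theta, theta, ← tsum_neg]
  refine tsum_congr fun k => ?_
  rw [← neg_one_mul, ← exp_pi_mul_I_odd k, ← Complex.exp_add]
  congr 1
  ring

lemma theta_neg (z τ : ℂ) : theta (-z) τ = -theta z τ := by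
  rw [theta, theta, ← tsum_neg, ← (Equiv.subLeft (-1 : ℤ)).tsum_eq]
  refine tsum_congr fun k => ?_
  rw [← neg_one_mul (cexp _), ← exp_neg_pi_mul_I_odd k, ← Complex.exp_add, Equiv.subLeft_apply]
  congr 1
  push_cast
  ring

lemma theta_zero (τ : ℂ) : theta 0 τ = 0 := by
  have := theta_neg 0 τ
  rw [neg_zero] at this
  linear_combination this / 2

lemma theta_add_tau (z τ : ℂ) :
    theta (z + τ) τ = -cexp (-(Real.pi * I * τ + 2 * Real.pi * I * z)) * theta z τ := by
  rw [theta, theta, ← (Equiv.subRight (1 : ℤ)).tsum_eq, ← tsum_mul_left]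
  refine tsum_congr fun k => ?_
  have := exp_neg_pi_mul_I_odd 0
  rw [← neg_one_mul, ← this, ← Complex.exp_add, ← Complex.exp_add, Equiv.subRight_apply]
  congr 1
  push_cast
  ring

lemma theta_T (z τ : ℂ) : theta z (τ + 1) = cexp (Real.pi * I / 4) * theta z τ := by
  rw [theta, theta, ← tsum_mul_left]
  refine tsum_congr fun k => ?_
  rw [show cexp (Real.pi * I / 4) = cexp (Real.pi * I / 4) * cexp (Real.pi * I * (k * (k + 1))) by
    rw [exp_pi_mul_I_mul_succ, mul_one], ← Complex.exp_add, ← Complex.exp_add]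
  congr 1
  ring

lemma im_neg_one_div {τ : ℂ} : (-1 / τ).im = τ.im / normSq τ := by
  rw [neg_div, neg_im, one_div, inv_im]
  ring

lemma im_neg_one_div_pos {τ : ℂ} (hτ : 0 < τ.im) : 0 < (-1 / τ).im := by
  rw [im_neg_one_div]
  exact div_pos hτ (normSq_pos.mpr fun h => by simp [h] at hτ)

lemma ne_zero_of_im_pos {τ : ℂ} (hτ : 0 < τ.im) : τ ≠ 0 := fun h => by simp [h] at hτ

lemma theta_S (z : ℂ) {τ : ℂ} (hτ : 0 < τ.im) :
    theta (z / τ) (-1 / τ) =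
      -I * (-I * τ) ^ (1 / 2 : ℂ) * cexp (Real.pi * I * z ^ 2 / τ) * theta z τ := by
  have hτ0 := ne_zero_of_im_pos hτ
  have hs : (-I * τ) ^ (1 / 2 : ℂ) ≠ 0 := by
    rw [Complex.cpow_ne_zero_iff]
    left
    simp [hτ0]
  have h1 := jacobiTheta₂_functional_equation (z + 1 / 2 + τ / 2) τ
  -- The offset `1/2 + τ/2` divided by `τ` differs from the offset for `-1/τ` by exactly one
  -- quasi-period `-1/τ`.
  have h2 := jacobiTheta₂_add_left' ((z + 1 / 2 + τ / 2) / τ) (-1 / τ)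
  rw [theta_eq_jacobiTheta₂, theta_eq_jacobiTheta₂, h1,
    show z / τ + 1 / 2 + -1 / τ / 2 = (z + 1 / 2 + τ / 2) / τ + -1 / τ by field_simp; ring, h2]
  have hI : -I = cexp (-(Real.pi * I * (1 / 2))) := by
    rw [Complex.exp_neg, exp_pi_mul_I_half, Complex.inv_I]
  have : ∀ a b c d e s j : ℂ, s ≠ 0 → cexp a * cexp b = -I * cexp c * cexp d * cexp e →
      cexp a * (cexp b * j) = -I * s * cexp c * (cexp d * (1 / s * cexp e * j)) := by
    intro a b c d e s j hs h
    field_simp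
    linear_combination j * h
  refine this _ _ _ _ _ _ _ hs ?_
  nth_rewrite 1 [hI]
  simp only [← Complex.exp_add]
  congr 1
  field_simp
  ring

lemma nome_eq_zpow_exp (τ : ℂ) (n : ℤ) : nome τ ^ n = cexp (2 * Real.pi * I * n * τ) := by
  rw [nome, ← Complex.exp_int_mul]
  congr 1
  ring

lemma norm_nome_lt_one {τ : ℂ} (hτ : 0 < τ.im) : ‖nome τ‖ < 1 := by
  rw [nome]
  exact UpperHalfPlane.norm_exp_two_pi_I_lt_one ⟨τ, hτ⟩

lemma nome_ne_zero (τ : ℂ) : nome τ ≠ 0 := Complex.exp_ne_zero _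

lemma nome_two_mul (τ : ℂ) : nome (2 * τ) = nome τ ^ 2 := by
  rw [nome, nome, ← Complex.exp_nat_mul]
  congr 1
  push_cast
  ring

lemma tripleTerm_nome (v τ : ℂ) (n : ℤ) :
    tripleTerm (nome τ) (nome τ * cexp (2 * Real.pi * I * v)) n =
      (-1 : ℂ) ^ n * cexp (Real.pi * I * n * ((n : ℂ) + 1) * τ + 2 * Real.pi * I * n * v) := by
  rw [tripleTerm, mul_assoc, mul_zpow, ← mul_assoc (nome τ ^ tri n), ← zpow_add₀ (nome_ne_zero _),
    nome_eq_zpow_exp, ← Complex.exp_int_mul, ← Complex.exp_add]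
  congr 2
  have := two_mul_tri n
  have h2 : (2 : ℂ) * tri n = n * (n - 1) := by exact_mod_cast this
  push_cast
  linear_combination (Real.pi * I * τ) * h2

lemma theta_eq_tsum_tripleTerm (v τ : ℂ) :
    theta v τ = I * cexp (Real.pi * I * τ / 4 + Real.pi * I * v) *
      ∑' n, tripleTerm (nome τ) (nome τ * cexp (2 * Real.pi * I * v)) n := by
  rw [theta, ← tsum_mul_left]
  refine tsum_congr fun k => ?_
  rw [tripleTerm_nome, ← exp_pi_mul_I_int k]
  rw [show I * cexp (Real.pi * I * τ / 4 + Real.pi * I * v) =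
    cexp (Real.pi * I * (1 / 2)) * cexp (Real.pi * I * τ / 4 + Real.pi * I * v) by
      rw [exp_pi_mul_I_half]]
  simp only [← Complex.exp_add]
  congr 1
  ring

lemma jacProd_mul_left {q : ℂ} (hq : ‖q‖ < 1) {x : ℂ} (hx : x ≠ 0) (hq0 : q ≠ 0) :
    x * jacProd (q * x) q = -jacProd x q := by
  rw [jacProd, jacProd, qPochInf_eq_mul hq x, show q / (q * x) = x⁻¹ by field_simp,
    qPochInf_eq_mul hq x⁻¹, mul_comm q x, show x⁻¹ * q = q / x by ring]
  field_simp
  ring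

/-- The product formula for `ϑ`. -/
lemma theta_eq_jacProd (v : ℂ) {τ : ℂ} (hτ : 0 < τ.im) :
    theta v τ = -I * cexp (Real.pi * I * τ / 4 - Real.pi * I * v) *
      (jacProd (cexp (2 * Real.pi * I * v)) (nome τ) * qPochInf (nome τ) (nome τ)) := by
  have h0 := nome_ne_zero τ
  have h1 := norm_nome_lt_one hτ
  have hx := Complex.exp_ne_zero (2 * Real.pi * I * v)
  rw [theta_eq_tsum_tripleTerm, tsum_tripleTerm h1 h0 (mul_ne_zero h0 hx)]
  have h2 := jacProd_mul_left h1 hx h0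
  have h3 : cexp (Real.pi * I * τ / 4 + Real.pi * I * v) =
      cexp (Real.pi * I * τ / 4 - Real.pi * I * v) * cexp (2 * Real.pi * I * v) := by
    rw [← Complex.exp_add]
    congr 1
    ring
  rw [h3]
  linear_combination (I * cexp (Real.pi * I * τ / 4 - Real.pi * I * v) *
    qPochInf (nome τ) (nome τ)) * h2

lemma eta_eq (τ : ℂ) : ModularForm.eta τ = cexp (Real.pi * I * τ / 12) * qPochInf (nome τ) (nome τ) := by
  rw [ModularForm.eta, Function.Periodic.qParam, qPochInf]
  congr 1
  · congr 1
    push_cast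
    ring
  · refine tprod_congr fun n => ?_
    rw [ModularForm.eta_q_eq_pow, pow_succ', nome]

/-- For base `q²` both factors of `[q; q²]_∞` are `(q; q²)_∞`, so the value is an eta quotient. It
is the denominator of `μ` in `N`, and it links the two multipliers in `multiplier_eq`. -/
lemma theta_half_period {τ : ℂ} (hτ : 0 < τ.im) :
    theta τ (2 * τ) = -I * cexp (-(Real.pi * I * τ / 2)) * (ModularForm.eta τ ^ 2 / ModularForm.eta (2 * τ)) := by
  have h1 := norm_nome_lt_one hτ
  have h0 := nome_ne_zero τ
  rw [theta_eq_jacProd _ (by simpa using hτ), eta_eq, eta_eq, nome_two_mul,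
    show cexp (2 * Real.pi * I * τ) = nome τ from rfl, jacProd,
    show nome τ ^ 2 / nome τ = nome τ by field_simp]
  have h2 := qPochInf_odd_mul_even h1
  have h3 := qPochInf_ne_zero_of_norm_lt (norm_sq_lt_one h1) (norm_sq_lt_one h1)
  have h4 := Complex.exp_ne_zero (Real.pi * I * τ / 12)
  rw [show Real.pi * I * (2 * τ) / 12 = Real.pi * I * τ / 12 + Real.pi * I * τ / 12 by ring,
    Complex.exp_add,
    show Real.pi * I * (2 * τ) / 4 - Real.pi * I * τ = -(Real.pi * I * τ / 2) by ring, ← h2]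
  field_simp

lemma theta_ne_zero {v τ : ℂ} (hτ : 0 < τ.im)
    (hv : ∀ n : ℤ, 1 - cexp (2 * Real.pi * I * v) * nome τ ^ n ≠ 0) : theta v τ ≠ 0 := by
  have h1 := norm_nome_lt_one hτ
  rw [theta_eq_jacProd _ hτ]
  refine mul_ne_zero (mul_ne_zero (by simp) (Complex.exp_ne_zero _))
    (mul_ne_zero (mul_ne_zero ?_ ?_) (qPochInf_ne_zero_of_norm_lt h1 h1))
  · exact qPochInf_ne_zero h1 fun j => by simpa using hv j
  · refine qPochInf_ne_zero h1 fun j => ?_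
    have := one_sub_inv_mul_ne_zero (Complex.exp_ne_zero _) hv (j + 1)
    rwa [zpow_add₀ (nome_ne_zero _), zpow_natCast, zpow_one, mul_comm (_ ^ _), mul_div_right_comm]
      at this

/-! ### The Appell function -/

/-- The condition `u ∉ ℤ + τ ℤ`. -/
def OffLattice (u τ : ℂ) : Prop := ∀ n : ℤ, 1 - cexp (2 * Real.pi * I * u) * nome τ ^ n ≠ 0

lemma OffLattice.add_one {u τ : ℂ} (h : OffLattice u τ) : OffLattice (u + 1) τ := fun n => by
  have := h n
  rwa [mul_add, Complex.exp_add, mul_one, Complex.exp_two_pi_mul_I, mul_one]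

lemma exp_two_pi_add_tau (u τ : ℂ) :
    cexp (2 * Real.pi * I * (u + τ)) = nome τ * cexp (2 * Real.pi * I * u) := by
  rw [mul_add, Complex.exp_add, mul_comm, nome]

lemma offLattice_add_tau {u τ : ℂ} : OffLattice (u + τ) τ ↔ OffLattice u τ := by
  have key : ∀ n : ℤ, cexp (2 * Real.pi * I * (u + τ)) * nome τ ^ n =
      cexp (2 * Real.pi * I * u) * nome τ ^ (n + 1) := by
    intro n
    rw [exp_two_pi_add_tau, zpow_add₀ (nome_ne_zero _), zpow_one]
    ring
  constructor
  · intro h n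
    have := h (n - 1)
    rwa [key, sub_add_cancel] at this
  · intro h n
    rw [key]
    exact h (n + 1)

lemma offLattice_iff {u τ : ℂ} : OffLattice u τ ↔ ∀ m n : ℤ, u ≠ m * τ + n := by
  have key : ∀ n : ℤ, cexp (2 * Real.pi * I * u) * nome τ ^ n =
      cexp (2 * Real.pi * I * (u + n * τ)) := by
    intro n
    rw [nome_eq_zpow_exp, ← Complex.exp_add]
    congr 1
    ring
  constructor
  · rintro h m n rfl
    apply h (-m)
    rw [key]
    push_cast
    rw [show 2 * Real.pi * I * (m * τ + n + -m * τ) = 2 * Real.pi * I * (n : ℂ) by ring,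
      exp_two_pi_mul_I_int, sub_self]
  · intro h n h0
    rw [key, sub_eq_zero, eq_comm, Complex.exp_eq_one_iff] at h0
    obtain ⟨m, hm⟩ := h0
    apply h (-n) m
    have : (2 * Real.pi * I : ℂ) ≠ 0 := Complex.two_pi_I_ne_zero
    apply mul_left_cancel₀ this
    push_cast
    linear_combination hm

/-- Oddness gives a zero at `0`, and quasi-periodicity spreads it over the lattice. -/
lemma offLattice_of_theta_ne_zero {u τ : ℂ} (h : theta u τ ≠ 0) : OffLattice u τ := by
  rw [offLattice_iff]
  rintro m n rfl
  apply h
  have h1 : ∀ (z : ℂ) (k : ℤ), theta z τ = 0 → theta (z + k) τ = 0 := by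
    intro z k
    induction k using Int.induction_on with
    | zero => simp
    | succ k ih => intro h; push_cast; rw [← add_assoc, theta_add_one, ← Int.cast_natCast, ih h, neg_zero]
    | pred k ih =>
      intro h
      have := theta_add_one (z + ((-k - 1 : ℤ) : ℂ)) τ
      rw [show z + ((-k - 1 : ℤ) : ℂ) + 1 = z + ((-k : ℤ) : ℂ) by push_cast; ring, ih h] at this
      exact neg_eq_zero.mp this.symm
  have h2 : ∀ k : ℤ, theta (k * τ) τ = 0 := by
    intro k
    induction k using Int.induction_on with
    | zero => simp [theta_zero]
    | succ k ih =>
      push_cast at ih ⊢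
      rw [add_mul, one_mul, theta_add_tau, ih, mul_zero]
    | pred k ih =>
      have := theta_add_tau (((-k - 1 : ℤ) : ℂ) * τ) τ
      rw [show ((-k - 1 : ℤ) : ℂ) * τ + τ = ((-k : ℤ) : ℂ) * τ by push_cast; ring, ih] at this
      simpa using this
  exact h1 _ _ (h2 m)

/-- The Appell sum `∑ (-1) ^ n q ^ (n (n + 1) / 2) w ^ n / (1 - x q ^ n)`. -/
def appell (q x w : ℂ) : ℂ := ∑' n, tripleTerm q (q * w) n / (1 - x * q ^ n)

lemma mu_eq_appell (u v τ : ℂ) :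
    mu u v τ = cexp (Real.pi * I * u) / theta v τ *
      appell (nome τ) (cexp (2 * Real.pi * I * u)) (cexp (2 * Real.pi * I * v)) := by
  rw [mu, appell]
  congr 1
  refine tsum_congr fun n => ?_
  rw [tripleTerm_nome, nome_eq_zpow_exp, ← Complex.exp_add]
  congr 3
  ring

section Appell

variable {q : ℂ}

lemma tripleTerm_mul_q {z : ℂ} (n : ℤ) :
    tripleTerm q (q * z) n = q ^ n * tripleTerm q z n := by
  rw [tripleTerm, tripleTerm, mul_zpow]
  ring

lemma tsum_tripleTerm_mul_q (hq0 : q ≠ 0) {z : ℂ} (hz : z ≠ 0) :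
    ∑' n, tripleTerm q z n = -z * ∑' n, tripleTerm q (q * z) n := by
  rw [← (Equiv.addRight (1 : ℤ)).tsum_eq, ← tsum_mul_left]
  refine tsum_congr fun n => ?_
  rw [Equiv.coe_addRight, tripleTerm_add_one hq0 hz, tripleTerm_mul_q]
  ring

lemma appell_mul_q_right (hq : ‖q‖ < 1) (hq0 : q ≠ 0) {x w : ℂ} (hx : x ≠ 0) (hw : w ≠ 0)
    (h : ∀ n : ℤ, 1 - x * q ^ n ≠ 0) :
    x * appell q x (q * w) = appell q x w - ∑' n, tripleTerm q (q * w) n := by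
  have hqw : q * w ≠ 0 := mul_ne_zero hq0 hw
  rw [appell, appell, ← Summable.tsum_sub (summable_norm_tripleTerm_div hq hq0 hx hqw).of_norm
    (summable_tripleTerm hq hq0 hqw), ← tsum_mul_left]
  refine tsum_congr fun n => ?_
  rw [tripleTerm_mul_q (z := q * w)]
  have := h n
  field_simp
  ring

/-- Shift the index by one and use `1/(1 - x q^n) = 1 + x q^n/(1 - x q^n)`; the `1` produces a theta
series. -/
lemma appell_mul_q_left (hq : ‖q‖ < 1) (hq0 : q ≠ 0) {x w : ℂ} (hx : x ≠ 0) (hw : w ≠ 0)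
    (h : ∀ n : ℤ, 1 - x * q ^ n ≠ 0) :
    appell q (q * x) w = ∑' n, tripleTerm q (q * w) n - x / w * appell q x w := by
  have hqw : q * w ≠ 0 := mul_ne_zero hq0 hw
  have h1 : ∑' n, tripleTerm q (q * w) n = ∑' n, -w⁻¹ * tripleTerm q w n := by
    rw [tsum_mul_left, tsum_tripleTerm_mul_q hq0 hw]
    field_simp
  rw [h1, appell, appell, ← tsum_mul_left, ← Summable.tsum_sub
    ((summable_tripleTerm hq hq0 hw).mul_left _)
    ((summable_norm_tripleTerm_div hq hq0 hx hqw).of_norm.mul_left _),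
    ← (Equiv.addRight (-1 : ℤ)).tsum_eq]
  refine tsum_congr fun n => ?_
  have h2 := tripleTerm_add_one hq0 hqw (n + -1)
  rw [neg_add_cancel_right] at h2
  have h3 := h n
  have hn : q ^ n ≠ 0 := zpow_ne_zero _ hq0
  have h4 := tripleTerm_mul_q (q := q) (z := w) n
  have h5 : q ^ (n + -1) = q ^ n * q⁻¹ := by rw [zpow_add₀ hq0, zpow_neg_one]
  rw [h5] at h2
  have h6 : tripleTerm q (q * w) (n + -1) = -(w⁻¹ * tripleTerm q w n) := by
    rw [h4] at h2
    field_simp at h2 ⊢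
    linear_combination h2
  rw [Equiv.coe_addRight, h6, h5, show q * x * (q ^ n * q⁻¹) = x * q ^ n by field_simp, h4]
  field_simp
  ring

end Appell

lemma mu_add_one_left (u v τ : ℂ) : mu (u + 1) v τ = -mu u v τ := by
  rw [mu_eq_appell, mu_eq_appell]
  simp only [mul_add, Complex.exp_add, mul_one, Complex.exp_two_pi_mul_I, Complex.exp_pi_mul_I]
  ring

lemma mu_add_one_right (u v τ : ℂ) : mu u (v + 1) τ = -mu u v τ := by
  rw [mu_eq_appell, mu_eq_appell, theta_add_one]
  simp only [mul_add, Complex.exp_add, mul_one, Complex.exp_two_pi_mul_I]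
  rw [div_neg]
  ring

lemma mu_T (u v τ : ℂ) : mu u v (τ + 1) = cexp (-(Real.pi * I / 4)) * mu u v τ := by
  rw [mu, mu, theta_T, Complex.exp_neg, mul_comm (cexp (Real.pi * I / 4)), ← div_div,
    div_mul_eq_mul_div, mul_div_right_comm, div_eq_inv_mul, mul_assoc]
  congr 2
  refine tsum_congr fun n => ?_
  rw [show Real.pi * I * n * ((n : ℂ) + 1) * (τ + 1) + 2 * Real.pi * I * n * v =
      (Real.pi * I * n * ((n : ℂ) + 1) * τ + 2 * Real.pi * I * n * v) +
        Real.pi * I * (n * ((n : ℂ) + 1)) by ring,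
    show 2 * Real.pi * I * n * (τ + 1) + 2 * Real.pi * I * u =
      (2 * Real.pi * I * n * τ + 2 * Real.pi * I * u) + 2 * Real.pi * I * n by ring,
    Complex.exp_add (Real.pi * I * n * ((n : ℂ) + 1) * τ + 2 * Real.pi * I * n * v),
    exp_pi_mul_I_mul_succ, Complex.exp_add (2 * Real.pi * I * n * τ + 2 * Real.pi * I * u),
    exp_two_pi_mul_I_int, mul_one, mul_one]

/-- The theta series left over by the Appell sum is divided by `theta v τ`, so the inhomogeneous
term is elementary; `zwegersR_add_tau` has the term that cancels it. -/
lemma mu_add_tau_left {u v τ : ℂ} (hτ : 0 < τ.im) (hu : OffLattice u τ) (hv : theta v τ ≠ 0) :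
    mu (u + τ) v τ = -I * cexp (Real.pi * I * (u - v) + 3 * Real.pi * I * τ / 4) -
      cexp (Real.pi * I * τ + 2 * Real.pi * I * (u - v)) * mu u v τ := by
  rw [mu_eq_appell, mu_eq_appell, exp_two_pi_add_tau, appell_mul_q_left (norm_nome_lt_one hτ)
    (nome_ne_zero τ) (Complex.exp_ne_zero _) (Complex.exp_ne_zero _) hu]
  have h1 := theta_eq_tsum_tripleTerm v τ
  set Θ := ∑' n, tripleTerm (nome τ) (nome τ * cexp (2 * Real.pi * I * v)) n
  set A := appell (nome τ) (cexp (2 * Real.pi * I * u)) (cexp (2 * Real.pi * I * v))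
  have e1 : cexp (Real.pi * I * (u + τ)) =
      cexp (Real.pi * I * (u - v) + 3 * Real.pi * I * τ / 4) *
        cexp (Real.pi * I * τ / 4 + Real.pi * I * v) := by
    rw [← Complex.exp_add]; congr 1; ring
  have e2 : cexp (Real.pi * I * (u + τ)) * (cexp (2 * Real.pi * I * u) /
      cexp (2 * Real.pi * I * v)) =
      cexp (Real.pi * I * τ + 2 * Real.pi * I * (u - v)) * cexp (Real.pi * I * u) := by
    rw [← Complex.exp_sub, ← Complex.exp_add, ← Complex.exp_add]; congr 1; ring
  have h2 : cexp (Real.pi * I * (u + τ)) * Θ =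
      -I * cexp (Real.pi * I * (u - v) + 3 * Real.pi * I * τ / 4) * theta v τ := by
    rw [h1, e1]
    linear_combination ((cexp (Real.pi * I * (u - v) + 3 * Real.pi * I * τ / 4) *
        cexp (Real.pi * I * τ / 4 + Real.pi * I * v) * Θ)) * I_sq
  rw [mul_sub, div_mul_eq_mul_div, h2, mul_div_cancel_right₀ _ hv]
  linear_combination (-(A / theta v τ)) * e2

lemma mu_add_tau_right {u v τ : ℂ} (hτ : 0 < τ.im) (hu : OffLattice u τ) (hv : theta v τ ≠ 0) :
    mu u (v + τ) τ = -I * cexp (-(Real.pi * I * (u - v)) + 3 * Real.pi * I * τ / 4) -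
      cexp (Real.pi * I * τ - 2 * Real.pi * I * (u - v)) * mu u v τ := by
  have hA := appell_mul_q_right (norm_nome_lt_one hτ)
    (nome_ne_zero τ) (Complex.exp_ne_zero _) (Complex.exp_ne_zero (2 * Real.pi * I * v)) hu
  rw [mu_eq_appell, mu_eq_appell, exp_two_pi_add_tau, theta_add_tau]
  have h1 := theta_eq_tsum_tripleTerm v τ
  set Θ := ∑' n, tripleTerm (nome τ) (nome τ * cexp (2 * Real.pi * I * v)) n
  set A := appell (nome τ) (cexp (2 * Real.pi * I * u)) (cexp (2 * Real.pi * I * v))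
  set B := appell (nome τ) (cexp (2 * Real.pi * I * u)) (nome τ * cexp (2 * Real.pi * I * v))
  have hΘ : Θ = -I * cexp (-(Real.pi * I * τ / 4 + Real.pi * I * v)) * theta v τ := by
    rw [h1, Complex.exp_neg]
    have := Complex.exp_ne_zero (Real.pi * I * τ / 4 + Real.pi * I * v)
    field_simp
    rw [I_sq]
    ring
  have hB : B = cexp (-(2 * Real.pi * I * u)) * (A - Θ) := by
    rw [← hA, ← mul_assoc, ← Complex.exp_add, neg_add_cancel, Complex.exp_zero, one_mul]
  have e0 : cexp (-(Real.pi * I * τ + 2 * Real.pi * I * v)) ≠ 0 := Complex.exp_ne_zero _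
  rw [hB, hΘ, Complex.exp_neg (Real.pi * I * τ + 2 * Real.pi * I * v)]
  have e1 : cexp (Real.pi * I * u) * cexp (Real.pi * I * τ + 2 * Real.pi * I * v) *
      cexp (-(2 * Real.pi * I * u)) =
      cexp (Real.pi * I * τ - 2 * Real.pi * I * (u - v)) * cexp (Real.pi * I * u) := by
    simp only [← Complex.exp_add]; congr 1; ring
  have e2 : cexp (Real.pi * I * τ - 2 * Real.pi * I * (u - v)) * cexp (Real.pi * I * u) *
      cexp (-(Real.pi * I * τ / 4 + Real.pi * I * v)) =
      cexp (-(Real.pi * I * (u - v)) + 3 * Real.pi * I * τ / 4) := by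
    simp only [← Complex.exp_add]; congr 1; ring
  have e3 : ∀ a b c d t y : ℂ, t ≠ 0 → b ≠ 0 →
      a / (-b⁻¹ * t) * (c * (A - -I * d * t)) = -(a * b * c) * (A / t) - I * (a * b * c) * d := by
    intro a b c d t y ht hb
    field_simp
    ring
  rw [e3 _ _ _ _ _ 0 hv (Complex.exp_ne_zero _), e1]
  linear_combination (-I) * e2

/-! ### The error function -/

lemma continuous_gauss : Continuous fun w : ℝ => Real.exp (-Real.pi * w ^ 2) := by fun_prop

lemma integrable_gauss : Integrable fun w : ℝ => Real.exp (-Real.pi * w ^ 2) :=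
  integrable_exp_neg_mul_sq Real.pi_pos

lemma hasDerivAt_errE (x : ℝ) : HasDerivAt errE (2 * Real.exp (-Real.pi * x ^ 2)) x :=
  (intervalIntegral.integral_hasDerivAt_right (continuous_gauss.intervalIntegrable _ _)
    (continuous_gauss.stronglyMeasurableAtFilter _ _) continuous_gauss.continuousAt).const_mul 2

lemma integral_gauss_Ioi_zero : ∫ w in Set.Ioi (0 : ℝ), Real.exp (-Real.pi * w ^ 2) = 1 / 2 := by
  rw [integral_gaussian_Ioi, div_self Real.pi_ne_zero, Real.sqrt_one]

lemma one_sub_errE (x : ℝ) : 1 - errE x = 2 * ∫ w in Set.Ioi x, Real.exp (-Real.pi * w ^ 2) := by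
  have h := intervalIntegral.integral_interval_add_Ioi (a := 0) (b := x)
    integrable_gauss.integrableOn integrable_gauss.integrableOn
  rw [integral_gauss_Ioi_zero] at h
  rw [errE]
  linear_combination -2 * h

lemma errE_neg (x : ℝ) : errE (-x) = -errE x := by
  have := intervalIntegral.integral_comp_neg (a := 0) (b := x)
    (fun w : ℝ => Real.exp (-Real.pi * w ^ 2))
  simp only [neg_sq, neg_zero] at this
  rw [errE, errE, intervalIntegral.integral_symm, this]
  ring

lemma errE_le_one (x : ℝ) : errE x ≤ 1 := by
  have : 0 ≤ 1 - errE x := by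
    rw [one_sub_errE]
    exact mul_nonneg zero_le_two (setIntegral_nonneg measurableSet_Ioi fun _ _ => (Real.exp_pos _).le)
  linarith

lemma abs_errE_le_one (x : ℝ) : |errE x| ≤ 1 := by
  rw [abs_le]
  have := errE_le_one (-x)
  rw [errE_neg] at this
  exact ⟨by linarith, errE_le_one x⟩

lemma one_sub_errE_le {x : ℝ} (hx : 0 ≤ x) : 1 - errE x ≤ Real.exp (-Real.pi * x ^ 2) := by
  have h1 : ∫ w in Set.Ioi x, Real.exp (-Real.pi * w ^ 2) =
      ∫ w in Set.Ioi (0 : ℝ), Real.exp (-Real.pi * (w + x) ^ 2) := by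
    have := (measurePreserving_add_right volume x).setIntegral_preimage_emb
      (measurableEmbedding_addRight x) (fun w : ℝ => Real.exp (-Real.pi * w ^ 2)) (Set.Ioi x)
    rw [← this]
    simp
  have h2 : ∫ w in Set.Ioi (0 : ℝ), Real.exp (-Real.pi * (w + x) ^ 2) ≤
      ∫ w in Set.Ioi (0 : ℝ), Real.exp (-Real.pi * x ^ 2) * Real.exp (-Real.pi * w ^ 2) := by
    refine setIntegral_mono_on (integrable_gauss.comp_add_right x).integrableOn
      (integrable_gauss.const_mul _).integrableOn measurableSet_Ioi fun w hw => ?_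
    rw [← Real.exp_add, Real.exp_le_exp]
    have hw : 0 < w := hw
    have : 0 ≤ Real.pi * (w * x) := by positivity
    nlinarith
  rw [integral_const_mul, integral_gauss_Ioi_zero] at h2
  rw [one_sub_errE, h1]
  linarith

lemma tendsto_errE : Tendsto errE atTop (𝓝 1) := by
  have h := (intervalIntegral_tendsto_integral_Ioi 0
    integrable_gauss.integrableOn tendsto_id).const_mul 2
  rwa [integral_gauss_Ioi_zero, mul_one_div_cancel two_ne_zero] at h

/-- If `n` and `n + x` have the same sign, the Gaussian tail bound applies. Otherwise `|n + x| ≤ |x|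
≤ S`, and the factor `exp(π c² S²)` outweighs the Gaussian, so the trivial bound `2` suffices. -/
lemma abs_sign_sub_errE_le {n x c S : ℝ} (hn : n ≠ 0) (hc : 0 ≤ c) (hS : |x| ≤ S) :
    |Real.sign n - errE ((n + x) * c)| ≤
      2 * Real.exp (Real.pi * c ^ 2 * S ^ 2) * Real.exp (-Real.pi * ((n + x) * c) ^ 2) := by
  have key : ∀ n x : ℝ, 0 < n → |x| ≤ S → |1 - errE ((n + x) * c)| ≤
      2 * Real.exp (Real.pi * c ^ 2 * S ^ 2) * Real.exp (-Real.pi * ((n + x) * c) ^ 2) := by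
    intro n x hn hS
    have hE := errE_le_one ((n + x) * c)
    rw [abs_of_nonneg (by linarith)]
    have h1 : 1 ≤ Real.exp (Real.pi * c ^ 2 * S ^ 2) :=
      Real.one_le_exp (by have := Real.pi_pos; positivity)
    rcases le_or_gt 0 (n + x) with h | h
    · refine (one_sub_errE_le (mul_nonneg h hc)).trans ?_
      have := Real.exp_pos (-Real.pi * ((n + x) * c) ^ 2)
      nlinarith
    · have h2 := (abs_le.mp (abs_errE_le_one ((n + x) * c))).1
      have h3 : 1 ≤ Real.exp (Real.pi * c ^ 2 * S ^ 2) *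
          Real.exp (-Real.pi * ((n + x) * c) ^ 2) := by
        rw [← Real.exp_add]
        apply Real.one_le_exp
        have h4 : (n + x) ^ 2 ≤ S ^ 2 := by
          apply sq_le_sq'
          · linarith [(abs_le.mp hS).1]
          · linarith [(abs_nonneg x).trans hS]
        have : 0 ≤ Real.pi * c ^ 2 * (S ^ 2 - (n + x) ^ 2) :=
          mul_nonneg (by have := Real.pi_pos; positivity) (by linarith)
        linarith
      linarith
  rcases lt_or_gt_of_ne hn with h | h
  · have := key (-n) (-x) (by linarith) (by simpa)
    rw [Real.sign_of_neg h]
    rw [show (-n + -x) * c = -((n + x) * c) by ring, errE_neg, neg_sq] at this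
    rwa [show -1 - errE ((n + x) * c) = -(1 - -errE ((n + x) * c)) by ring, abs_neg]
  · rw [Real.sign_of_pos h]
    exact key n x h hS

/-! ### The function `R` -/

lemma int_add_half_ne_zero (k : ℤ) : (k : ℝ) + 1 / 2 ≠ 0 := by
  intro h
  have : (2 * k + 1 : ℝ) = 0 := by linarith
  have h2 : 2 * k + 1 = 0 := by exact_mod_cast this
  omega

/-- The real coefficient `sgn n - E((n + a) √(2 y))` of the series for `R`, with `n = k + 1/2`. -/
def zwegersCoeff (τ u : ℂ) (k : ℤ) : ℝ :=
  Real.sign ((k : ℝ) + 1 / 2) - errE (((k : ℝ) + 1 / 2 + u.im / τ.im) * Real.sqrt (2 * τ.im))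

/-- The holomorphic factor of the general term of the series for `R`. -/
def zwegersExp (τ u : ℂ) (k : ℤ) : ℂ :=
  (-1 : ℂ) ^ k *
    cexp (-Real.pi * I * ((k : ℂ) + 1 / 2) ^ 2 * τ - 2 * Real.pi * I * ((k : ℂ) + 1 / 2) * u)

lemma zwegersR_eq (u τ : ℂ) : zwegersR u τ = ∑' k, zwegersCoeff τ u k * zwegersExp τ u k := by
  rw [zwegersR]
  exact tsum_congr fun k => mul_assoc _ _ _

lemma norm_zwegersExp (τ u : ℂ) (k : ℤ) : ‖zwegersExp τ u k‖ =
    Real.exp (Real.pi * ((k : ℝ) + 1 / 2) ^ 2 * τ.im + 2 * Real.pi * ((k : ℝ) + 1 / 2) * u.im) := by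
  rw [zwegersExp, norm_mul, norm_zpow, norm_neg, norm_one, one_zpow, one_mul, Complex.norm_exp]
  congr 1
  have : (-Real.pi * I * ((k : ℂ) + 1 / 2) ^ 2 * τ - 2 * Real.pi * I * ((k : ℂ) + 1 / 2) * u) =
      ((-Real.pi * ((k : ℝ) + 1 / 2) ^ 2 : ℝ) : ℂ) * (τ * I) -
      ((2 * Real.pi * ((k : ℝ) + 1 / 2) : ℝ) : ℂ) * (u * I) := by
    push_cast
    ring
  rw [this, sub_re, re_ofReal_mul, re_ofReal_mul, mul_I_re, mul_I_re]
  ring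

/-- A Gaussian majorant on the strip `|Im u| ≤ B`. -/
def gaussBound (y B : ℝ) (k : ℤ) : ℝ :=
  Real.exp (Real.pi * B) * Real.exp (-Real.pi * (y * k ^ 2 - 2 * (y / 2 + B) * |(k : ℝ)|))

lemma gaussBound_nonneg (y B : ℝ) (k : ℤ) : 0 ≤ gaussBound y B k :=
  mul_nonneg (Real.exp_pos _).le (Real.exp_pos _).le

lemma summable_pow_mul_gaussBound {y : ℝ} (hy : 0 < y) (B : ℝ) (j : ℕ) :
    Summable fun k : ℤ => |(k : ℝ)| ^ j * gaussBound y B k := by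
  have := (summable_pow_mul_jacobiTheta₂_term_bound (y / 2 + B) hy j).mul_left
    (Real.exp (Real.pi * B))
  refine this.congr fun k => ?_
  rw [gaussBound]
  push_cast
  ring

/-- The holomorphic factor grows like `exp(π n² y)`, but the Gaussian decays like `exp(-2π n² y)`.
Completing the square isolates `exp(-2π (Im u)²/y)`. -/
lemma gauss_mul_norm_zwegersExp_le {τ u : ℂ} (hτ : 0 < τ.im) {B : ℝ} (hu : |u.im| ≤ B) (k : ℤ) :
    Real.exp (-Real.pi * (((k : ℝ) + 1 / 2 + u.im / τ.im) * Real.sqrt (2 * τ.im)) ^ 2) *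
      ‖zwegersExp τ u k‖ ≤ Real.exp (-(2 * Real.pi * u.im ^ 2 / τ.im)) * gaussBound τ.im B k := by
  rw [norm_zwegersExp, gaussBound, mul_pow, Real.sq_sqrt (by positivity), ← Real.exp_add,
    ← Real.exp_add, ← Real.exp_add, Real.exp_le_exp]
  have h1 : -Real.pi * (((k : ℝ) + 1 / 2 + u.im / τ.im) ^ 2 * (2 * τ.im)) +
      (Real.pi * ((k : ℝ) + 1 / 2) ^ 2 * τ.im + 2 * Real.pi * ((k : ℝ) + 1 / 2) * u.im) =
      -(2 * Real.pi * u.im ^ 2 / τ.im) +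
      Real.pi * (-(τ.im * k ^ 2) - τ.im * k - τ.im / 4 - 2 * k * u.im - u.im) := by
    field_simp
    ring
  have h2 : Real.pi * B + -Real.pi * (τ.im * k ^ 2 - 2 * (τ.im / 2 + B) * |(k : ℝ)|) =
      Real.pi * (B - τ.im * k ^ 2 + τ.im * |(k : ℝ)| + 2 * (B * |(k : ℝ)|)) := by ring
  rw [h1, h2]
  gcongr
  have h3 : -((k : ℝ) * u.im) ≤ B * |(k : ℝ)| := by
    have := neg_abs_le ((k : ℝ) * u.im)
    rw [abs_mul] at this
    nlinarith [abs_nonneg (k : ℝ)]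
  have h4 : -(τ.im * k) ≤ τ.im * |(k : ℝ)| := by
    have := neg_abs_le (k : ℝ)
    nlinarith
  have h5 := neg_abs_le u.im
  linarith

lemma abs_zwegersCoeff_mul_le {τ u : ℂ} (hτ : 0 < τ.im) {B : ℝ} (hu : |u.im| ≤ B) (k : ℤ) :
    |zwegersCoeff τ u k| * ‖zwegersExp τ u k‖ ≤ 2 * gaussBound τ.im B k := by
  have h1 := abs_sign_sub_errE_le (x := u.im / τ.im) (int_add_half_ne_zero k)
    (Real.sqrt_nonneg (2 * τ.im)) le_rfl
  have h2 := gauss_mul_norm_zwegersExp_le hτ hu k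
  rw [Real.sq_sqrt (by positivity), sq_abs] at h1
  calc _ ≤ 2 * Real.exp (Real.pi * (2 * τ.im) * (u.im / τ.im) ^ 2) * Real.exp (-Real.pi *
          (((k : ℝ) + 1 / 2 + u.im / τ.im) * Real.sqrt (2 * τ.im)) ^ 2) * ‖zwegersExp τ u k‖ :=
        mul_le_mul_of_nonneg_right h1 (norm_nonneg _)
    _ ≤ 2 * Real.exp (Real.pi * (2 * τ.im) * (u.im / τ.im) ^ 2) *
        (Real.exp (-(2 * Real.pi * u.im ^ 2 / τ.im)) * gaussBound τ.im B k) := by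
        rw [mul_assoc]
        gcongr
    _ = 2 * gaussBound τ.im B k := by
        rw [mul_assoc, ← mul_assoc (Real.exp _), ← Real.exp_add]
        have : Real.pi * (2 * τ.im) * (u.im / τ.im) ^ 2 + -(2 * Real.pi * u.im ^ 2 / τ.im) = 0 := by
          field_simp
          ring
        rw [this, Real.exp_zero, one_mul]

lemma summable_gaussBound {y : ℝ} (hy : 0 < y) (B : ℝ) : Summable (gaussBound y B) := by
  simpa using summable_pow_mul_gaussBound hy B 0

lemma summable_zwegers {τ : ℂ} (hτ : 0 < τ.im) (u : ℂ) :
    Summable fun k => (zwegersCoeff τ u k : ℂ) * zwegersExp τ u k := by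
  refine Summable.of_norm_bounded ((summable_gaussBound hτ |u.im|).mul_left 2) fun k => ?_
  rw [norm_mul, norm_real, Real.norm_eq_abs]
  exact abs_zwegersCoeff_mul_le hτ le_rfl k

lemma zwegersR_add_one (u τ : ℂ) : zwegersR (u + 1) τ = -zwegersR u τ := by
  rw [zwegersR_eq, zwegersR_eq, ← tsum_neg]
  refine tsum_congr fun k => ?_
  have h1 : zwegersExp τ (u + 1) k = -zwegersExp τ u k := by
    rw [zwegersExp, zwegersExp, ← mul_neg, ← mul_neg_one (cexp _), ← exp_neg_pi_mul_I_odd k,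
      ← Complex.exp_add]
    congr 2
    ring
  rw [h1, zwegersCoeff, zwegersCoeff, add_im, one_im, add_zero]
  ring

lemma zwegersR_T (u τ : ℂ) : zwegersR u (τ + 1) = cexp (-(Real.pi * I / 4)) * zwegersR u τ := by
  rw [zwegersR_eq, zwegersR_eq, ← tsum_mul_left]
  refine tsum_congr fun k => ?_
  have h1 : zwegersExp (τ + 1) u k = cexp (-(Real.pi * I / 4)) * zwegersExp τ u k := by
    have h0 := exp_pi_mul_I_mul_succ k
    rw [zwegersExp, zwegersExp, mul_left_comm, ← Complex.exp_add]
    congr 1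
    rw [show -Real.pi * I * ((k : ℂ) + 1 / 2) ^ 2 * (τ + 1) -
      2 * Real.pi * I * ((k : ℂ) + 1 / 2) * u = (-(Real.pi * I / 4) +
      (-Real.pi * I * ((k : ℂ) + 1 / 2) ^ 2 * τ - 2 * Real.pi * I * ((k : ℂ) + 1 / 2) * u)) +
      -(Real.pi * I * (k * (k + 1))) by ring, Complex.exp_add _ (-(Real.pi * I * (k * (k + 1)))),
      Complex.exp_neg (Real.pi * I * (k * (k + 1))), h0, inv_one, mul_one]
  rw [h1, zwegersCoeff, zwegersCoeff, add_im, one_im, add_zero]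
  ring

/-- Adding `τ` raises `Im u / Im τ` by one, which the shift `k ↦ k - 1` undoes inside `errE`. Only
the sign changes, and only at `k = 0`; this gives the inhomogeneous term. -/
lemma zwegersR_add_tau (u : ℂ) {τ : ℂ} (hτ : 0 < τ.im) :
    zwegersR (u + τ) τ = 2 * cexp (Real.pi * I * u + 3 * Real.pi * I * τ / 4) -
      cexp (Real.pi * I * τ + 2 * Real.pi * I * u) * zwegersR u τ := by
  have h2 : ∑' k : ℤ, (if k = 0 then 2 * zwegersExp τ u 0 else 0) = 2 * zwegersExp τ u 0 :=
    tsum_ite_eq _ _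
  have h3 : 2 * cexp (Real.pi * I * u + 3 * Real.pi * I * τ / 4) =
      cexp (Real.pi * I * τ + 2 * Real.pi * I * u) * (2 * zwegersExp τ u 0) := by
    rw [zwegersExp, mul_left_comm, zpow_zero, one_mul, ← Complex.exp_add]
    congr 2
    push_cast
    ring
  have hs : Summable fun k : ℤ => if k = 0 then 2 * zwegersExp τ u 0 else 0 :=
    (hasSum_ite_eq (0 : ℤ) (2 * zwegersExp τ u 0)).summable
  rw [h3, ← mul_sub, ← h2, zwegersR_eq, zwegersR_eq, ← Summable.tsum_sub hs (summable_zwegers hτ u),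
    ← tsum_mul_left, ← (Equiv.subRight (1 : ℤ)).tsum_eq]
  refine tsum_congr fun k => ?_
  have e1 : zwegersExp τ (u + τ) (k - 1) =
      -cexp (Real.pi * I * τ + 2 * Real.pi * I * u) * zwegersExp τ u k := by
    rw [zwegersExp, zwegersExp, zpow_sub₀ (by norm_num : (-1 : ℂ) ≠ 0), zpow_one, mul_left_comm,
      neg_mul (cexp _), ← Complex.exp_add, div_neg, div_one, neg_mul ((-1 : ℂ) ^ k),
      mul_neg ((-1 : ℂ) ^ k)]
    congr 3
    push_cast
    ring
  have e2 : zwegersCoeff τ (u + τ) (k - 1) = zwegersCoeff τ u k - if k = 0 then 2 else 0 := by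
    have hs : Real.sign (((k - 1 : ℤ) : ℝ) + 1 / 2) =
        Real.sign ((k : ℝ) + 1 / 2) - if k = 0 then 2 else 0 := by
      split_ifs with hk
      · subst hk
        rw [Real.sign_of_pos (show (0 : ℝ) < ((0 : ℤ) : ℝ) + 1 / 2 by norm_num),
          Real.sign_of_neg (show (((0 - 1 : ℤ) : ℤ) : ℝ) + 1 / 2 < 0 by norm_num)]
        norm_num
      · rw [sub_zero]
        rcases lt_or_gt_of_ne hk with h | h
        · have h' : (k : ℝ) ≤ -1 := by exact_mod_cast (by omega : k ≤ -1)
          rw [Real.sign_of_neg (by push_cast; linarith), Real.sign_of_neg (by linarith)]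
        · have h' : (1 : ℝ) ≤ k := by exact_mod_cast (by omega : 1 ≤ k)
          rw [Real.sign_of_pos (by push_cast; linarith), Real.sign_of_pos (by linarith)]
    rw [zwegersCoeff, zwegersCoeff, hs]
    have : ((k - 1 : ℤ) : ℝ) + 1 / 2 + (u + τ).im / τ.im = (k : ℝ) + 1 / 2 + u.im / τ.im := by
      rw [add_im]
      field_simp
      push_cast
      ring
    rw [this]
    ring
  rw [Equiv.subRight_apply, e1, e2]
  split_ifs with hk
  · subst hk
    push_cast
    ring
  · push_cast
    ring

/-! ### The Wirtinger derivative of `R` -/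

/-- `f` is real differentiable at `u` with `∂f/∂ū = b`. -/
def HasDbarAt (f : ℂ → ℂ) (b u : ℂ) : Prop :=
  ∃ a : ℂ, HasFDerivAt f (a • (1 : ℂ →L[ℝ] ℂ) + b • (conjCLE : ℂ →L[ℝ] ℂ)) u

/-- The Cauchy–Riemann criterion: with no conjugate part the real derivative is complex linear. -/
lemma HasDbarAt.differentiableAt {f : ℂ → ℂ} {u : ℂ} (h : HasDbarAt f 0 u) :
    DifferentiableAt ℂ f u := by
  obtain ⟨a, ha⟩ := h
  refine (hasFDerivAt_of_restrictScalars (f' := a • (1 : ℂ →L[ℂ] ℂ)) ℝ ha ?_).differentiableAt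
  ext x
  simp

lemma DifferentiableAt.hasDbarAt {f : ℂ → ℂ} {u : ℂ} (h : DifferentiableAt ℂ f u) :
    HasDbarAt f 0 u := by
  refine ⟨deriv f u, ?_⟩
  refine (h.hasDerivAt.hasFDerivAt.restrictScalars ℝ).congr_fderiv ?_
  ext x
  simp [mul_comm]

lemma HasDbarAt.add {f g : ℂ → ℂ} {b c u : ℂ} (hf : HasDbarAt f b u) (hg : HasDbarAt g c u) :
    HasDbarAt (fun z => f z + g z) (b + c) u := by
  obtain ⟨a, ha⟩ := hf
  obtain ⟨a', ha'⟩ := hg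
  refine ⟨a + a', ?_⟩
  refine (ha.add ha').congr_fderiv ?_
  module

lemma HasDbarAt.mul_left {f g : ℂ → ℂ} {b u : ℂ} (hf : HasDbarAt f b u)
    (hg : DifferentiableAt ℂ g u) : HasDbarAt (fun z => g z * f z) (g u * b) u := by
  obtain ⟨a, ha⟩ := hf
  obtain ⟨a', ha'⟩ := DifferentiableAt.hasDbarAt hg
  refine ⟨g u * a + f u * a', ?_⟩
  refine (ha'.mul ha).congr_fderiv ?_
  ext x
  simp
  ring

lemma HasDbarAt.comp_mul {f : ℂ → ℂ} {b c u d : ℂ} (hf : HasDbarAt f b (c * u + d)) :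
    HasDbarAt (fun z => f (c * z + d)) (b * (starRingEnd ℂ) c) u := by
  obtain ⟨a, ha⟩ := hf
  refine ⟨a * c, ?_⟩
  have h1 : HasFDerivAt (fun z : ℂ => c * z + d) (c • (1 : ℂ →L[ℝ] ℂ)) u := by
    have := ((hasDerivAt_id u).const_mul c).add_const d
    refine (this.hasFDerivAt.restrictScalars ℝ).congr_fderiv ?_
    ext x
    simp [mul_comm]
  refine (ha.comp u h1).congr_fderiv ?_
  ext x
  simp
  ring

/-- The exponential is holomorphic in `u`, so `ū` enters only through `Im u = (u - ū)/(2i)` in the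
argument of `errE`. -/
lemma hasFDerivAt_zwegers_term (τ : ℂ) (k : ℤ) (u : ℂ) :
    HasFDerivAt (fun u => (zwegersCoeff τ u k : ℂ) * zwegersExp τ u k)
      ((zwegersCoeff τ u k * (-(2 * Real.pi * I * ((k : ℂ) + 1 / 2)) * zwegersExp τ u k) +
        I * (Real.sqrt (2 * τ.im) / τ.im *
          Real.exp (-Real.pi * (((k : ℝ) + 1 / 2 + u.im / τ.im) * Real.sqrt (2 * τ.im)) ^ 2) : ℝ) *
            zwegersExp τ u k) • (1 : ℂ →L[ℝ] ℂ) +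
      (-I * (Real.sqrt (2 * τ.im) / τ.im *
          Real.exp (-Real.pi * (((k : ℝ) + 1 / 2 + u.im / τ.im) * Real.sqrt (2 * τ.im)) ^ 2) : ℝ) *
            zwegersExp τ u k) • (conjCLE : ℂ →L[ℝ] ℂ)) u := by
  have h1 : HasDerivAt (fun u => zwegersExp τ u k)
      (-(2 * Real.pi * I * ((k : ℂ) + 1 / 2)) * zwegersExp τ u k) u := by
    have h := (((hasDerivAt_id u).const_mul (2 * Real.pi * I * ((k : ℂ) + 1 / 2))).const_sub
      (-Real.pi * I * ((k : ℂ) + 1 / 2) ^ 2 * τ)).cexp.const_mul ((-1 : ℂ) ^ k)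
    simp only [id] at h
    convert! h using 1
    rw [zwegersExp]
    ring
  have h2 : HasFDerivAt (fun u : ℂ => zwegersCoeff τ u k)
      (-(2 * Real.exp (-Real.pi *
        (((k : ℝ) + 1 / 2 + u.im / τ.im) * Real.sqrt (2 * τ.im)) ^ 2)) •
        ((Real.sqrt (2 * τ.im) / τ.im) • imCLM)) u := by
    have h3 : HasFDerivAt
        (fun u : ℂ => ((k : ℝ) + 1 / 2 + u.im / τ.im) * Real.sqrt (2 * τ.im))
        ((Real.sqrt (2 * τ.im) / τ.im) • imCLM) u := by
      have := (imCLM.hasFDerivAt (x := u)).const_smul (Real.sqrt (2 * τ.im) / τ.im)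
      refine (this.const_add (((k : ℝ) + 1 / 2) * Real.sqrt (2 * τ.im))).congr_of_eventuallyEq
        (Eventually.of_forall fun z => ?_)
      simp only [imCLM_apply, smul_eq_mul, Pi.smul_apply]
      ring
    have h4 := (hasDerivAt_errE _).comp_hasFDerivAt u h3
    refine (h4.const_sub (Real.sign ((k : ℝ) + 1 / 2))).congr_fderiv ?_
    module
  have h5 : HasFDerivAt (fun u : ℂ => (zwegersCoeff τ u k : ℂ)) _ u :=
    ofRealCLM.hasFDerivAt.comp u h2
  refine (h5.mul (h1.hasFDerivAt.restrictScalars ℝ)).congr_fderiv ?_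
  ext x
  have hx : (starRingEnd ℂ) x = x - 2 * x.im * I := by
    apply Complex.ext <;> simp
    ring
  simp [-Real.sqrt_mul, -Nat.ofNat_nonneg]
  rw [hx]
  ring_nf
  simp only [I_sq]
  ring

/-- `∂R/∂ū = √(2 / y) exp(-2 π (Im u)² / y) conj (ϑ(u; τ))`. -/
lemma hasDbarAt_zwegersR {τ : ℂ} (hτ : 0 < τ.im) (u : ℂ) :
    HasDbarAt (fun u => zwegersR u τ) ((Real.sqrt (2 * τ.im) / τ.im *
      Real.exp (-(2 * Real.pi * u.im ^ 2 / τ.im)) : ℝ) * (starRingEnd ℂ) (theta u τ)) u := by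
  -- The bounds are uniform on the strip `|Im| < B`, which is open, connected and contains `u`; this
  -- permits termwise differentiation.
  set B := |u.im| + 1 with hB
  set c := Real.sqrt (2 * τ.im) / τ.im with hc
  have hc0 : 0 ≤ c := by positivity
  set a : ℤ → ℂ → ℂ := fun k u =>
    zwegersCoeff τ u k * (-(2 * Real.pi * I * ((k : ℂ) + 1 / 2)) * zwegersExp τ u k) +
        I * (c * Real.exp (-Real.pi * (((k : ℝ) + 1 / 2 + u.im / τ.im) *
          Real.sqrt (2 * τ.im)) ^ 2) : ℝ) * zwegersExp τ u k with ha
  set b : ℤ → ℂ → ℂ := fun k u => -I * (c *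
          Real.exp (-Real.pi * (((k : ℝ) + 1 / 2 + u.im / τ.im) * Real.sqrt (2 * τ.im)) ^ 2) : ℝ) *
            zwegersExp τ u k with hb
  have hbound : ∀ k u, |u.im| ≤ B → ‖b k u‖ ≤ c * gaussBound τ.im B k := by
    intro k u hu
    rw [hb]
    simp only [norm_mul, norm_neg, norm_I, one_mul, norm_real, Real.norm_eq_abs, Real.abs_exp,
      abs_of_nonneg hc0]
    rw [mul_assoc]
    gcongr
    refine (gauss_mul_norm_zwegersExp_le hτ hu k).trans ?_
    refine mul_le_of_le_one_left (gaussBound_nonneg _ _ _) ?_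
    rw [Real.exp_le_one_iff, neg_nonpos]
    have := Real.pi_pos
    positivity
  have habound : ∀ k u, |u.im| ≤ B → ‖a k u‖ ≤
      4 * Real.pi * (|(k : ℝ)| ^ 1 * gaussBound τ.im B k) +
        (2 * Real.pi + c) * (|(k : ℝ)| ^ 0 * gaussBound τ.im B k) := by
    intro k u hu
    have h1 : a k u = zwegersCoeff τ u k * (-(2 * Real.pi * I * ((k : ℂ) + 1 / 2)) *
        zwegersExp τ u k) + -b k u := by
      rw [ha, hb]
      ring
    rw [h1]
    refine (norm_add_le _ _).trans ?_
    rw [norm_neg]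
    have h2 := hbound k u hu
    have h3 := abs_zwegersCoeff_mul_le hτ hu k
    have h4 : ‖(-(2 * Real.pi * I * ((k : ℂ) + 1 / 2)))‖ ≤ 2 * Real.pi * (|(k : ℝ)| + 1 / 2) := by
      rw [norm_neg, norm_mul, norm_mul, norm_mul, norm_I, norm_real, Real.norm_eq_abs,
        abs_of_pos Real.pi_pos, mul_one, RCLike.norm_ofNat]
      gcongr
      refine (norm_add_le _ _).trans ?_
      simp
    rw [norm_mul, norm_mul, norm_real, Real.norm_eq_abs]
    have h5 : |zwegersCoeff τ u k| * (‖(-(2 * Real.pi * I * ((k : ℂ) + 1 / 2)))‖ *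
        ‖zwegersExp τ u k‖) ≤ (2 * gaussBound τ.im B k) * (2 * Real.pi * (|(k : ℝ)| + 1 / 2)) := by
      rw [mul_left_comm, mul_comm (2 * gaussBound _ _ _)]
      gcongr
    rw [pow_one, pow_zero]
    linarith
  have hopen : IsOpen {u : ℂ | |u.im| < B} :=
    isOpen_lt (by fun_prop) continuous_const
  have hconn : IsPreconnected {u : ℂ | |u.im| < B} := by
    have : {u : ℂ | |u.im| < B} = imCLM ⁻¹' (Set.Ioo (-B) B) := by
      ext u
      simp [abs_lt]
    rw [this]
    exact ((convex_Ioo _ _).linear_preimage (imCLM : ℂ →ₗ[ℝ] ℝ)).isPreconnected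
  have hsum1 := (summable_pow_mul_gaussBound hτ B 1).mul_left (4 * Real.pi)
  have hsum0 := summable_pow_mul_gaussBound hτ B 0
  have hsa : Summable fun k : ℤ => 4 * Real.pi * (|(k : ℝ)| ^ 1 * gaussBound τ.im B k) +
        (2 * Real.pi + c) * (|(k : ℝ)| ^ 0 * gaussBound τ.im B k) :=
    hsum1.add (hsum0.mul_left _)
  have hsb : Summable fun k => c * gaussBound τ.im B k := (summable_gaussBound hτ B).mul_left c
  have hu : |u.im| < B := by rw [hB]; linarith
  have hone : ‖(1 : ℂ →L[ℝ] ℂ)‖ ≤ 1 := ContinuousLinearMap.norm_id_le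
  have hconj : ‖(conjCLE : ℂ →L[ℝ] ℂ)‖ ≤ 1 := by
    refine ContinuousLinearMap.opNorm_le_bound _ zero_le_one fun x => ?_
    simp
  have hmain := hasFDerivAt_tsum_of_isPreconnected (𝕜 := ℝ)
    (f := fun k u => (zwegersCoeff τ u k : ℂ) * zwegersExp τ u k)
    (f' := fun k u => a k u • (1 : ℂ →L[ℝ] ℂ) + b k u • (conjCLE : ℂ →L[ℝ] ℂ))
    (u := fun k : ℤ => (4 * Real.pi * (|(k : ℝ)| ^ 1 * gaussBound τ.im B k) +
        (2 * Real.pi + c) * (|(k : ℝ)| ^ 0 * gaussBound τ.im B k)) + c * gaussBound τ.im B k)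
    (hsa.add hsb) hopen hconn (fun k u _ => hasFDerivAt_zwegers_term τ k u)
    (fun k x hx => by
      have hx : |x.im| ≤ B := le_of_lt hx
      refine (norm_add_le _ _).trans (add_le_add ?_ ?_)
      · rw [norm_smul]
        exact (mul_le_of_le_one_right (norm_nonneg _) hone).trans (habound k x hx)
      · rw [norm_smul]
        exact (mul_le_of_le_one_right (norm_nonneg _) hconj).trans (hbound k x hx))
    hu (summable_zwegers hτ u) hu
  have ha' : Summable fun k => a k u := Summable.of_norm_bounded hsa fun k => habound k u hu.le
  have hb' : Summable fun k => b k u := Summable.of_norm_bounded hsb fun k => hbound k u hu.le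
  -- After the square is completed, the exponents of the `ū`-derivatives are the conjugates of those
  -- in the series for `theta u τ`.
  have htheta : ∑' k, b k u = ((c * Real.exp (-(2 * Real.pi * u.im ^ 2 / τ.im)) : ℝ) : ℂ) *
      (starRingEnd ℂ) (theta u τ) := by
    rw [theta, conj_tsum, ← tsum_mul_left]
    refine tsum_congr fun k => ?_
    have e1 : cexp (Real.pi * I * ((k : ℂ) + 1 / 2) ^ 2 * τ +
        2 * Real.pi * I * ((k : ℂ) + 1 / 2) * (u + 1 / 2)) = I * ((-1) ^ k *
        cexp (Real.pi * I * ((k : ℂ) + 1 / 2) ^ 2 * τ + 2 * Real.pi * I * ((k : ℂ) + 1 / 2) * u)) := by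
      rw [← exp_pi_mul_I_int, ← Complex.exp_add, show ∀ z : ℂ, I * z =
        cexp (Real.pi * I * (1 / 2)) * z by rw [exp_pi_mul_I_half]; exact fun _ => rfl,
        ← Complex.exp_add]
      congr 1
      ring
    rw [hb, e1]
    simp only [map_mul, conj_I, map_zpow₀, map_neg, map_one, ← Complex.exp_conj, map_add, map_pow,
      map_ofNat, conj_ofReal, map_div₀, map_intCast, zwegersExp]
    rw [ofReal_mul c, ofReal_mul c, ofReal_exp, ofReal_exp]
    have e2 : cexp ((-Real.pi * (((k : ℝ) + 1 / 2 + u.im / τ.im) * Real.sqrt (2 * τ.im)) ^ 2 : ℝ)) *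
        cexp (-Real.pi * I * ((k : ℂ) + 1 / 2) ^ 2 * τ - 2 * Real.pi * I * ((k : ℂ) + 1 / 2) * u) =
        cexp ((-(2 * Real.pi * u.im ^ 2 / τ.im) : ℝ)) *
        cexp (Real.pi * -I * ((k : ℂ) + 1 / 2) ^ 2 * (starRingEnd ℂ) τ +
          2 * Real.pi * -I * ((k : ℂ) + 1 / 2) * (starRingEnd ℂ) u) := by
      rw [← Complex.exp_add, ← Complex.exp_add]
      congr 1
      have hτ0 : (τ.im : ℂ) ≠ 0 := by exact_mod_cast hτ.ne'
      have h1 : (starRingEnd ℂ) τ = τ - 2 * τ.im * I := by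
        apply Complex.ext <;> simp
        ring
      have h2 : (starRingEnd ℂ) u = u - 2 * u.im * I := by
        apply Complex.ext <;> simp
        ring
      rw [h1, h2, mul_pow, Real.sq_sqrt (by positivity)]
      push_cast
      field_simp
      ring_nf
      simp only [I_sq]
      ring
    linear_combination (-I * c * (-1) ^ k) * e2
  refine ⟨∑' k, a k u, ?_⟩
  rw [← htheta, show (fun u => zwegersR u τ) =
    fun u => ∑' k, (zwegersCoeff τ u k : ℂ) * zwegersExp τ u k from funext fun u => zwegersR_eq u τ]
  refine hmain.congr_fderiv ?_
  rw [Summable.tsum_add (ha'.smul_const _) (hb'.smul_const _), ha'.tsum_smul_const,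
    hb'.tsum_smul_const]

/-! ### Elliptic transformations of `μ̃` -/

lemma muTilde_add_one_left (u v τ : ℂ) : muTilde (u + 1) v τ = -muTilde u v τ := by
  rw [muTilde, muTilde, mu_add_one_left, show u + 1 - v = u - v + 1 by ring, zwegersR_add_one]
  ring

lemma muTilde_add_one_right (u v τ : ℂ) : muTilde u (v + 1) τ = -muTilde u v τ := by
  have h := zwegersR_add_one (u - (v + 1)) τ
  rw [show u - (v + 1) + 1 = u - v by ring] at h
  rw [muTilde, muTilde, mu_add_one_right, h]
  ring

lemma muTilde_T (u v τ : ℂ) : muTilde u v (τ + 1) = cexp (-(Real.pi * I / 4)) * muTilde u v τ := by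
  rw [muTilde, muTilde, mu_T, zwegersR_T]
  ring

/-- The completion restores ellipticity: the inhomogeneous terms of `mu_add_tau_left` and
`zwegersR_add_tau` cancel. -/
lemma muTilde_add_tau_left {u v τ : ℂ} (hτ : 0 < τ.im) (hu : OffLattice u τ)
    (hv : theta v τ ≠ 0) :
    muTilde (u + τ) v τ = -cexp (Real.pi * I * τ + 2 * Real.pi * I * (u - v)) * muTilde u v τ := by
  rw [muTilde, muTilde, mu_add_tau_left hτ hu hv, show u + τ - v = u - v + τ by ring,
    zwegersR_add_tau _ hτ]
  ring

lemma muTilde_add_tau_right {u v τ : ℂ} (hτ : 0 < τ.im) (hu : OffLattice u τ)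
    (hv : theta v τ ≠ 0) :
    muTilde u (v + τ) τ = -cexp (Real.pi * I * τ + 2 * Real.pi * I * (v - u)) * muTilde u v τ := by
  have h := zwegersR_add_tau (u - (v + τ)) hτ
  rw [show u - (v + τ) + τ = u - v by ring] at h
  rw [muTilde, muTilde, mu_add_tau_right hτ hu hv]
  set R := zwegersR (u - (v + τ)) τ
  rw [h, show Real.pi * I * τ - 2 * Real.pi * I * (u - v) =
    Real.pi * I * τ + 2 * Real.pi * I * (v - u) by ring]
  have e1 : cexp (Real.pi * I * τ + 2 * Real.pi * I * (v - u)) *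
      cexp (Real.pi * I * (u - (v + τ)) + 3 * Real.pi * I * τ / 4) =
      cexp (-(Real.pi * I * (u - v)) + 3 * Real.pi * I * τ / 4) := by
    rw [← Complex.exp_add]; congr 1; ring
  have e2 : cexp (Real.pi * I * τ + 2 * Real.pi * I * (v - u)) *
      cexp (Real.pi * I * τ + 2 * Real.pi * I * (u - (v + τ))) = 1 := by
    rw [← Complex.exp_add, ← Complex.exp_zero]; congr 1; ring
  linear_combination I * e1 - (I / 2 * R) * e2

/-! ### Analytic properties of the Appell sum -/

/-- From `1 - y q^n = (y/x)(1 - x q^n) + (1 - y/x)`, a lower bound at `x` uniform in `n` persists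
for `y` near `x`. Indices with a pole at `x` itself are left out. -/
lemma exists_norm_inv_le_near (x : ℂ) (hx : x ≠ 0) {q : ℂ} (hq : ‖q‖ < 1) (hq0 : q ≠ 0) :
    ∃ M : ℝ, ∀ᶠ y in 𝓝 x, ∀ n : ℤ, 1 - x * q ^ n ≠ 0 →
      1 - y * q ^ n ≠ 0 ∧ ‖(1 - y * q ^ n)⁻¹‖ ≤ M := by
  obtain ⟨C, hC0, hC⟩ := exists_norm_inv_one_sub_le hq hx hq0
  set K := C + 1 with hK
  have hKpos : 0 < K := by positivity
  refine ⟨4 * K, ?_⟩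
  have ht : Tendsto (fun y : ℂ => ‖1 - y / x‖) (𝓝 x) (𝓝 0) := by
    have : ContinuousAt (fun y : ℂ => ‖1 - y / x‖) x := by fun_prop
    simpa [ContinuousAt, div_self hx] using this
  have h1 : (0 : ℝ) < min (1 / 2) (1 / (4 * K)) := by positivity
  filter_upwards [ht.eventually_lt_const h1] with y hy n hn
  have hy1 := hy.trans_le (min_le_left _ _)
  have hy2 := hy.trans_le (min_le_right _ _)
  have hlow : 1 / K ≤ ‖1 - x * q ^ n‖ := by
    have h2 := (hC n).trans (by linarith : C ≤ K)
    rw [norm_inv] at h2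
    have h3 : 0 < ‖1 - x * q ^ n‖ := norm_pos_iff.mpr hn
    rw [div_le_iff₀ hKpos]
    rw [inv_le_iff_one_le_mul₀ h3] at h2
    linarith
  have e : 1 - y * q ^ n = y / x * (1 - x * q ^ n) - -(1 - y / x) := by
    field_simp
    ring
  have hyx : 1 / 2 ≤ ‖y / x‖ := by
    have := norm_sub_norm_le (1 : ℂ) (1 - y / x)
    rw [norm_one, sub_sub_cancel] at this
    linarith
  have hmain : 1 / (4 * K) ≤ ‖1 - y * q ^ n‖ := by
    rw [e]
    refine le_trans ?_ (norm_sub_norm_le _ _)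
    rw [norm_mul, norm_neg]
    have h4 : 1 / 2 * (1 / K) ≤ ‖y / x‖ * ‖1 - x * q ^ n‖ := by gcongr
    have h5 : 1 / 2 * (1 / K) = 1 / (4 * K) + 1 / (4 * K) := by field_simp; norm_num
    linarith
  have hpos : 0 < ‖1 - y * q ^ n‖ := lt_of_lt_of_le (by positivity) hmain
  refine ⟨norm_pos_iff.mp hpos, ?_⟩
  rw [norm_inv, inv_le_iff_one_le_mul₀ hpos]
  rw [div_le_iff₀ (by positivity)] at hmain
  linarith

/-- Dropping the terms singular at `x` serves two purposes: off the lattice nothing is dropped and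
`μ` is holomorphic; at `x = 1` only `n = 0` is dropped, which isolates the pole. -/
lemma differentiableAt_appell_tail {q : ℂ} (hq : ‖q‖ < 1) (hq0 : q ≠ 0) {t : ℤ → ℂ}
    (ht : Summable fun n => ‖t n‖) (x : ℂ) (hx : x ≠ 0) :
    DifferentiableAt ℂ
      (fun y => ∑' n : ℤ, if 1 - x * q ^ n = 0 then 0 else t n / (1 - y * q ^ n)) x := by
  obtain ⟨M, hM⟩ := exists_norm_inv_le_near x hx hq hq0
  obtain ⟨r, hr, hball⟩ := Metric.eventually_nhds_iff_ball.mp hM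
  have hM0 : ∀ n : ℤ, ∀ y ∈ Metric.ball x r,
      ‖(if 1 - x * q ^ n = 0 then 0 else t n / (1 - y * q ^ n))‖ ≤ ‖t n‖ * |M| := by
    intro n y hy
    split_ifs with h
    · rw [norm_zero]; positivity
    · rw [div_eq_mul_inv, norm_mul]
      gcongr
      exact (hball y hy n h).2.trans (le_abs_self M)
  refine (Complex.differentiableOn_tsum_of_summable_norm (ht.mul_right |M|) ?_
    Metric.isOpen_ball hM0).differentiableAt (Metric.ball_mem_nhds x hr)
  intro n y hy
  by_cases h : 1 - x * q ^ n = 0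
  · simp only [h, if_true]
    fun_prop
  · simp only [h, if_false]
    have := (hball y hy n h).1
    have h2 : DifferentiableAt ℂ (fun y => t n / (1 - y * q ^ n)) y := by
      fun_prop (disch := assumption)
    exact h2.differentiableWithinAt

lemma summable_norm_appellTerm {τ : ℂ} (hτ : 0 < τ.im) (v : ℂ) : Summable fun n =>
    ‖tripleTerm (nome τ) (nome τ * cexp (2 * Real.pi * I * v)) n‖ :=
  summable_norm_tripleTerm (norm_nome_lt_one hτ) (nome_ne_zero τ)
    (mul_ne_zero (nome_ne_zero τ) (Complex.exp_ne_zero _))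

lemma differentiableAt_mu {u v τ : ℂ} (hτ : 0 < τ.im) (hu : OffLattice u τ) :
    DifferentiableAt ℂ (fun u => mu u v τ) u := by
  have h := differentiableAt_appell_tail (norm_nome_lt_one hτ) (nome_ne_zero τ)
    (summable_norm_appellTerm hτ v) _ (Complex.exp_ne_zero (2 * Real.pi * I * u))
  simp only [hu _, if_false] at h
  have h2 : DifferentiableAt ℂ (fun u => cexp (2 * Real.pi * I * u)) u := by fun_prop
  have h3 := h.comp u h2
  simp only [mu_eq_appell]
  exact DifferentiableAt.mul (by fun_prop) h3

lemma eventually_offLattice {u τ : ℂ} (hτ : 0 < τ.im) (hu : OffLattice u τ) :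
    ∀ᶠ z in 𝓝 u, OffLattice z τ := by
  obtain ⟨M, hM⟩ := exists_norm_inv_le_near _ (Complex.exp_ne_zero (2 * Real.pi * I * u))
    (norm_nome_lt_one hτ) (nome_ne_zero τ)
  have hc : ContinuousAt (fun u => cexp (2 * Real.pi * I * u)) u := by fun_prop
  filter_upwards [hc.eventually hM] with z hz n
  exact (hz n (hu n)).1

lemma one_sub_exp_mul_nome_zpow {τ : ℂ} (hτ : 0 < τ.im) {n : ℤ} :
    1 - cexp (2 * Real.pi * I * 0) * nome τ ^ n = 0 ↔ n = 0 := by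
  rw [mul_zero, Complex.exp_zero, one_mul]
  constructor
  · intro h
    by_contra hn
    have h1 : ‖nome τ‖ ^ n = 1 := by
      rw [← norm_zpow, ← sub_eq_zero.mp h, norm_one]
    have h2 := norm_pos_iff.mpr (nome_ne_zero τ)
    rcases lt_or_gt_of_ne hn with h0 | h0
    · exact (one_lt_zpow_of_neg₀ h2 (norm_nome_lt_one hτ) h0).ne' h1
    · exact (zpow_lt_one₀ h2 (norm_nome_lt_one hτ) h0).ne h1
  · rintro rfl
    simp

lemma eventually_offLattice_zero {τ : ℂ} (hτ : 0 < τ.im) : ∀ᶠ z in 𝓝[≠] 0, OffLattice z τ := by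
  obtain ⟨M, hM⟩ := exists_norm_inv_le_near _ (Complex.exp_ne_zero (2 * Real.pi * I * 0))
    (norm_nome_lt_one hτ) (nome_ne_zero τ)
  have hc : ContinuousAt (fun u => cexp (2 * Real.pi * I * u)) 0 := by fun_prop
  have hball : ∀ᶠ z : ℂ in 𝓝[≠] 0, ‖z‖ < 1 := by
    refine nhdsWithin_le_nhds ?_
    filter_upwards [Metric.ball_mem_nhds (0 : ℂ) one_pos] with z hz
    simpa using hz
  filter_upwards [nhdsWithin_le_nhds (hc.eventually hM), hball, self_mem_nhdsWithin] with z hz hz1 hz0 n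
  by_cases hn : n = 0
  · subst hn
    rw [zpow_zero, mul_one]
    intro h
    rw [sub_eq_zero, eq_comm, Complex.exp_eq_one_iff] at h
    obtain ⟨m, hm⟩ := h
    have hzm : z = m := by
      apply mul_left_cancel₀ Complex.two_pi_I_ne_zero
      linear_combination hm
    rw [hzm, Complex.norm_intCast] at hz1
    have : m = 0 := by
      have : |m| < 1 := by exact_mod_cast hz1
      exact Int.abs_lt_one_iff.mp this
    exact hz0 (by simp [hzm, this])
  · exact (hz n (by rwa [Ne, one_sub_exp_mul_nome_zpow hτ])).1

/-- The residue at `u = 0`, which comes from the term `n = 0` alone. -/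
lemma tendsto_mul_mu {v τ : ℂ} (hτ : 0 < τ.im) : Tendsto (fun u => u * mu u v τ) (𝓝[≠] 0)
    (𝓝 (-(2 * Real.pi * I)⁻¹ / theta v τ)) := by
  set t := tripleTerm (nome τ) (nome τ * cexp (2 * Real.pi * I * v)) with ht
  have h := differentiableAt_appell_tail (norm_nome_lt_one hτ) (nome_ne_zero τ)
    (summable_norm_appellTerm hτ v) _ (Complex.exp_ne_zero (2 * Real.pi * I * 0))
  simp only [one_sub_exp_mul_nome_zpow hτ] at h
  set F : ℂ → ℂ := fun y => ∑' n : ℤ, if n = 0 then 0 else t n / (1 - y * nome τ ^ n) with hF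
  have hx : DifferentiableAt ℂ (fun u => cexp (2 * Real.pi * I * u)) 0 := by fun_prop
  have hFc : ContinuousAt (fun u => F (cexp (2 * Real.pi * I * u))) 0 :=
    ContinuousAt.comp (f := fun u => cexp (2 * Real.pi * I * u)) h.continuousAt hx.continuousAt
  have hsplit : ∀ u, appell (nome τ) (cexp (2 * Real.pi * I * u)) (cexp (2 * Real.pi * I * v)) =
      (1 - cexp (2 * Real.pi * I * u))⁻¹ + F (cexp (2 * Real.pi * I * u)) := by
    intro u
    rw [appell, (summable_norm_tripleTerm_div (norm_nome_lt_one hτ) (nome_ne_zero τ)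
      (Complex.exp_ne_zero _) (mul_ne_zero (nome_ne_zero τ)
        (Complex.exp_ne_zero _))).of_norm.tsum_eq_add_tsum_ite 0]
    simp [tripleTerm, tri, hF, ht]
  have hpole : Tendsto (fun u : ℂ => u * (1 - cexp (2 * Real.pi * I * u))⁻¹) (𝓝[≠] 0)
      (𝓝 (-(2 * Real.pi * I)⁻¹)) := by
    have hd : HasDerivAt (fun u => cexp (2 * Real.pi * I * u)) (2 * Real.pi * I) 0 := by
      have := ((hasDerivAt_id (0 : ℂ)).const_mul (2 * Real.pi * I)).cexp
      simpa using this
    have hs := hd.tendsto_slope_zero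
    have hs2 := (hs.inv₀ Complex.two_pi_I_ne_zero).neg
    refine hs2.congr fun u => ?_
    simp only [zero_add, mul_zero, Complex.exp_zero, smul_eq_mul, mul_inv, inv_inv]
    rw [← mul_neg, ← inv_neg, neg_sub]
  have h1 : Tendsto (fun u : ℂ => cexp (Real.pi * I * u) / theta v τ) (𝓝[≠] 0)
      (𝓝 (1 / theta v τ)) := by
    have : ContinuousAt (fun u : ℂ => cexp (Real.pi * I * u) / theta v τ) 0 := by fun_prop
    have := this.tendsto.mono_left (nhdsWithin_le_nhds (s := {0}ᶜ))
    simpa using this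
  have h2 : Tendsto (fun u : ℂ => u * F (cexp (2 * Real.pi * I * u))) (𝓝[≠] 0) (𝓝 0) := by
    have := (continuousAt_id.mul hFc).tendsto.mono_left (nhdsWithin_le_nhds (s := {0}ᶜ))
    simpa [Pi.mul_def] using this
  have h3 := h1.mul (hpole.add h2)
  rw [add_zero, div_mul_eq_mul_div, one_mul] at h3
  refine h3.congr fun u => ?_
  rw [mu_eq_appell, hsplit]
  ring

/-- A doubly periodic entire function is constant. -/
lemma eq_of_doubly_periodic {f : ℂ → ℂ} {τ : ℂ} (hτ : 0 < τ.im) (hf : Differentiable ℂ f)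
    (h1 : ∀ z, f (z + 1) = f z) (hτ' : ∀ z, f (z + τ) = f z) (z w : ℂ) : f z = f w := by
  refine hf.apply_eq_apply_of_bounded ?_ z w
  have hcomp : IsCompact ((fun p : ℝ × ℝ => f (p.1 + p.2 * τ)) '' Set.Icc (0, 0) (1, 1)) := by
    refine isCompact_Icc.image ?_
    have := hf.continuous
    fun_prop
  refine hcomp.isBounded.subset ?_
  rintro _ ⟨z, rfl⟩
  have hp1 : Function.Periodic f 1 := h1
  have hpτ : Function.Periodic f τ := hτ'
  set b := z.im / τ.im with hb
  set a := z.re - b * τ.re with ha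
  refine ⟨(Int.fract a, Int.fract b), ⟨⟨Int.fract_nonneg _, Int.fract_nonneg _⟩,
    ⟨(Int.fract_lt_one _).le, (Int.fract_lt_one _).le⟩⟩, ?_⟩
  have hz : z = ((Int.fract a : ℝ) + (Int.fract b : ℝ) * τ) + (⌊a⌋ * 1) + (⌊b⌋ * τ) := by
    have e1 : ((Int.fract a : ℝ) : ℂ) = a - ⌊a⌋ := by rw [Int.fract]; push_cast; rfl
    have e2 : ((Int.fract b : ℝ) : ℂ) = b - ⌊b⌋ := by rw [Int.fract]; push_cast; rfl
    rw [e1, e2]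
    have e3 : z = a + b * τ := by
      apply Complex.ext
      · simp [ha]
      · simp [hb, hτ.ne']
    linear_combination e3
  conv_rhs => rw [hz]
  rw [(hpτ.int_mul ⌊b⌋) _, (hp1.int_mul ⌊a⌋) _]

/-! ### The transformation of `μ̃` under `τ ↦ -1 / τ` -/

lemma sqrt_neg_I_mul_sq (τ : ℂ) : ((-I * τ) ^ (1 / 2 : ℂ)) ^ 2 = -I * τ := by
  rw [← Complex.cpow_nat_mul]
  norm_num

/-- It matches the Gaussian weights of the two `∂̄`-derivatives in `differentiable_zwegersR_S`. -/
lemma normSq_mul_im_identity {τ : ℂ} (hτ : 0 < τ.im) (w : ℂ) :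
    (w ^ 2 / τ).im + (w / τ).im ^ 2 * normSq τ / τ.im = w.im ^ 2 / τ.im := by
  have h : normSq τ ≠ 0 := (normSq_pos.mpr (ne_zero_of_im_pos hτ)).ne'
  have h2 := hτ.ne'
  rw [Complex.div_im, Complex.div_im]
  field_simp
  simp only [pow_two, mul_re, mul_im]
  rw [normSq_apply]
  ring

/-- The Mordell integral, written through `R`, is holomorphic. -/
lemma differentiable_zwegersR_S {τ : ℂ} (hτ : 0 < τ.im) : Differentiable ℂ fun w =>
    cexp (Real.pi * I * w ^ 2 / τ) * zwegersR (w / τ) (-1 / τ) +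
      (-I * τ) ^ (1 / 2 : ℂ) * zwegersR w τ := by
  intro w
  set s := (-I * τ) ^ (1 / 2 : ℂ) with hs
  have hτ0 := ne_zero_of_im_pos hτ
  have hN : 0 < normSq τ := normSq_pos.mpr hτ0
  have h1 := HasDbarAt.comp_mul (c := τ⁻¹) (d := 0) (u := w)
    (hasDbarAt_zwegersR (im_neg_one_div_pos hτ) (τ⁻¹ * w + 0))
  have e : (fun z => zwegersR (τ⁻¹ * z + 0) (-1 / τ)) = fun z => zwegersR (z / τ) (-1 / τ) := by
    funext z
    rw [add_zero, div_eq_inv_mul z]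
  rw [e] at h1
  have h2 := h1.mul_left (g := fun w => cexp (Real.pi * I * w ^ 2 / τ)) (by fun_prop)
  have h3 := (hasDbarAt_zwegersR hτ w).mul_left (g := fun _ => s) (by fun_prop)
  have h4 := h2.add h3
  refine HasDbarAt.differentiableAt ?_
  -- It remains to see that the two `∂̄`-derivatives cancel: by `theta_S` both are multiples of the
  -- conjugate of `theta w τ`, with opposite coefficients.
  convert h4 using 1
  rw [add_zero, ← div_eq_inv_mul, theta_S w hτ, ← hs]
  set t := (starRingEnd ℂ) (theta w τ) with ht
  have hsq : s ^ 2 = -I * τ := sqrt_neg_I_mul_sq τ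
  have hcs : (starRingEnd ℂ) s ^ 2 = I * (starRingEnd ℂ) τ := by
    rw [← map_pow, hsq, map_mul, map_neg, conj_I, neg_neg]
  have hns : s * (starRingEnd ℂ) s = (‖τ‖ : ℝ) := by
    rw [Complex.mul_conj, Complex.normSq_eq_norm_sq, ← norm_pow, hsq]
    simp
  have hnorm : 0 < ‖τ‖ := norm_pos_iff.mpr hτ0
  have hcoef : Real.sqrt (2 * (-1 / τ).im) / (-1 / τ).im = Real.sqrt (2 * τ.im) / τ.im * ‖τ‖ := by
    rw [im_neg_one_div, Complex.normSq_eq_norm_sq, ← mul_div_assoc, Real.sqrt_div (by positivity),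
      Real.sqrt_sq hnorm.le]
    field_simp
  have hexp : cexp (Real.pi * I * w ^ 2 / τ) * (starRingEnd ℂ) (cexp (Real.pi * I * w ^ 2 / τ)) *
      (Real.exp (-(2 * Real.pi * (w / τ).im ^ 2 / (-1 / τ).im)) : ℝ) =
      (Real.exp (-(2 * Real.pi * w.im ^ 2 / τ.im)) : ℝ) := by
    rw [Complex.mul_conj, Complex.normSq_eq_norm_sq, Complex.norm_exp, ← ofReal_mul, ← Real.exp_nat_mul,
      ← Real.exp_add]
    congr 2
    rw [im_neg_one_div, mul_div_assoc (2 * Real.pi) (w.im ^ 2), ← normSq_mul_im_identity hτ w]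
    have : (Real.pi * I * w ^ 2 / τ).re = -(Real.pi * (w ^ 2 / τ).im) := by
      rw [show Real.pi * I * w ^ 2 / τ = (Real.pi : ℂ) * (w ^ 2 / τ * I) by ring, re_ofReal_mul,
        mul_I_re]
      ring
    rw [this]
    field_simp
    push_cast
    ring
  have hc0 : (starRingEnd ℂ) τ ≠ 0 := by simpa using hτ0
  rw [hcoef]
  simp only [map_mul, map_neg, conj_I, neg_neg, map_inv₀, ← ht, ofReal_mul (_ / _ : ℝ),
    ofReal_mul (_ * _ : ℝ), ← hns]
  set e := cexp (Real.pi * I * w ^ 2 / τ)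
  set E' : ℂ := ((Real.exp (-(2 * Real.pi * (w / τ).im ^ 2 / (-1 / τ).im)) : ℝ) : ℂ)
  set E : ℂ := ((Real.exp (-(2 * Real.pi * w.im ^ 2 / τ.im)) : ℝ) : ℂ)
  set c : ℂ := ((Real.sqrt (2 * τ.im) / τ.im : ℝ) : ℂ)
  rw [← hexp]
  field_simp
  linear_combination (-(I * s * c * E' * e * (starRingEnd ℂ) e * t)) * hcs -
    (s * c * E' * e * (starRingEnd ℂ) e * t * (starRingEnd ℂ) τ) * I_sq


lemma offLattice_S {u τ : ℂ} (hτ : 0 < τ.im) (hu : OffLattice u τ) : OffLattice (u / τ) (-1 / τ) := by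
  have hτ0 := ne_zero_of_im_pos hτ
  rw [offLattice_iff] at hu ⊢
  intro m n h
  refine hu n (-m) ?_
  rw [div_eq_iff hτ0] at h
  rw [h]
  push_cast
  field_simp
  ring

lemma OffLattice.sub_one {u τ : ℂ} (h : OffLattice (u + 1) τ) : OffLattice u τ := fun n => by
  have := h n
  rwa [mul_add, Complex.exp_add, mul_one, Complex.exp_two_pi_mul_I, mul_one] at this

/-- The failure of `μ̃` to be modular under `τ ↦ -1 / τ`. -/
def muDefect (u v τ : ℂ) : ℂ :=
  cexp (Real.pi * I * (u - v) ^ 2 / τ) * muTilde (u / τ) (v / τ) (-1 / τ) +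
    (-I * τ) ^ (1 / 2 : ℂ) * muTilde u v τ

lemma theta_S_ne_zero {v τ : ℂ} (hτ : 0 < τ.im) (hv : theta v τ ≠ 0) :
    theta (v / τ) (-1 / τ) ≠ 0 :=
  theta_ne_zero (im_neg_one_div_pos hτ) (offLattice_S hτ (offLattice_of_theta_ne_zero hv))

lemma muDefect_add_one {u v τ : ℂ} (hτ : 0 < τ.im) (hu : OffLattice u τ) (hv : theta v τ ≠ 0) :
    muDefect (u + 1) v τ = -muDefect u v τ := by
  have hτ0 := ne_zero_of_im_pos hτ
  have h := muTilde_add_tau_left (im_neg_one_div_pos hτ) (offLattice_S hτ hu.add_one)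
    (theta_S_ne_zero hτ hv)
  rw [show (u + 1) / τ + -1 / τ = u / τ by ring] at h
  rw [muDefect, muDefect, muTilde_add_one_left, h, show Real.pi * I * (u + 1 - v) ^ 2 / τ =
    Real.pi * I * (u - v) ^ 2 / τ +
      (Real.pi * I * (-1 / τ) + 2 * Real.pi * I * ((u + 1) / τ - v / τ)) by ring, Complex.exp_add]
  ring

lemma muDefect_add_tau {u v τ : ℂ} (hτ : 0 < τ.im) (hu : OffLattice u τ) (hv : theta v τ ≠ 0) :
    muDefect (u + τ) v τ =
      -cexp (Real.pi * I * τ + 2 * Real.pi * I * (u - v)) * muDefect u v τ := by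
  have hτ0 := ne_zero_of_im_pos hτ
  rw [muDefect, muDefect, muTilde_add_tau_left hτ hu hv, add_div, div_self hτ0,
    muTilde_add_one_left, show Real.pi * I * (u + τ - v) ^ 2 / τ =
    Real.pi * I * (u - v) ^ 2 / τ + (Real.pi * I * τ + 2 * Real.pi * I * (u - v)) by
      field_simp; ring, Complex.exp_add]
  ring

lemma muDefect_eq (u v τ : ℂ) : muDefect u v τ =
    cexp (Real.pi * I * (u - v) ^ 2 / τ) * mu (u / τ) (v / τ) (-1 / τ) +
      (-I * τ) ^ (1 / 2 : ℂ) * mu u v τ +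
      I / 2 * (cexp (Real.pi * I * (u - v) ^ 2 / τ) * zwegersR ((u - v) / τ) (-1 / τ) +
        (-I * τ) ^ (1 / 2 : ℂ) * zwegersR (u - v) τ) := by
  rw [muDefect, muTilde, muTilde, sub_div]
  ring

lemma differentiableAt_muDefect {u v τ : ℂ} (hτ : 0 < τ.im) (hu : OffLattice u τ) :
    DifferentiableAt ℂ (fun u => muDefect u v τ) u := by
  simp only [muDefect_eq]
  have h1 : DifferentiableAt ℂ (fun u => mu (u / τ) (v / τ) (-1 / τ)) u :=
    (differentiableAt_mu (im_neg_one_div_pos hτ) (offLattice_S hτ hu)).comp u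
      (f := fun u => u / τ) (by fun_prop)
  have h2 := differentiableAt_mu (v := v) hτ hu
  have h3 : DifferentiableAt ℂ (fun u => cexp (Real.pi * I * (u - v) ^ 2 / τ) *
      zwegersR ((u - v) / τ) (-1 / τ) + (-I * τ) ^ (1 / 2 : ℂ) * zwegersR (u - v) τ) u :=
    (differentiable_zwegersR_S hτ).comp (f := fun u : ℂ => u - v) (by fun_prop) u
  exact ((DifferentiableAt.mul (by fun_prop) h1).add (h2.const_mul _)).add (h3.const_mul _)

/-- The residues of the two `μ` terms at `0` cancel, by `theta_S` at `v` and the square of the root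
being `-Iτ`; the `R` part is holomorphic. -/
lemma tendsto_mul_muDefect {v τ : ℂ} (hτ : 0 < τ.im) (hv : theta v τ ≠ 0) :
    Tendsto (fun u => u * muDefect u v τ) (𝓝[≠] 0) (𝓝 0) := by
  have hτ0 := ne_zero_of_im_pos hτ
  set s := (-I * τ) ^ (1 / 2 : ℂ) with hs
  have hs2 : s ^ 2 = -I * τ := sqrt_neg_I_mul_sq τ
  have hs0 : s ≠ 0 := fun h => by simp [h, hτ0] at hs2
  have hdiv : Tendsto (fun u : ℂ => u / τ) (𝓝[≠] 0) (𝓝[≠] 0) := by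
    refine tendsto_nhdsWithin_iff.mpr ⟨?_, ?_⟩
    · have : ContinuousAt (fun u : ℂ => u / τ) 0 := by fun_prop
      simpa using this.tendsto.mono_left (nhdsWithin_le_nhds (s := {0}ᶜ))
    · filter_upwards [self_mem_nhdsWithin] with u hu
      exact div_ne_zero hu hτ0
  have h1 := (tendsto_mul_mu (v := v / τ) (im_neg_one_div_pos hτ)).comp hdiv
  have h2 := tendsto_mul_mu (v := v) hτ
  have he : Tendsto (fun u : ℂ => cexp (Real.pi * I * (u - v) ^ 2 / τ) * τ) (𝓝[≠] 0)
      (𝓝 (cexp (Real.pi * I * v ^ 2 / τ) * τ)) := by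
    have : ContinuousAt (fun u : ℂ => cexp (Real.pi * I * (u - v) ^ 2 / τ) * τ) 0 := by fun_prop
    simpa using this.tendsto.mono_left (nhdsWithin_le_nhds (s := {0}ᶜ))
  have h3 : Continuous (fun u => cexp (Real.pi * I * (u - v) ^ 2 / τ) *
      zwegersR ((u - v) / τ) (-1 / τ) + s * zwegersR (u - v) τ) :=
    ((differentiable_zwegersR_S hτ).comp (f := fun u : ℂ => u - v) (by fun_prop)).continuous
  have h4 := ((continuous_id.mul (h3.const_mul (I / 2))).tendsto 0).mono_left
    (nhdsWithin_le_nhds (s := {0}ᶜ))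
  have h5 := ((he.mul h1).add (h2.const_mul s)).add h4
  convert h5 using 1
  · funext u
    simp only [muDefect_eq, Function.comp, Pi.mul_apply, id, ← hs]
    field_simp
  · congr 1
    have := Complex.exp_ne_zero (Real.pi * I * v ^ 2 / τ)
    rw [theta_S v hτ, ← hs]
    simp only [Pi.mul_apply, id, zero_mul, add_zero]
    field_simp
    linear_combination I * hs2 - τ * I_sq

lemma eventually_theta_ne_zero {v τ : ℂ} (hτ : 0 < τ.im) (hv : theta v τ ≠ 0) (w : ℂ) :
    ∀ᶠ z in 𝓝[≠] w, theta z τ ≠ 0 := by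
  have han : AnalyticOnNhd ℂ (fun z => theta z τ) Set.univ :=
    (differentiable_theta hτ).differentiableOn.analyticOnNhd isOpen_univ
  refine ((han w (Set.mem_univ _)).eventually_eq_zero_or_eventually_ne_zero).resolve_left ?_
  intro h
  exact hv (han.eqOn_zero_of_preconnected_of_eventuallyEq_zero isPreconnected_univ
    (Set.mem_univ w) h (Set.mem_univ v))

lemma offLattice_add_int_mul {u τ : ℂ} (m n : ℤ) :
    OffLattice (u + (m * τ + n)) τ ↔ OffLattice u τ := by
  simp only [offLattice_iff]
  constructor
  · intro h k l hkl
    refine h (k + m) (l + n) ?_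
    rw [hkl]; push_cast; ring
  · intro h k l hkl
    refine h (k - m) (l - n) ?_
    push_cast
    linear_combination hkl

/-- The factor `theta (u - v) τ` has the inverse quasi-periods of the defect, so the product is
doubly periodic. Its singularities are removable, hence it is constant, and it vanishes at `u = v`
where `theta` does. -/
lemma muDefect_mul_theta_eq_zero {u v τ : ℂ} (hτ : 0 < τ.im) (hu : OffLattice u τ)
    (hv : theta v τ ≠ 0) : muDefect u v τ * theta (u - v) τ = 0 := by
  classical
  set G : ℂ → ℂ := fun u => muDefect u v τ * theta (u - v) τ with hG
  have hGd : ∀ u, OffLattice u τ → DifferentiableAt ℂ G u := fun u hu =>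
    (differentiableAt_muDefect hτ hu).mul
      ((differentiable_theta hτ).comp (f := fun u : ℂ => u - v) (by fun_prop) u)
  set L := limUnder (𝓝[≠] 0) G with hL
  -- On the lattice, where `G` carries only conventional values, the limit at `0` is substituted.
  -- Periodicity carries differentiability at `0` to every lattice point.
  set H : ℂ → ℂ := fun u => if OffLattice u τ then G u else L with hH
  have h0 : ¬ OffLattice 0 τ := fun h => by simpa using offLattice_iff.mp h 0 0
  have hH1 : ∀ z, H (z + 1) = H z := by
    intro z
    have hiff : OffLattice (z + 1) τ ↔ OffLattice z τ :=
      ⟨OffLattice.sub_one, OffLattice.add_one⟩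
    by_cases hz : OffLattice z τ
    · simp only [hH, hiff, hz, if_true, hG, muDefect_add_one hτ hz hv,
        show z + 1 - v = z - v + 1 by ring, theta_add_one]
      ring
    · simp only [hH, hiff, hz, if_false]
  have hHτ : ∀ z, H (z + τ) = H z := by
    intro z
    by_cases hz : OffLattice z τ
    · simp only [hH, offLattice_add_tau, hz, if_true, hG, muDefect_add_tau hτ hz hv,
        show z + τ - v = z - v + τ by ring, theta_add_tau]
      rw [Complex.exp_neg]
      have := Complex.exp_ne_zero (Real.pi * I * τ + 2 * Real.pi * I * (z - v))
      field_simp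
    · simp only [hH, offLattice_add_tau, hz, if_false]
  have hHoff : ∀ z, OffLattice z τ → DifferentiableAt ℂ H z := by
    intro z hz
    refine (hGd z hz).congr_of_eventuallyEq ?_
    filter_upwards [eventually_offLattice hτ hz] with w hw
    simp only [hH, hw, if_true]
  have hH0 : DifferentiableAt ℂ H 0 := by
    have hev := eventually_offLattice_zero hτ
    rw [eventually_nhdsWithin_iff] at hev
    have hd : DifferentiableOn ℂ G ({z | z ∈ ({0}ᶜ : Set ℂ) → OffLattice z τ} \ {0}) := by
      rintro z ⟨hz, hz0⟩
      exact (hGd z (hz hz0)).differentiableWithinAt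
    -- A growth of `o(1/z)` suffices for Riemann's removable singularity theorem.
    have ho : (fun z => G z - G 0) =o[𝓝[≠] 0] fun z => (z - 0)⁻¹ := by
      rw [Asymptotics.isLittleO_iff_tendsto']
      · have hc : ContinuousAt (fun u => theta (u - v) τ) 0 :=
          ((differentiable_theta hτ).comp (f := fun u : ℂ => u - v)
            (by fun_prop)).continuous.continuousAt
        have h1 := (tendsto_mul_muDefect hτ hv).mul (hc.tendsto.mono_left
          (nhdsWithin_le_nhds (s := {0}ᶜ)))
        have h2 : Tendsto (fun z : ℂ => z * G 0) (𝓝[≠] 0) (𝓝 0) := by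
          have : ContinuousAt (fun z : ℂ => z * G 0) 0 := by fun_prop
          simpa using this.tendsto.mono_left (nhdsWithin_le_nhds (s := {0}ᶜ))
        have h3 := h1.sub h2
        rw [zero_mul, sub_zero] at h3
        refine h3.congr fun z => ?_
        simp only [hG, sub_zero, div_inv_eq_mul]
        ring
      · filter_upwards [self_mem_nhdsWithin] with z hz h
        simp at h
        exact absurd h hz
    have h := Complex.differentiableOn_update_limUnder_of_isLittleO hev hd ho
    refine (h.differentiableAt hev).congr_of_eventuallyEq ?_
    filter_upwards [hev] with z hz
    by_cases hz0 : z = 0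
    · subst hz0
      simp [hH, h0, hL]
    · simp [hH, hz hz0, hz0]
  have hHd : Differentiable ℂ H := by
    intro z
    by_cases hz : OffLattice z τ
    · exact hHoff z hz
    · simp only [offLattice_iff, not_forall, not_not, ne_eq] at hz
      obtain ⟨m, n, rfl⟩ := hz
      have hp1 : Function.Periodic H 1 := hH1
      have hpτ : Function.Periodic H τ := hHτ
      have hp : H = fun z => H (z - (m * τ + n)) := by
        funext z
        have e1 := hp1.int_mul n (z - (m * τ + n))
        have e2 := hpτ.int_mul m (z - (m * τ + n) + n * 1)
        rw [← e1, ← e2]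
        congr 1
        ring
      rw [hp]
      have h2 : DifferentiableAt ℂ H ((m * τ + n : ℂ) - (m * τ + n)) := by rwa [sub_self]
      exact h2.comp (m * τ + n : ℂ) (f := fun z => z - (m * τ + n)) (by fun_prop)
  have hv' := offLattice_of_theta_ne_zero hv
  have h := eq_of_doubly_periodic hτ hHd hH1 hHτ u v
  simpa [hH, hu, hv', hG, theta_zero] using h

/-- Zeros of `theta (· - v) τ` are isolated, so the factor can be cancelled on a punctured
neighbourhood; continuity of the defect covers `u` itself. -/
lemma muDefect_eq_zero {u v τ : ℂ} (hτ : 0 < τ.im) (hu : OffLattice u τ)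
    (hv : theta v τ ≠ 0) : muDefect u v τ = 0 := by
  have hc := (differentiableAt_muDefect (v := v) hτ hu).continuousAt
  have hθ := eventually_theta_ne_zero hτ hv (u - v)
  have ht : Tendsto (fun u : ℂ => u - v) (𝓝[≠] u) (𝓝[≠] (u - v)) := by
    refine tendsto_nhdsWithin_iff.mpr ⟨?_, ?_⟩
    · have : ContinuousAt (fun u : ℂ => u - v) u := by fun_prop
      exact this.tendsto.mono_left nhdsWithin_le_nhds
    · filter_upwards [self_mem_nhdsWithin] with w hw h
      exact hw (sub_left_injective h)
  refine tendsto_nhds_unique (hc.tendsto.mono_left (nhdsWithin_le_nhds (s := {u}ᶜ))) ?_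
  refine tendsto_const_nhds.congr' ?_
  filter_upwards [ht.eventually hθ, nhdsWithin_le_nhds (eventually_offLattice hτ hu)] with w hw hw2
  exact ((mul_eq_zero.mp (muDefect_mul_theta_eq_zero hτ hw2 hv)).resolve_right hw).symm

/-- The transformation of `μ̃` under `τ ↦ -1 / τ`. -/
theorem muTilde_S {u v τ : ℂ} (hτ : 0 < τ.im) (hu : OffLattice u τ) (hv : theta v τ ≠ 0) :
    muTilde (u / τ) (v / τ) (-1 / τ) = -(-I * τ) ^ (1 / 2 : ℂ) *
      cexp (-(Real.pi * I * (u - v) ^ 2 / τ)) * muTilde u v τ := by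
  have h := muDefect_eq_zero hτ hu hv
  rw [muDefect] at h
  rw [Complex.exp_neg]
  have := Complex.exp_ne_zero (Real.pi * I * (u - v) ^ 2 / τ)
  generalize muTilde (u / τ) (v / τ) (-1 / τ) = x at h ⊢
  generalize (-I * τ) ^ (1 / 2 : ℂ) = s at h ⊢
  field_simp
  linear_combination h

/-! ### The transformation of `ϑ` and `μ̃` under `SL₂(ℤ)` -/

/-- The factor of automorphy `γ τ + δ` of `A = (α, β; γ, δ)`. -/
def autFactor (A : SL(2, ℤ)) (τ : ℍ) : ℂ := (A 1 0 : ℂ) * τ + (A 1 1 : ℂ)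

/-- The quotient `η(A τ) / η(τ)`. -/
def etaFactor (A : SL(2, ℤ)) (τ : ℍ) : ℂ :=
  ModularForm.eta ((A • τ : ℍ) : ℂ) / ModularForm.eta (τ : ℂ)

lemma autFactor_ne_zero (A : SL(2, ℤ)) (τ : ℍ) : autFactor A τ ≠ 0 := denom_ne A τ

lemma coe_smul_eq (A : SL(2, ℤ)) (τ : ℍ) :
    ((A • τ : ℍ) : ℂ) = ((A 0 0 : ℂ) * τ + (A 0 1 : ℂ)) / autFactor A τ := by
  rw [UpperHalfPlane.coe_specialLinearGroup_apply]
  simp [autFactor]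

lemma det_cast (A : SL(2, ℤ)) : (A 0 0 : ℂ) * A 1 1 - A 0 1 * A 1 0 = 1 := by
  have h := A.det_coe
  rw [Matrix.det_fin_two] at h
  exact_mod_cast h

lemma mul_apply_one_zero (A B : SL(2, ℤ)) :
    (((A * B) 1 0 : ℤ) : ℂ) = A 1 0 * B 0 0 + A 1 1 * B 1 0 := by
  rw [Matrix.SpecialLinearGroup.coe_mul, Matrix.mul_apply, Fin.sum_univ_two]
  push_cast
  rfl

lemma mul_apply_one_one (A B : SL(2, ℤ)) :
    (((A * B) 1 1 : ℤ) : ℂ) = A 1 0 * B 0 1 + A 1 1 * B 1 1 := by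
  rw [Matrix.SpecialLinearGroup.coe_mul, Matrix.mul_apply, Fin.sum_univ_two]
  push_cast
  rfl

lemma autFactor_mul (A B : SL(2, ℤ)) (τ : ℍ) :
    autFactor (A * B) τ = autFactor A (B • τ) * autFactor B τ := by
  have h := autFactor_ne_zero B τ
  rw [autFactor, autFactor, coe_smul_eq, mul_apply_one_zero, mul_apply_one_one]
  field_simp
  rw [autFactor]
  ring

lemma autFactor_one (τ : ℍ) : autFactor 1 τ = 1 := by
  simp [autFactor]

lemma eta_ne_zero (τ : ℍ) : ModularForm.eta (τ : ℂ) ≠ 0 := ModularForm.eta_ne_zero τ.2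

lemma etaFactor_ne_zero (A : SL(2, ℤ)) (τ : ℍ) : etaFactor A τ ≠ 0 :=
  div_ne_zero (eta_ne_zero _) (eta_ne_zero _)

lemma etaFactor_mul (A B : SL(2, ℤ)) (τ : ℍ) :
    etaFactor (A * B) τ = etaFactor A (B • τ) * etaFactor B τ := by
  have := eta_ne_zero (B • τ)
  rw [etaFactor, etaFactor, etaFactor, mul_smul, div_mul_div_cancel₀ this]

lemma etaFactor_one (τ : ℍ) : etaFactor 1 τ = 1 := by
  rw [etaFactor, one_smul, div_self (eta_ne_zero τ)]

/-- The Gaussian part of the index `1/2` automorphy factor. -/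
def gaussFactor (A : SL(2, ℤ)) (τ : ℍ) (w : ℂ) : ℂ :=
  cexp (Real.pi * I * A 1 0 * w ^ 2 / autFactor A τ)

lemma gaussFactor_one (τ : ℍ) (w : ℂ) : gaussFactor 1 τ w = 1 := by
  simp [gaussFactor]

/-- With `j = autFactor` and `γ` the lower left entry, the cocycle property rests on `γ_{AB} j_B =
γ_B j_{AB} + γ_A`, a consequence of `det B = 1`. -/
lemma gaussFactor_mul (A B : SL(2, ℤ)) (τ : ℍ) (w : ℂ) :
    gaussFactor (A * B) τ w = gaussFactor A (B • τ) (w / autFactor B τ) * gaussFactor B τ w := by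
  have h1 := autFactor_ne_zero B τ
  have h2 := autFactor_ne_zero A (B • τ)
  have h3 := autFactor_ne_zero (A * B) τ
  have key : ((A * B) 1 0 : ℂ) * autFactor B τ = B 1 0 * autFactor (A * B) τ + A 1 0 := by
    rw [autFactor, autFactor, mul_apply_one_zero, mul_apply_one_one]
    linear_combination (A 1 0 : ℂ) * det_cast B
  rw [gaussFactor, gaussFactor, gaussFactor, ← Complex.exp_add]
  congr 1
  rw [autFactor_mul] at key ⊢
  field_simp
  linear_combination w ^ 2 * key

lemma offLattice_smul {u : ℂ} (A : SL(2, ℤ)) (τ : ℍ) (hu : OffLattice u τ) :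
    OffLattice (u / autFactor A τ) ((A • τ : ℍ) : ℂ) := by
  have h1 := autFactor_ne_zero A τ
  rw [offLattice_iff] at hu ⊢
  intro m n h
  refine hu (m * A 0 0 + n * A 1 0) (m * A 0 1 + n * A 1 1) ?_
  rw [coe_smul_eq] at h
  field_simp at h
  rw [h, autFactor]
  push_cast
  ring

/-- The statement that `f` transforms under `A` with the automorphy factor `Φ`. -/
def TransformsUnder (f : ℂ → ℂ → ℂ → ℂ) (Φ : SL(2, ℤ) → ℍ → ℂ → ℂ → ℂ) (A : SL(2, ℤ)) : Prop :=
  ∀ (τ : ℍ) (u v : ℂ), OffLattice u τ → OffLattice v τ →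
    f (u / autFactor A τ) (v / autFactor A τ) ((A • τ : ℍ) : ℂ) = Φ A τ u v * f u v τ

/-- For a cocycle `Φ`, the matrices under which `f` transforms form a subgroup, and `S` and `T`
generate. -/
lemma transformsUnder_of_generators {f : ℂ → ℂ → ℂ → ℂ} {Φ : SL(2, ℤ) → ℍ → ℂ → ℂ → ℂ}
    (h1 : ∀ τ u v, Φ 1 τ u v = 1)
    (hmul : ∀ A B τ u v, Φ (A * B) τ u v =
      Φ A (B • τ) (u / autFactor B τ) (v / autFactor B τ) * Φ B τ u v)
    (hS : TransformsUnder f Φ ModularGroup.S) (hT : TransformsUnder f Φ ModularGroup.T)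
    (A : SL(2, ℤ)) : TransformsUnder f Φ A := by
  have hA : A ∈ Subgroup.closure {ModularGroup.S, ModularGroup.T} := by
    rw [SpecialLinearGroup.SL2Z_generators]
    trivial
  induction hA using Subgroup.closure_induction with
  | mem B hB =>
    rcases hB with rfl | rfl
    · exact hS
    · exact hT
  | one =>
    intro τ u v _ _
    rw [autFactor_one, one_smul, div_one, div_one, h1, one_mul]
  | mul A B _ _ hA hB =>
    intro τ u v hu hv
    have e := hA (B • τ) _ _ (offLattice_smul B τ hu) (offLattice_smul B τ hv)
    rw [hB τ u v hu hv, div_div, div_div, mul_comm (autFactor B τ), ← autFactor_mul,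
      ← mul_smul] at e
    rw [e, hmul, mul_assoc]
  | inv A _ hA =>
    intro τ u v hu hv
    have e := hA (A⁻¹ • τ) _ _ (offLattice_smul A⁻¹ τ hu) (offLattice_smul A⁻¹ τ hv)
    rw [div_div, div_div, mul_comm (autFactor A⁻¹ τ), ← autFactor_mul, mul_inv_cancel,
      autFactor_one, div_one, div_one, ← mul_smul, mul_inv_cancel, one_smul] at e
    have h := hmul A A⁻¹ τ u v
    rw [mul_inv_cancel, h1] at h
    rw [e]
    linear_combination h * f (u / autFactor A⁻¹ τ) (v / autFactor A⁻¹ τ) ((A⁻¹ • τ : ℍ) : ℂ)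

lemma autFactor_S (τ : ℍ) : autFactor ModularGroup.S τ = τ := by
  simp [autFactor, ModularGroup.S]

lemma autFactor_T (τ : ℍ) : autFactor ModularGroup.T τ = 1 := by
  simp [autFactor, ModularGroup.T]

lemma coe_S_smul (τ : ℍ) : ((ModularGroup.S • τ : ℍ) : ℂ) = -1 / τ := by
  rw [coe_smul_eq, autFactor_S]
  simp [ModularGroup.S]

lemma coe_T_smul (τ : ℍ) : ((ModularGroup.T • τ : ℍ) : ℂ) = τ + 1 := by
  rw [coe_smul_eq, autFactor_T]
  simp [ModularGroup.T]

lemma gaussFactor_S (τ : ℍ) (w : ℂ) :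
    gaussFactor ModularGroup.S τ w = cexp (Real.pi * I * w ^ 2 / τ) := by
  rw [gaussFactor, autFactor_S]
  simp [ModularGroup.S]

lemma gaussFactor_T (τ : ℍ) (w : ℂ) : gaussFactor ModularGroup.T τ w = 1 := by
  rw [gaussFactor, autFactor_T]
  simp [ModularGroup.T]

lemma etaFactor_T (τ : ℍ) : etaFactor ModularGroup.T τ = cexp (Real.pi * I / 12) := by
  rw [etaFactor, div_eq_iff (eta_ne_zero τ), coe_T_smul, eta_eq, eta_eq]
  have : nome ((τ : ℂ) + 1) = nome τ := by
    rw [nome, mul_add, Complex.exp_add, mul_one, Complex.exp_two_pi_mul_I, mul_one, nome]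
  rw [this, ← mul_assoc, ← Complex.exp_add]
  congr 2
  ring

/-- The constant is read off at `i`, which `S` fixes. Merging the two principal roots into one is
legitimate because `0 < arg τ ≤ π` keeps `arg τ - π/2` in the principal range. -/
lemma etaFactor_S (τ : ℍ) : etaFactor ModularGroup.S τ = (-I * τ) ^ (1 / 2 : ℂ) := by
  have hsq : ∀ σ : ℍ, sqrtDenom ModularGroup.S σ = Complex.sqrt (σ : ℂ) := by
    intro σ
    simp [sqrtDenom, ModularGroup.S]
  have hI : ModularGroup.S • UpperHalfPlane.I = UpperHalfPlane.I := by
    apply UpperHalfPlane.ext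
    rw [coe_S_smul]
    simp
  have hsI : Complex.sqrt I ≠ 0 := by simp [Complex.sqrt]
  rw [etaFactor, div_eq_iff (eta_ne_zero τ), eta_smul, hsq, nu, hI, hsq]
  have hη := eta_ne_zero UpperHalfPlane.I
  congr 1
  rw [UpperHalfPlane.coe_I] at hη ⊢
  have hτ := τ.ne_zero
  rw [show ModularForm.eta I / (Complex.sqrt I * ModularForm.eta I) * Complex.sqrt (τ : ℂ) =
    Complex.sqrt (τ : ℂ) / Complex.sqrt I by field_simp, Complex.sqrt, Complex.sqrt,
    Complex.cpow_def_of_ne_zero hτ, Complex.cpow_def_of_ne_zero I_ne_zero,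
    Complex.cpow_def_of_ne_zero (by simpa using hτ), ← Complex.exp_sub,
    (Complex.log_mul_eq_add_log_iff (by simp) hτ).mpr, Complex.log_I, Complex.log_neg_I]
  · congr 1
    ring
  · rw [Complex.arg_neg_I]
    have h1 : 0 < Complex.arg τ := by
      have h0 := Complex.arg_nonneg_iff.mpr τ.im_pos.le
      refine lt_of_le_of_ne h0 fun h => ?_
      have := (Complex.arg_eq_zero_iff.mp h.symm).2
      exact τ.im_ne_zero this
    have h2 := Complex.arg_le_pi τ
    have := Real.pi_pos
    constructor <;> linarith

/-- The cube of the eta factor carries the multiplier, so no explicit formula for it is needed: on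
`S` it gives `s³/τ = -I s` with `s² = -Iτ`, on `T` it gives `exp(π I/4)`. -/
theorem theta_smul {z : ℂ} (A : SL(2, ℤ)) (τ : ℍ) (hz : OffLattice z τ) :
    theta (z / autFactor A τ) ((A • τ : ℍ) : ℂ) =
      etaFactor A τ ^ 3 / autFactor A τ * gaussFactor A τ z * theta z τ := by
  refine transformsUnder_of_generators (f := fun u _ τ => theta u τ)
    (Φ := fun A τ u _ => etaFactor A τ ^ 3 / autFactor A τ * gaussFactor A τ u)
    ?_ ?_ ?_ ?_ A τ z z hz hz
  · intro τ u v
    simp [autFactor_one, etaFactor_one, gaussFactor_one]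
  · intro A B τ u v
    rw [autFactor_mul, etaFactor_mul, gaussFactor_mul]
    field_simp
  · intro τ u v _ _
    have hτ := τ.ne_zero
    have h := sqrt_neg_I_mul_sq τ
    simp only [autFactor_S, coe_S_smul, etaFactor_S, gaussFactor_S]
    rw [theta_S u τ.im_pos]
    generalize (-I * (τ : ℂ)) ^ (1 / 2 : ℂ) = s at h ⊢
    congr 2
    field_simp
    linear_combination -s * h
  · intro τ u v _ _
    simp only [autFactor_T, coe_T_smul, etaFactor_T, gaussFactor_T, div_one, theta_T, mul_one]
    rw [← Complex.exp_nat_mul]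
    congr 2
    push_cast
    ring

/-- As for `theta_smul`, with the inverse multiplier: on `S` the factor is `τ²/s³ = -s`, because `s⁴
= -τ²`. -/
theorem muTilde_smul {u v : ℂ} (A : SL(2, ℤ)) (τ : ℍ) (hu : OffLattice u τ) (hv : OffLattice v τ) :
    muTilde (u / autFactor A τ) (v / autFactor A τ) ((A • τ : ℍ) : ℂ) =
      autFactor A τ ^ 2 / etaFactor A τ ^ 3 * (gaussFactor A τ (u - v))⁻¹ * muTilde u v τ := by
  refine transformsUnder_of_generators (f := muTilde)
    (Φ := fun A τ u v => autFactor A τ ^ 2 / etaFactor A τ ^ 3 * (gaussFactor A τ (u - v))⁻¹)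
    ?_ ?_ ?_ ?_ A τ u v hu hv
  · intro τ u v
    simp [autFactor_one, etaFactor_one, gaussFactor_one]
  · intro A B τ u v
    rw [autFactor_mul, etaFactor_mul, gaussFactor_mul, mul_inv, sub_div]
    field_simp
  · intro τ u v hu hv
    have hτ := τ.ne_zero
    have h := sqrt_neg_I_mul_sq τ
    have h0 := etaFactor_ne_zero ModularGroup.S τ
    rw [etaFactor_S] at h0
    simp only [autFactor_S, coe_S_smul, etaFactor_S, gaussFactor_S]
    rw [muTilde_S τ.im_pos hu (theta_ne_zero τ.im_pos hv), Complex.exp_neg]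
    generalize (-I * (τ : ℂ)) ^ (1 / 2 : ℂ) = s at h h0 ⊢
    congr 2
    field_simp
    have h4 : s ^ 4 = -(τ : ℂ) ^ 2 := by
      linear_combination (s ^ 2 - I * τ) * h + (τ : ℂ) ^ 2 * I_sq
    rw [h4, neg_neg]
  · intro τ u v hu hv
    simp only [autFactor_T, coe_T_smul, etaFactor_T, gaussFactor_T, div_one, muTilde_T, one_pow,
      inv_one, mul_one]
    rw [← Complex.exp_nat_mul, one_div, ← Complex.exp_neg]
    congr 2
    push_cast
    ring


/-! ### Translation by lattice points -/

lemma zpow_neg_one_mul_of_add_one {f : ℂ → ℂ} (hf : ∀ z, f (z + 1) = -f z) (z : ℂ) (n : ℤ) :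
    f (z + n) = (-1) ^ n * f z := by
  induction n using Int.induction_on with
  | zero => simp
  | succ n ih =>
    rw [zpow_add_one₀ (by norm_num), show z + ((n + 1 : ℤ) : ℂ) = z + (n : ℤ) + 1 by push_cast; ring,
      hf, ih]
    ring
  | pred n ih =>
    have h := hf (z + ((-n - 1 : ℤ) : ℂ))
    rw [show z + ((-n - 1 : ℤ) : ℂ) + 1 = z + ((-n : ℤ) : ℂ) by push_cast; ring, ih] at h
    rw [zpow_sub_one₀ (by norm_num)]
    linear_combination h

/-- Iteration of a quasi-periodicity. -/
lemma add_int_mul_of_quasiPeriodic {f : ℂ → ℂ} {τ ε c : ℂ} {p : ℂ → Prop}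
    (hp : ∀ z, p (z + τ) ↔ p z)
    (hf : ∀ z, p z →
      f (z + τ) = -cexp (ε * (Real.pi * I * τ + 2 * Real.pi * I * (z + c))) * f z)
    {z : ℂ} (hz : p z) (k : ℤ) : p (z + k * τ) ∧
    f (z + k * τ) = (-1) ^ k *
      cexp (ε * (Real.pi * I * k ^ 2 * τ + 2 * Real.pi * I * k * (z + c))) * f z := by
  induction k using Int.induction_on with
  | zero => simp [hz]
  | succ n ih =>
    obtain ⟨h1, h2⟩ := ih
    rw [show z + ((n + 1 : ℤ) : ℂ) * τ = z + (n : ℤ) * τ + τ by push_cast; ring]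
    refine ⟨(hp _).mpr h1, ?_⟩
    rw [hf _ h1, h2, zpow_add_one₀ (by norm_num)]
    rw [show ε * (Real.pi * I * ((n + 1 : ℤ) : ℂ) ^ 2 * τ +
        2 * Real.pi * I * ((n + 1 : ℤ) : ℂ) * (z + c)) =
      ε * (Real.pi * I * τ + 2 * Real.pi * I * (z + (n : ℤ) * τ + c)) +
      ε * (Real.pi * I * (n : ℤ) ^ 2 * τ + 2 * Real.pi * I * (n : ℤ) * (z + c)) by
        push_cast; ring, Complex.exp_add]
    ring
  | pred n ih =>
    obtain ⟨h1, h2⟩ := ih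
    have e : z + ((-n - 1 : ℤ) : ℂ) * τ + τ = z + ((-n : ℤ) : ℂ) * τ := by push_cast; ring
    have h3 : p (z + ((-n - 1 : ℤ) : ℂ) * τ) := (hp _).mp (by rwa [e])
    refine ⟨h3, ?_⟩
    have h4 := hf _ h3
    rw [e, h2] at h4
    have h5 := Complex.exp_ne_zero
      (ε * (Real.pi * I * τ + 2 * Real.pi * I * (z + ((-n - 1 : ℤ) : ℂ) * τ + c)))
    rw [show ε * (Real.pi * I * ((-n : ℤ) : ℂ) ^ 2 * τ +
        2 * Real.pi * I * ((-n : ℤ) : ℂ) * (z + c)) =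
      ε * (Real.pi * I * τ + 2 * Real.pi * I * (z + ((-n - 1 : ℤ) : ℂ) * τ + c)) +
      ε * (Real.pi * I * ((-n - 1 : ℤ) : ℂ) ^ 2 * τ +
        2 * Real.pi * I * ((-n - 1 : ℤ) : ℂ) * (z + c)) by push_cast; ring, Complex.exp_add] at h4
    rw [zpow_sub_one₀ (by norm_num)]
    apply mul_left_cancel₀ h5
    linear_combination h4

lemma theta_add_lattice (z τ : ℂ) (k l : ℤ) :
    theta (z + k * τ + l) τ = (-1) ^ (k + l) *
      cexp (-(Real.pi * I * k ^ 2 * τ + 2 * Real.pi * I * k * z)) * theta z τ := by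
  have h := (add_int_mul_of_quasiPeriodic (f := fun z => theta z τ) (τ := τ) (ε := -1) (c := 0)
    (p := fun _ => True) (by simp) (fun z _ => by
      rw [theta_add_tau, neg_one_mul, add_zero]) (z := z) trivial k).2
  simp only [add_zero, neg_one_mul] at h
  rw [zpow_neg_one_mul_of_add_one (f := fun z => theta z τ) (fun z => theta_add_one z τ), h,
    zpow_add₀ (by norm_num)]
  ring

lemma muTilde_add_lattice {u v τ : ℂ} (hτ : 0 < τ.im) (hu : OffLattice u τ) (hv : OffLattice v τ)
    (k l m n : ℤ) :
    muTilde (u + k * τ + l) (v + m * τ + n) τ = (-1) ^ (k + l + m + n) *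
      cexp (Real.pi * I * (k - m) ^ 2 * τ + 2 * Real.pi * I * (k - m) * (u - v)) *
      muTilde u v τ := by
  rw [zpow_neg_one_mul_of_add_one (f := fun u => muTilde u _ τ) (fun z => muTilde_add_one_left z _ τ),
    zpow_neg_one_mul_of_add_one (f := fun v => muTilde _ v τ) (fun z => muTilde_add_one_right _ z τ)]
  have h1 := add_int_mul_of_quasiPeriodic (f := fun u => muTilde u v τ) (τ := τ) (ε := 1) (c := -v)
    (p := fun u => OffLattice u τ) (fun z => offLattice_add_tau) (fun z hz => by
      rw [muTilde_add_tau_left hτ hz (theta_ne_zero hτ hv), one_mul, sub_eq_add_neg]) hu k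
  have h2 := (add_int_mul_of_quasiPeriodic (f := fun v => muTilde (u + k * τ) v τ) (τ := τ) (ε := 1)
    (c := -(u + k * τ)) (p := fun u => OffLattice u τ) (fun z => offLattice_add_tau) (fun z hz => by
      rw [muTilde_add_tau_right hτ h1.1 (theta_ne_zero hτ hz), one_mul, sub_eq_add_neg]) hv m).2
  simp only [one_mul] at h1 h2
  have e : cexp (Real.pi * I * (k - m) ^ 2 * τ + 2 * Real.pi * I * (k - m) * (u - v)) =
      cexp (Real.pi * I * m ^ 2 * τ + 2 * Real.pi * I * m * (v + -(u + k * τ))) *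
        cexp (Real.pi * I * k ^ 2 * τ + 2 * Real.pi * I * k * (u + -v)) := by
    rw [← Complex.exp_add]
    congr 1
    ring
  rw [h2, h1.2, e, zpow_add₀ (by norm_num), zpow_add₀ (by norm_num), zpow_add₀ (by norm_num)]
  ring

/-! ### The transformations of `N(a, c; τ)` and `P(a, c; τ)` -/

/-- The point `2 τ` of the upper half-plane. -/
def twice (τ : ℍ) : ℍ := ⟨2 * τ, by simpa using τ.im_pos⟩

lemma coe_twice (τ : ℍ) : ((twice τ : ℍ) : ℂ) = 2 * τ := rfl

lemma exp_pi_mul_I_two_mul_int (n : ℤ) : cexp (Real.pi * I * (2 * n)) = 1 := by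
  rw [show Real.pi * I * (2 * (n : ℂ)) = 2 * Real.pi * I * n by ring, exp_two_pi_mul_I_int]

lemma offLattice_half_period (τ : ℍ) : OffLattice τ (twice τ) := by
  rw [offLattice_iff]
  intro m n h
  rw [coe_twice] at h
  have h1 := congrArg Complex.im h
  simp only [Complex.add_im, Complex.mul_im, Complex.intCast_re, Complex.intCast_im, Complex.re_ofNat,
    Complex.im_ofNat, zero_mul, add_zero, UpperHalfPlane.coe_im] at h1
  have h2 : τ.im * (1 - 2 * m) = 0 := by linear_combination h1
  have h3 : (1 - 2 * m : ℝ) = 0 := (mul_eq_zero.mp h2).resolve_left τ.im_pos.ne'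
  have : 1 - 2 * m = 0 := by exact_mod_cast h3
  omega

lemma offLattice_two_mul_div {a : ℤ} {c : ℕ} (hc : 0 < c) (hac : ¬ (c : ℤ) ∣ 2 * a) (τ : ℍ) :
    OffLattice (2 * (a : ℂ) / (c : ℂ)) τ := by
  rw [offLattice_iff]
  intro m n h
  have hc0 : (c : ℂ) ≠ 0 := by exact_mod_cast hc.ne'
  have h1 := congrArg Complex.im h
  have e : (2 * (a : ℂ) / (c : ℂ)) = ((2 * (a : ℝ) / (c : ℝ) : ℝ) : ℂ) := by push_cast; rfl
  rw [e, Complex.ofReal_im] at h1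
  simp only [Complex.add_im, Complex.mul_im, Complex.intCast_re, Complex.intCast_im,
    zero_mul, add_zero, UpperHalfPlane.coe_im] at h1
  have h2 : (m : ℝ) = 0 := (mul_eq_zero.mp h1.symm).resolve_right τ.im_pos.ne'
  have h3 : m = 0 := by exact_mod_cast h2
  rw [h3, Int.cast_zero, zero_mul, zero_add, div_eq_iff hc0] at h
  apply hac
  refine ⟨n, ?_⟩
  have : 2 * a = n * (c : ℤ) := by exact_mod_cast h
  rw [this, mul_comm]

lemma sqrtDenom_sq (A : SL(2, ℤ)) (τ : ℍ) : sqrtDenom A τ ^ 2 = autFactor A τ := by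
  simp [sqrtDenom, autFactor, Complex.sqrt]

lemma sqrtDenom_ne_zero (A : SL(2, ℤ)) (τ : ℍ) : sqrtDenom A τ ≠ 0 := by
  intro h
  apply autFactor_ne_zero A τ
  rw [← sqrtDenom_sq, h, zero_pow two_ne_zero]

lemma etaFactor_eq (A : SL(2, ℤ)) (τ : ℍ) : etaFactor A τ = nu A * sqrtDenom A τ := by
  rw [etaFactor, eta_smul, mul_div_cancel_right₀ _ (eta_ne_zero τ)]

lemma nu_ne_zero (A : SL(2, ℤ)) : nu A ≠ 0 := by
  intro h
  apply etaFactor_ne_zero A UpperHalfPlane.I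
  rw [etaFactor_eq, h, zero_mul]

lemma two_dvd_of_mem {A : SL(2, ℤ)} (h : A ∈ Gamma0 2) : (2 : ℤ) ∣ A 1 0 :=
  (ZMod.intCast_zmod_eq_zero_iff_dvd _ 2).mp (Gamma0_mem.mp h)

lemma upTwo_zero_zero (A : SL(2, ℤ)) (h : A ∈ Gamma0 2) : (upTwo A h) 0 0 = A 0 0 := rfl

lemma upTwo_zero_one (A : SL(2, ℤ)) (h : A ∈ Gamma0 2) : (upTwo A h) 0 1 = 2 * A 0 1 := rfl

lemma upTwo_one_one (A : SL(2, ℤ)) (h : A ∈ Gamma0 2) : (upTwo A h) 1 1 = A 1 1 := rfl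

lemma upTwo_one_zero (A : SL(2, ℤ)) (h : A ∈ Gamma0 2) :
    (((upTwo A h) 1 0 : ℤ) : ℂ) = (A 1 0 : ℂ) / 2 := by
  have h2 : 2 * (upTwo A h) 1 0 = A 1 0 := Int.mul_ediv_cancel' (two_dvd_of_mem h)
  rw [← h2]
  push_cast
  ring

lemma autFactor_upTwo (A : SL(2, ℤ)) (h : A ∈ Gamma0 2) (τ : ℍ) :
    autFactor (upTwo A h) (twice τ) = autFactor A τ := by
  rw [autFactor, autFactor, coe_twice, upTwo_one_zero, upTwo_one_one]
  ring

lemma sqrtDenom_upTwo (A : SL(2, ℤ)) (h : A ∈ Gamma0 2) (τ : ℍ) :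
    sqrtDenom (upTwo A h) (twice τ) = sqrtDenom A τ :=
  congrArg Complex.sqrt (autFactor_upTwo A h τ)

lemma upTwo_smul_twice (A : SL(2, ℤ)) (h : A ∈ Gamma0 2) (τ : ℍ) :
    ((upTwo A h • twice τ : ℍ) : ℂ) = 2 * ((A • τ : ℍ) : ℂ) := by
  rw [coe_smul_eq, coe_smul_eq, autFactor_upTwo, upTwo_zero_zero, upTwo_zero_one, coe_twice]
  push_cast
  ring

lemma gaussFactor_upTwo (A : SL(2, ℤ)) (h : A ∈ Gamma0 2) (τ : ℍ) (w : ℂ) :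
    gaussFactor (upTwo A h) (twice τ) w =
      cexp (Real.pi * I * (A 1 0 / 2 * w ^ 2 / autFactor A τ)) := by
  rw [gaussFactor, autFactor_upTwo, upTwo_one_zero]
  congr 1
  ring

lemma exists_eq_two_mul_add_one {A : SL(2, ℤ)} (h : A ∈ Gamma0 2) :
    A 0 0 = 2 * ((A 0 0 - 1) / 2) + 1 := by
  obtain ⟨k, hk⟩ := two_dvd_of_mem h
  have hd := A.det_coe
  rw [Matrix.det_fin_two, hk] at hd
  have h1 : Odd (A 0 0 * A 1 1) := ⟨A 0 1 * k, by linear_combination hd⟩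
  obtain ⟨m, hm⟩ := (Int.odd_mul.mp h1).1
  omega

lemma I_zpow_eq (n : ℤ) : I ^ n = cexp (Real.pi * I * (n / 2)) := by
  rw [show Real.pi * I * ((n : ℂ) / 2) = n * (Real.pi * I * (1 / 2)) by ring,
    Complex.exp_int_mul, exp_pi_mul_I_half]

/-- The image of `τ` under `A`, scaled, in terms of the half period `τ` of `2 τ`. -/
lemma smul_eq_half_period (A : SL(2, ℤ)) (h : A ∈ Gamma0 2) (τ : ℍ) :
    ((A • τ : ℍ) : ℂ) = ((τ : ℂ) + ((A 0 0 - 1) / 2 : ℤ) * (twice τ : ℂ) + A 0 1) /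
      autFactor (upTwo A h) (twice τ) := by
  have e : (A 0 0 : ℂ) = 2 * ((A 0 0 - 1) / 2 : ℤ) + 1 := by
    exact_mod_cast exists_eq_two_mul_add_one h
  rw [coe_smul_eq, autFactor_upTwo, coe_twice, e]
  ring

/-- The quadratic identity behind the cancellation of the exponential factors. -/
lemma half_smul_add (A : SL(2, ℤ)) (τ : ℍ) :
    ((A • τ : ℍ) : ℂ) / 2 + A 1 0 / 2 * (A 0 0 * τ + A 0 1) ^ 2 / autFactor A τ =
      A 0 0 * (A 0 0 * τ + A 0 1) / 2 := by
  have h := autFactor_ne_zero A τ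
  rw [coe_smul_eq]
  field_simp
  rw [autFactor]
  linear_combination (-(A 0 0 * (τ : ℂ) + A 0 1)) * det_cast A

lemma coe_twice_smul (A : SL(2, ℤ)) (h : A ∈ Gamma0 2) (τ : ℍ) :
    ((twice (A • τ) : ℍ) : ℂ) = ((upTwo A h • twice τ : ℍ) : ℂ) :=
  (upTwo_smul_twice A h τ).symm

lemma eta_smul_twice (A : SL(2, ℤ)) (h : A ∈ Gamma0 2) (τ : ℍ) :
    ModularForm.eta (twice (A • τ) : ℂ) =
      nu (upTwo A h) * sqrtDenom A τ * ModularForm.eta (twice τ : ℂ) := by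
  rw [coe_twice_smul A h, eta_smul, sqrtDenom_upTwo]

lemma theta_half_period_twice (τ : ℍ) : theta τ (twice τ) = -I * cexp (-(Real.pi * I * τ / 2)) *
    (ModularForm.eta (τ : ℂ) ^ 2 / ModularForm.eta (twice τ : ℂ)) :=
  theta_half_period τ.im_pos

lemma theta_smul_twice {z : ℂ} (A : SL(2, ℤ)) (h : A ∈ Gamma0 2) (τ : ℍ)
    (hz : OffLattice z (twice τ)) :
    theta (z / autFactor (upTwo A h) (twice τ)) (twice (A • τ)) =
      nu (upTwo A h) ^ 3 * sqrtDenom A τ *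
        cexp (Real.pi * I * (A 1 0 / 2 * z ^ 2 / autFactor A τ)) * theta z (twice τ) := by
  have h1 := sqrtDenom_ne_zero A τ
  have h2 : (nu (upTwo A h) * sqrtDenom A τ) ^ 3 / sqrtDenom A τ ^ 2 =
      nu (upTwo A h) ^ 3 * sqrtDenom A τ := by
    field_simp
  rw [coe_twice_smul A h, theta_smul _ _ hz, gaussFactor_upTwo, etaFactor_eq, sqrtDenom_upTwo,
    autFactor_upTwo, ← sqrtDenom_sq, h2, sqrtDenom_sq]

lemma neg_one_zpow_mul_self (n : ℤ) : (-1 : ℂ) ^ n * (-1) ^ n = 1 := by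
  rw [← mul_zpow]
  norm_num

/-- Under `²A`, the value of `ϑ(·; 2τ)` at a translate of its half period `τ` goes to the
corresponding value at `Aτ`. Both are eta quotients by `theta_half_period`, and comparison yields
`ν(A)² = ν(²A)⁴ (-1)^(m+β) i^(αβ)` with `m = (α - 1)/2`. -/
lemma multiplier_eq (A : SL(2, ℤ)) (h : A ∈ Gamma0 2) :
    nu (upTwo A h) / nu A ^ 2 = multiplier A h := by
  -- The claim does not involve `τ`, so any point serves for the comparison.
  set τ := UpperHalfPlane.I
  set m := (A 0 0 - 1) / 2 with hm
  have hα : (A 0 0 : ℂ) = 2 * m + 1 := by exact_mod_cast exists_eq_two_mul_add_one h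
  have hv := offLattice_half_period τ
  have hv' := hv
  rw [← offLattice_add_int_mul m (A 0 1), ← add_assoc] at hv'
  have e := theta_smul_twice A h τ hv'
  rw [← smul_eq_half_period, theta_half_period_twice, theta_add_lattice, theta_half_period_twice,
    eta_smul, eta_smul_twice A h] at e
  have h1 := sqrtDenom_ne_zero A τ
  have h2 := nu_ne_zero A
  have h3 := nu_ne_zero (upTwo A h)
  have h4 := eta_ne_zero τ
  have h5 := eta_ne_zero (twice τ)
  have hexp : cexp (Real.pi * I * (A 1 0 / 2 * ((τ : ℂ) + m * (twice τ : ℂ) + A 0 1) ^ 2 /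
      autFactor A τ)) * cexp (-(Real.pi * I * m ^ 2 * (twice τ : ℂ) + 2 * Real.pi * I * m * τ)) *
      cexp (-(Real.pi * I * τ / 2)) =
      I ^ (A 0 0 * A 0 1) * cexp (-(Real.pi * I * ((A • τ : ℍ) : ℂ) / 2)) := by
    rw [I_zpow_eq, ← Complex.exp_add, ← Complex.exp_add, ← Complex.exp_add]
    congr 1
    have hs := half_smul_add A τ
    rw [hα] at hs
    rw [coe_twice]
    push_cast
    rw [hα, show (τ : ℂ) + m * (2 * τ) + A 0 1 = (2 * m + 1) * τ + A 0 1 by ring]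
    linear_combination (Real.pi * I) * hs
  have hE := Complex.exp_ne_zero (-(Real.pi * I * ((A • τ : ℍ) : ℂ) / 2))
  have hmain : nu A ^ 2 = nu (upTwo A h) ^ 4 * (-1) ^ (m + A 0 1) * I ^ (A 0 0 * A 0 1) := by
    generalize cexp (-(Real.pi * I * ((A • τ : ℍ) : ℂ) / 2)) = x at e hexp hE
    generalize cexp (-(Real.pi * I * τ / 2)) = y at e hexp
    generalize cexp (-(Real.pi * I * m ^ 2 * (twice τ : ℂ) + 2 * Real.pi * I * m * τ)) = z at e hexp
    generalize cexp (Real.pi * I * (A 1 0 / 2 * ((τ : ℂ) + m * (twice τ : ℂ) + A 0 1) ^ 2 /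
      autFactor A τ)) = w at e hexp
    field_simp at e
    apply mul_left_cancel₀ hE
    linear_combination -e + (nu (upTwo A h) ^ 4 * (-1) ^ (m + A 0 1)) * hexp
  have hI : I ^ (A 0 0 * A 0 1) ≠ 0 := zpow_ne_zero _ I_ne_zero
  have h6 := neg_one_zpow_mul_self (m + A 0 1)
  rw [multiplier, ← hm, hmain, zpow_neg I, zpow_neg, add_comm (A 0 1)]
  have h7 : (-1 : ℂ) ^ (m + A 0 1) ≠ 0 := zpow_ne_zero _ (by norm_num)
  rw [show nu (upTwo A h) ^ (3 : ℤ) = nu (upTwo A h) ^ 3 by norm_cast]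
  field_simp
  linear_combination -h6

lemma P_eq (a : ℤ) (c : ℕ) (τ : ℍ) : P a c τ =
    -I * cexp (-(2 * Real.pi * I * a / c)) * (ModularForm.eta (twice τ : ℂ) ^ 4 /
      (ModularForm.eta (τ : ℂ) ^ 2 * theta (2 * (a : ℂ) / (c : ℂ)) (twice τ))) := by
  have h0 := norm_nome_lt_one τ.im_pos
  have h1 := norm_sq_lt_one h0
  have hq := qPochInf_ne_zero_of_norm_lt h0 h0
  have hq2 := qPochInf_ne_zero_of_norm_lt h1 h1
  have e1 : cexp (2 * Real.pi * I * (2 * (a : ℂ) / (c : ℂ))) = zeta (2 * a) c := by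
    rw [zeta]
    push_cast
    rfl
  have e2 : qPochInf (-nome τ) (nome τ) =
      qPochInf (nome τ ^ 2) (nome τ ^ 2) / qPochInf (nome τ) (nome τ) := by
    rw [eq_div_iff hq, qPochInf_neg_mul_self h0]
  rw [P, theta_eq_jacProd _ (twice τ).im_pos, e1, e2, eta_eq, eta_eq, coe_twice, nome_two_mul]
  have e3 : cexp (Real.pi * I * (2 * τ) / 12) ^ 4 * cexp (-(2 * Real.pi * I * a / c)) =
      cexp (Real.pi * I * τ / 12) ^ 2 *
        cexp (Real.pi * I * (2 * τ) / 4 - Real.pi * I * (2 * (a : ℂ) / (c : ℂ))) := by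
    rw [← Complex.exp_nat_mul, ← Complex.exp_nat_mul, ← Complex.exp_add, ← Complex.exp_add]
    congr 1
    push_cast
    ring
  have n1 := Complex.exp_ne_zero (Real.pi * I * τ / 12)
  have n2 := Complex.exp_ne_zero (Real.pi * I * (2 * τ) / 4 - Real.pi * I * (2 * (a : ℂ) / (c : ℂ)))
  rw [mul_pow, mul_pow]
  -- If the theta product vanishes, both sides are `0` by the convention for division.
  by_cases hj : jacProd (zeta (2 * a) c) (nome τ ^ 2) = 0
  · simp [hj]
  generalize cexp (Real.pi * I * (2 * τ) / 4 - Real.pi * I * (2 * (a : ℂ) / (c : ℂ))) = x at *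
  generalize cexp (Real.pi * I * τ / 12) = y at *
  generalize cexp (Real.pi * I * (2 * τ) / 12) = z at *
  generalize cexp (-(2 * Real.pi * I * a / c)) = w at *
  have hI := I_ne_zero
  field_simp
  linear_combination -e3

/-- The integers describing an element of `Γ₀(c²) ∩ Γ₁(c)`. -/
lemma exists_entries {c : ℕ} {A : SL(2, ℤ)} (hA2 : A ∈ Gamma0 2) (hAc2 : A ∈ Gamma0 (c ^ 2))
    (hAc : A ∈ Gamma1 c) : ∃ g r d e : ℤ, A 1 0 = c ^ 2 * g ∧ A 0 0 = 1 + c * r ∧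
      A 1 1 = 1 + c * d ∧ c * g = 2 * e := by
  obtain ⟨g, hg⟩ := (ZMod.intCast_zmod_eq_zero_iff_dvd _ _).mp (Gamma0_mem.mp hAc2)
  obtain ⟨h1, h2, -⟩ := (Gamma1_mem c A).mp hAc
  have h3 : ((A 0 0 - 1 : ℤ) : ZMod c) = 0 := by push_cast; rw [h1, sub_self]
  have h4 : ((A 1 1 - 1 : ℤ) : ZMod c) = 0 := by push_cast; rw [h2, sub_self]
  obtain ⟨r, hr⟩ := (ZMod.intCast_zmod_eq_zero_iff_dvd _ _).mp h3
  obtain ⟨d, hd⟩ := (ZMod.intCast_zmod_eq_zero_iff_dvd _ _).mp h4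
  push_cast at hg
  -- The entry `γ = c² g` is even, and `c` has the parity of `c²`. The half `e` of `c g` controls
  -- the sign `(-1)^(a c g)`.
  have h5 : Even ((c : ℤ) * g) := by
    have h6 : Even ((c : ℤ) ^ 2 * g) := hg ▸ even_iff_two_dvd.mpr (two_dvd_of_mem hA2)
    rw [Int.even_mul] at h6 ⊢
    rcases h6 with h6 | h6
    · exact Or.inl ((Int.even_pow.mp h6).1)
    · exact Or.inr h6
  obtain ⟨e, he⟩ := even_iff_two_dvd.mp h5
  exact ⟨g, r, d, e, hg, by linarith, by linarith, he⟩

/-- With `Z = 2a/c`, the difference `Z (γτ + δ) - Z` lies in the lattice of `2τ` and `1`. Hence `Z`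
is, up to translation, preserved by the action of `²A`. -/
lemma two_mul_div_eq_div {a : ℤ} {c : ℕ} (hc : 0 < c) {A : SL(2, ℤ)} (hA2 : A ∈ Gamma0 2) {g d : ℤ}
    (hg : A 1 0 = c ^ 2 * g) (hd : A 1 1 = 1 + c * d) (τ : ℍ) :
    2 * (a : ℂ) / (c : ℂ) = (2 * (a : ℂ) / (c : ℂ) + (a * c * g : ℤ) * (twice τ : ℂ) +
      (2 * a * d : ℤ)) / autFactor (upTwo A hA2) (twice τ) := by
  have hc0 : (c : ℂ) ≠ 0 := by exact_mod_cast hc.ne'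
  have h := autFactor_ne_zero A τ
  rw [autFactor_upTwo, eq_div_iff h, coe_twice, autFactor, hg, hd]
  push_cast
  field_simp
  ring

/-- `muTilde_smul` for `²A` at the translated points, with the translations removed by
`muTilde_add_lattice`. All content is then in the exponential identity `hexp`; there `c² ∣ γ` makes
`γ Z²/2 = 2a²g` an integer. -/
theorem N_smul {a : ℤ} {c : ℕ} (hc : 0 < c) (hac : ¬ (c : ℤ) ∣ 2 * a) {A : SL(2, ℤ)}
    (hA2 : A ∈ Gamma0 2) (hAc2 : A ∈ Gamma0 (c ^ 2)) (hAc : A ∈ Gamma1 c) (τ : ℍ) :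
    N a c (A • τ) = multiplier A hA2 * sqrtDenom A τ * N a c τ := by
  obtain ⟨g, r, d, e, hg, hr, hd, he⟩ := exists_entries hA2 hAc2 hAc
  have hc0 : (c : ℂ) ≠ 0 := by exact_mod_cast hc.ne'
  have hu := offLattice_two_mul_div hc hac (twice τ)
  have hv := offLattice_half_period τ
  have hu' := hu
  rw [← offLattice_add_int_mul (a * c * g) (2 * a * d), ← add_assoc] at hu'
  have hv' := hv
  rw [← offLattice_add_int_mul ((A 0 0 - 1) / 2) (A 0 1), ← add_assoc] at hv'
  have h := muTilde_smul (upTwo A hA2) (twice τ) hu' hv'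
  rw [← two_mul_div_eq_div hc hA2 hg hd, ← smul_eq_half_period, upTwo_smul_twice,
    muTilde_add_lattice (twice τ).im_pos hu hv, autFactor_upTwo, etaFactor_eq, sqrtDenom_upTwo,
    gaussFactor_upTwo, ← Complex.exp_neg] at h
  set m := (A 0 0 - 1) / 2 with hm
  have hα : (A 0 0 : ℂ) = 2 * m + 1 := by exact_mod_cast exists_eq_two_mul_add_one hA2
  set Z := 2 * (a : ℂ) / (c : ℂ) with hZ
  have ha : (a : ℂ) = c * Z / 2 := by rw [hZ]; field_simp
  have he' : (e : ℂ) = c * g / 2 := by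
    have : (c : ℂ) * g = 2 * e := by exact_mod_cast he
    rw [this]; ring
  have hr' : (A 0 0 : ℂ) = 1 + c * r := by exact_mod_cast hr
  have hd' : (A 1 1 : ℂ) = 1 + c * d := by exact_mod_cast hd
  have hg' : (A 1 0 : ℂ) = c ^ 2 * g := by exact_mod_cast hg
  have hm' : (m : ℂ) = c * r / 2 := by linear_combination (hr' - hα) / 2
  have hexp : cexp (-(2 * Real.pi * I * ((A • τ : ℍ) : ℂ)) / 4) *
      cexp (-(Real.pi * I * (A 1 0 / 2 * (Z + (a * c * g : ℤ) * (twice τ : ℂ) + (2 * a * d : ℤ) -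
        ((τ : ℂ) + m * (twice τ : ℂ) + A 0 1)) ^ 2 / autFactor A τ))) *
      ((-1) ^ (a * c * g + 2 * a * d + m + A 0 1) *
        cexp (Real.pi * I * ((a * c * g : ℤ) - m) ^ 2 * (twice τ : ℂ) +
          2 * Real.pi * I * ((a * c * g : ℤ) - m) * (Z - τ))) =
      (-1) ^ (A 0 1 + m) * I ^ (-(A 0 0 * A 0 1)) * cexp (-(2 * Real.pi * I * τ) / 4) := by
    -- The integer inserted here collects the surplus phases depending on `a`; it makes the
    -- exponents on both sides equal after substituting `e = c g / 2` and `m = c r / 2`.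
    rw [I_zpow_eq, ← exp_pi_mul_I_int, ← exp_pi_mul_I_int,
      ← mul_one (_ * cexp (-(2 * Real.pi * I * τ) / 4)),
      ← exp_pi_mul_I_two_mul_int (a * e + a * d - a ^ 2 * g * (1 + c * d) + 2 * a ^ 2 * g +
        a * A 0 1 * c * g - a * r)]
    simp only [← Complex.exp_add]
    congr 1
    have hs := half_smul_add A τ
    have hj := autFactor_ne_zero A τ
    -- The translated difference of arguments is `Z j - (ατ + β)` with `j = γτ + δ`. After expansion
    -- only `(ατ + β)²/j` is not polynomial, and `half_smul_add` disposes of it.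
    have hQ : (A 1 0 / 2 * (Z + (a * c * g : ℤ) * (twice τ : ℂ) + (2 * a * d : ℤ) -
        ((τ : ℂ) + m * (twice τ : ℂ) + A 0 1)) ^ 2 / autFactor A τ) =
        A 1 0 / 2 * (Z ^ 2 * autFactor A τ - 2 * Z * (A 0 0 * τ + A 0 1)) +
        A 1 0 / 2 * (A 0 0 * τ + A 0 1) ^ 2 / autFactor A τ := by
      rw [show Z + (a * c * g : ℤ) * (twice τ : ℂ) + (2 * a * d : ℤ) -
        ((τ : ℂ) + m * (twice τ : ℂ) + A 0 1) = Z * autFactor A τ - (A 0 0 * τ + A 0 1) by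
          rw [autFactor, coe_twice, hα, hg', hd']
          push_cast
          rw [ha]
          ring]
      field_simp
      ring
    rw [hQ, autFactor, coe_twice]
    rw [autFactor] at hs
    push_cast
    rw [ha, he', hm', hr', hg', hd']
    rw [hr', hg', hd'] at hs
    linear_combination (-(Real.pi * I)) * hs
  have h1 := sqrtDenom_ne_zero A τ
  have h3 := nu_ne_zero (upTwo A hA2)
  rw [N, N, h, ← coe_twice τ, multiplier, ← hm, zpow_neg,
    show nu (upTwo A hA2) ^ (3 : ℤ) = nu (upTwo A hA2) ^ 3 by norm_cast]
  have h4 : autFactor A τ ^ 2 / (nu (upTwo A hA2) * sqrtDenom A τ) ^ 3 =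
      (nu (upTwo A hA2) ^ 3)⁻¹ * sqrtDenom A τ := by
    rw [← sqrtDenom_sq]
    field_simp
  rw [h4]
  linear_combination ((nu (upTwo A hA2) ^ 3)⁻¹ * sqrtDenom A τ *
    muTilde Z τ (twice τ)) * hexp

/-- By `P_eq` only the theta value at `2a/c` goes beyond eta functions, and the congruences on `A`
cancel its Gaussian factor against its translation factor. -/
theorem P_smul {a : ℤ} {c : ℕ} (hc : 0 < c) (hac : ¬ (c : ℤ) ∣ 2 * a) {A : SL(2, ℤ)}
    (hA2 : A ∈ Gamma0 2) (hAc2 : A ∈ Gamma0 (c ^ 2)) (hAc : A ∈ Gamma1 c) (τ : ℍ) :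
    P a c (A • τ) = nu (upTwo A hA2) / nu A ^ 2 * sqrtDenom A τ * P a c τ := by
  obtain ⟨g, r, d, e, hg, hr, hd, he⟩ := exists_entries hA2 hAc2 hAc
  have hc0 : (c : ℂ) ≠ 0 := by exact_mod_cast hc.ne'
  have hu := offLattice_two_mul_div hc hac (twice τ)
  have hu' := hu
  rw [← offLattice_add_int_mul (a * c * g) (2 * a * d), ← add_assoc] at hu'
  have h := theta_smul_twice A hA2 τ hu'
  rw [← two_mul_div_eq_div hc hA2 hg hd, theta_add_lattice] at h
  set Z := 2 * (a : ℂ) / (c : ℂ) with hZ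
  have ha : (a : ℂ) = c * Z / 2 := by rw [hZ]; field_simp
  have he' : (e : ℂ) = c * g / 2 := by
    have : (c : ℂ) * g = 2 * e := by exact_mod_cast he
    rw [this]; ring
  have hd' : (A 1 1 : ℂ) = 1 + c * d := by exact_mod_cast hd
  have hg' : (A 1 0 : ℂ) = c ^ 2 * g := by exact_mod_cast hg
  have hexp : cexp (Real.pi * I * (A 1 0 / 2 * (Z + (a * c * g : ℤ) * (twice τ : ℂ) +
      (2 * a * d : ℤ)) ^ 2 / autFactor A τ)) * ((-1) ^ (a * c * g + 2 * a * d) *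
      cexp (-(Real.pi * I * (a * c * g : ℤ) ^ 2 * (twice τ : ℂ) +
        2 * Real.pi * I * (a * c * g : ℤ) * Z))) = 1 := by
    rw [← exp_pi_mul_I_int,
      ← exp_pi_mul_I_two_mul_int (a * e + a * d + a ^ 2 * g * (1 + c * d) - 2 * a ^ 2 * g)]
    simp only [← Complex.exp_add]
    congr 1
    have hj := autFactor_ne_zero A τ
    have hQ : Z + (a * c * g : ℤ) * (twice τ : ℂ) + (2 * a * d : ℤ) = Z * autFactor A τ := by
      rw [autFactor, coe_twice, hg', hd']
      push_cast
      rw [ha]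
      ring
    rw [hQ, show A 1 0 / 2 * (Z * autFactor A τ) ^ 2 / autFactor A τ =
      A 1 0 / 2 * (Z ^ 2 * autFactor A τ) by field_simp, autFactor, coe_twice]
    push_cast
    rw [ha, he', hg', hd']
    ring
  have h1 := sqrtDenom_ne_zero A τ
  have h2 := nu_ne_zero A
  have h3 := nu_ne_zero (upTwo A hA2)
  have h4 := eta_ne_zero τ
  have h5 := theta_ne_zero (twice τ).im_pos hu
  have h6 : theta Z (twice (A • τ)) =
      nu (upTwo A hA2) ^ 3 * sqrtDenom A τ * theta Z (twice τ) := by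
    rw [h]
    linear_combination (nu (upTwo A hA2) ^ 3 * sqrtDenom A τ * theta Z (twice τ)) * hexp
  rw [P_eq, P_eq, ← hZ, h6, eta_smul, eta_smul_twice A hA2]
  field_simp

/-! ### The period integral -/

/-- An explicit antiderivative for the terms of the period integral; it produces the error functions
of `R`. -/
lemma hasDerivAt_errE_mul_sqrt {κ s t : ℝ} (h : 0 < s + t) :
    HasDerivAt (fun t => errE (κ * Real.sqrt (s + t)))
      (κ * Real.exp (-(Real.pi * κ ^ 2 * (s + t))) / Real.sqrt (s + t)) t := by
  have h1 : HasDerivAt (fun t => κ * Real.sqrt (s + t)) (κ * (1 / (2 * Real.sqrt (s + t)))) t :=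
    (((hasDerivAt_id t).const_add s).sqrt h.ne').const_mul κ
  have h2 := (hasDerivAt_errE (κ * Real.sqrt (s + t))).comp t h1
  refine h2.congr_deriv ?_
  rw [mul_pow, Real.sq_sqrt h.le, show -Real.pi * (κ ^ 2 * (s + t)) = -(Real.pi * κ ^ 2 * (s + t)) by ring]
  have : Real.sqrt (s + t) ≠ 0 := (Real.sqrt_pos.mpr h).ne'
  field_simp

lemma tendsto_errE_mul_sqrt {κ : ℝ} (hκ : 0 < κ) (s : ℝ) :
    Tendsto (fun t => errE (κ * Real.sqrt (s + t))) atTop (𝓝 1) := by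
  refine tendsto_errE.comp (Tendsto.const_mul_atTop hκ ?_)
  exact Real.tendsto_sqrt_atTop.comp (tendsto_atTop_add_const_left _ _ tendsto_id)

lemma gauss_div_sqrt_nonneg {κ s t : ℝ} (hκ : 0 < κ) :
    0 ≤ κ * Real.exp (-(Real.pi * κ ^ 2 * (s + t))) / Real.sqrt (s + t) := by positivity

lemma integrableOn_gauss_div_sqrt {κ s : ℝ} (hκ : 0 < κ) (hs : 0 < s) : IntegrableOn
    (fun t => κ * Real.exp (-(Real.pi * κ ^ 2 * (s + t))) / Real.sqrt (s + t)) (Set.Ioi 0) :=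
  integrableOn_Ioi_deriv_of_nonneg' (fun t ht => hasDerivAt_errE_mul_sqrt (by
    have : (0 : ℝ) ≤ t := ht
    linarith)) (fun _ _ => gauss_div_sqrt_nonneg hκ) (tendsto_errE_mul_sqrt hκ s)

lemma integral_gauss_div_sqrt {κ s : ℝ} (hκ : 0 < κ) (hs : 0 < s) :
    ∫ t in Set.Ioi 0, κ * Real.exp (-(Real.pi * κ ^ 2 * (s + t))) / Real.sqrt (s + t) =
      1 - errE (κ * Real.sqrt s) := by
  rw [integral_Ioi_of_hasDerivAt_of_nonneg' (fun t ht => hasDerivAt_errE_mul_sqrt (by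
    have : (0 : ℝ) ≤ t := ht
    linarith)) (fun _ _ => gauss_div_sqrt_nonneg hκ) (tendsto_errE_mul_sqrt hκ s), add_zero]

/-- The phase `(-1) ^ k ζ ^ (-2 k) q ^ (-k ^ 2)` with `ζ ^ 2 = exp(2 π i w)`. -/
def periodPhase (w τ : ℂ) (k : ℤ) : ℂ :=
  (-1) ^ k * cexp (-(2 * Real.pi * I * k * w) - 2 * Real.pi * I * k ^ 2 * τ)

lemma norm_periodPhase (w : ℝ) (τ : ℂ) (k : ℤ) :
    ‖periodPhase w τ k‖ = Real.exp (2 * Real.pi * k ^ 2 * τ.im) := by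
  rw [periodPhase, norm_mul, norm_zpow, norm_neg, norm_one, one_zpow, one_mul, Complex.norm_exp]
  congr 1
  have : -(2 * Real.pi * I * k * w) - 2 * Real.pi * I * k ^ 2 * τ =
      ((2 * Real.pi * k ^ 2 : ℝ) : ℂ) * -(τ * I) - ((2 * Real.pi * k * w : ℝ) : ℂ) * I := by
    push_cast
    ring
  rw [this, sub_re, re_ofReal_mul, neg_re, mul_I_re, re_ofReal_mul, Complex.I_re]
  ring

/-- The general term of the integrand of the period integral. -/
def periodTerm (w : ℝ) (τ : ℂ) (k : ℤ) (t : ℝ) : ℂ :=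
  I * periodPhase w τ k * ((k * Real.exp (-(2 * Real.pi * k ^ 2 * (2 * τ.im + t))) /
    Real.sqrt (2 * τ.im + t) : ℝ) : ℂ)

lemma periodTerm_eq {k : ℤ} (hk : k ≠ 0) (w : ℝ) (τ : ℂ) (t : ℝ) : periodTerm w τ k t =
    I * periodPhase w τ k * ((Real.sign k / Real.sqrt 2 : ℝ) : ℂ) *
      ((Real.sqrt 2 * |(k : ℝ)| * Real.exp (-(Real.pi * (Real.sqrt 2 * |(k : ℝ)|) ^ 2 *
        (2 * τ.im + t))) / Real.sqrt (2 * τ.im + t) : ℝ) : ℂ) := by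
  have h2 : Real.sqrt 2 ≠ 0 := by positivity
  have hs : (k : ℝ) = Real.sign k * |(k : ℝ)| := by
    rcases lt_or_gt_of_ne (Int.cast_ne_zero.mpr hk : (k : ℝ) ≠ 0) with h | h
    · rw [Real.sign_of_neg h, abs_of_neg h]; ring
    · rw [Real.sign_of_pos h, abs_of_pos h]; ring
  rw [periodTerm, mul_assoc _ (((_ : ℝ) : ℂ)), ← ofReal_mul, mul_pow, sq_abs, Real.sq_sqrt zero_le_two]
  congr 2
  rw [show Real.pi * (2 * (k : ℝ) ^ 2) = 2 * Real.pi * k ^ 2 by ring]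
  nth_rw 1 [hs]
  field_simp

lemma integrableOn_periodTerm {τ : ℂ} (hτ : 0 < τ.im) (w : ℝ) (k : ℤ) :
    IntegrableOn (periodTerm w τ k) (Set.Ioi 0) := by
  by_cases hk : k = 0
  · subst hk
    have : periodTerm w τ 0 = fun _ => 0 := by
      funext t
      simp [periodTerm]
    rw [this]
    exact integrableOn_zero
  · have hk' : 0 < Real.sqrt 2 * |(k : ℝ)| := by
      have : (k : ℝ) ≠ 0 := Int.cast_ne_zero.mpr hk
      positivity
    have h := (integrableOn_gauss_div_sqrt hk' (by positivity : 0 < 2 * τ.im)).ofReal (𝕜 := ℂ)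
    have e : periodTerm w τ k = _ := funext (periodTerm_eq hk w τ)
    rw [e]
    exact h.const_mul _

lemma sqrt_two_mul_mul_sqrt (k y : ℝ) :
    Real.sqrt 2 * k * Real.sqrt (2 * y) = k * Real.sqrt (2 * (2 * y)) := by
  rw [Real.sqrt_mul zero_le_two (2 * y)]
  ring

lemma integral_periodTerm {τ : ℂ} (hτ : 0 < τ.im) (w : ℝ) (k : ℤ) :
    ∫ t in Set.Ioi 0, periodTerm w τ k t = I / Real.sqrt 2 * (((Real.sign k -
      errE (k * Real.sqrt (2 * (2 * τ.im))) : ℝ) : ℂ) * periodPhase w τ k) := by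
  by_cases hk : k = 0
  · subst hk
    simp [periodTerm, errE]
  · have hk0 : (k : ℝ) ≠ 0 := Int.cast_ne_zero.mpr hk
    have hk' : 0 < Real.sqrt 2 * |(k : ℝ)| := by positivity
    have h := integral_gauss_div_sqrt hk' (by positivity : 0 < 2 * τ.im)
    simp only [periodTerm_eq hk]
    rw [integral_const_mul, integral_complex_ofReal, h, sqrt_two_mul_mul_sqrt]
    have e : Real.sign k * (1 - errE (|(k : ℝ)| * Real.sqrt (2 * (2 * τ.im)))) =
        Real.sign k - errE (k * Real.sqrt (2 * (2 * τ.im))) := by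
      rcases lt_or_gt_of_ne hk0 with h | h
      · rw [Real.sign_of_neg h, abs_of_neg h, neg_mul (k : ℝ), errE_neg]; ring
      · rw [Real.sign_of_pos h, abs_of_pos h]; ring
    rw [← e]
    push_cast
    ring

/-- Justifies exchanging sum and integral: the phase grows like `exp(2π k² y)`, while the integral
decays like `exp(-4π k² y)`. -/
lemma summable_integral_norm_periodTerm {τ : ℂ} (hτ : 0 < τ.im) (w : ℝ) :
    Summable fun k => ∫ t in Set.Ioi 0, ‖periodTerm w τ k t‖ := by
  have hb := summable_pow_mul_jacobiTheta₂_term_bound 0 (T := 2 * τ.im) (by positivity) 0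
  refine Summable.of_nonneg_of_le (fun k => integral_nonneg fun _ => norm_nonneg _) (fun k => ?_) hb
  rw [pow_zero, one_mul, mul_zero, zero_mul, sub_zero]
  by_cases hk : k = 0
  · subst hk
    simp [periodTerm]
  · have hk0 : (k : ℝ) ≠ 0 := Int.cast_ne_zero.mpr hk
    have hk' : 0 < Real.sqrt 2 * |(k : ℝ)| := by positivity
    have h := integral_gauss_div_sqrt hk' (by positivity : 0 < 2 * τ.im)
    have hsgn : |Real.sign (k : ℝ)| = 1 := by
      rcases Real.sign_apply_eq_of_ne_zero _ hk0 with h | h <;> rw [h] <;> simp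
    have e : ∀ t, ‖periodTerm w τ k t‖ = Real.exp (2 * Real.pi * k ^ 2 * τ.im) / Real.sqrt 2 *
        (Real.sqrt 2 * |(k : ℝ)| * Real.exp (-(Real.pi * (Real.sqrt 2 * |(k : ℝ)|) ^ 2 *
        (2 * τ.im + t))) / Real.sqrt (2 * τ.im + t)) := by
      intro t
      rw [periodTerm_eq hk, norm_mul, norm_mul, norm_mul, norm_I, one_mul, norm_periodPhase,
        norm_real, norm_real, Real.norm_eq_abs, Real.norm_eq_abs, abs_div, hsgn,
        abs_of_pos (by positivity : 0 < Real.sqrt 2), abs_of_nonneg (gauss_div_sqrt_nonneg hk')]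
      ring
    simp only [e]
    rw [integral_const_mul, h]
    have h1 := one_sub_errE_le (x := Real.sqrt 2 * |(k : ℝ)| * Real.sqrt (2 * τ.im)) (by positivity)
    have h2 : 1 ≤ Real.sqrt 2 := Real.one_le_sqrt.mpr one_le_two
    calc _ ≤ Real.exp (2 * Real.pi * k ^ 2 * τ.im) * Real.exp (-Real.pi *
          (Real.sqrt 2 * |(k : ℝ)| * Real.sqrt (2 * τ.im)) ^ 2) := by
          gcongr
          · exact sub_nonneg.mpr (errE_le_one _)
          · exact div_le_self (Real.exp_pos _).le h2
      _ = _ := by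
          rw [← Real.exp_add, mul_pow, mul_pow, sq_abs, Real.sq_sqrt zero_le_two,
            Real.sq_sqrt (by positivity)]
          congr 1
          ring

lemma sqrt_ofReal {x : ℝ} (hx : 0 ≤ x) : Complex.sqrt (x : ℂ) = (Real.sqrt x : ℝ) := by
  rw [Complex.sqrt, Real.sqrt_eq_rpow, Complex.ofReal_cpow hx]
  norm_num

lemma periodIntegrand_eq (a : ℤ) (c : ℕ) (τ : ℍ) {t : ℝ} (ht : 0 < t) :
    unaryTheta 0 (1 / 2 - 2 * (a : ℝ) / (c : ℝ)) (2 * (-(starRingEnd ℂ) (τ : ℂ) + I * t)) /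
      Complex.sqrt (-I * ((-(starRingEnd ℂ) (τ : ℂ) + I * t) + τ)) * I =
      ∑' k : ℤ, periodTerm (2 * (a : ℝ) / (c : ℝ)) τ k t := by
  have hτ := τ.im_pos
  have hconj : (starRingEnd ℂ) (τ : ℂ) = τ - 2 * (τ.im : ℝ) * I := by
    rw [← UpperHalfPlane.coe_im]
    apply Complex.ext <;> simp
    ring
  have e1 : -I * ((-(starRingEnd ℂ) (τ : ℂ) + I * t) + τ) = ((2 * τ.im + t : ℝ) : ℂ) := by
    rw [hconj]
    push_cast
    linear_combination (-(2 * (τ.im : ℂ)) - t) * I_sq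
  rw [e1, sqrt_ofReal (by positivity), unaryTheta, ← tsum_div_const, ← tsum_mul_right]
  refine tsum_congr fun k => ?_
  have e2 : Real.pi * I * ((k : ℂ) + (0 : ℝ)) ^ 2 * (2 * (-(starRingEnd ℂ) (τ : ℂ) + I * t)) +
      2 * Real.pi * I * ((k : ℂ) + (0 : ℝ)) * ((1 / 2 - 2 * (a : ℝ) / (c : ℝ) : ℝ) : ℂ) =
      Real.pi * I * k + (-(2 * Real.pi * I * k * ((2 * (a : ℝ) / (c : ℝ) : ℝ) : ℂ)) -
        2 * Real.pi * I * k ^ 2 * τ) +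
      ((-(2 * Real.pi * k ^ 2 * (2 * τ.im + t)) : ℝ) : ℂ) := by
    rw [hconj]
    push_cast
    linear_combination (2 * Real.pi * (k : ℂ) ^ 2 * (2 * τ.im + t)) * I_sq
  rw [e2, Complex.exp_add, Complex.exp_add, exp_pi_mul_I_int, ← ofReal_exp, periodTerm, periodPhase,
    UpperHalfPlane.coe_im]
  push_cast
  ring

/-- The period integral as a series. -/
lemma hasSum_periodIntegral (a : ℤ) (c : ℕ) (τ : ℍ) : HasSum (fun k : ℤ => I / Real.sqrt 2 *
    (((Real.sign k - errE (k * Real.sqrt (2 * (2 * τ.im))) : ℝ) : ℂ) *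
      periodPhase ((2 * (a : ℝ) / (c : ℝ) : ℝ) : ℂ) τ k)) (periodIntegral a c τ) := by
  have h := hasSum_integral_of_summable_integral_norm
    (integrableOn_periodTerm τ.im_pos (2 * (a : ℝ) / (c : ℝ)))
    (summable_integral_norm_periodTerm τ.im_pos _)
  simp only [integral_periodTerm (τ := (τ : ℂ)) τ.im_pos] at h
  have e : periodIntegral a c τ = ∫ t in Set.Ioi 0, ∑' k, periodTerm (2 * (a : ℝ) / (c : ℝ)) τ k t :=
    setIntegral_congr_fun measurableSet_Ioi fun t ht => periodIntegrand_eq a c τ ht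
  rw [e]
  exact h

/-- For `u = w - τ` and modulus `2τ` the quotient of imaginary parts is `-1/2`, so the argument of
`errE` becomes an integer multiple. The sign of `k + 1/2` differs from that of `k` only at `k = 0`,
where `sign 0 = 0`; this accounts for the `+ 1`. -/
lemma zwegersR_half_period (w : ℝ) (τ : ℍ) {S : ℂ}
    (hS : HasSum (fun k : ℤ => ((Real.sign k - errE (k * Real.sqrt (2 * (2 * τ.im))) : ℝ) : ℂ) *
      periodPhase w τ k) S) :
    zwegersR (w - τ) (2 * τ) = cexp (Real.pi * I * τ / 2 - Real.pi * I * w) * (S + 1) := by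
  have h := (hS.add (hasSum_ite_eq (0 : ℤ) (1 : ℂ))).mul_left
    (cexp (Real.pi * I * τ / 2 - Real.pi * I * w))
  rw [← h.tsum_eq, zwegersR]
  refine tsum_congr fun k => ?_
  have e1 : ((w : ℂ) - τ).im / (2 * (τ : ℂ)).im = -(1 / 2) := by
    have := τ.im_ne_zero
    rw [sub_im, ofReal_im, mul_im]
    simp
    field_simp
  have e2 : (2 * (τ : ℂ)).im = 2 * τ.im := by simp
  have e3 : cexp (-Real.pi * I * ((k : ℂ) + 1 / 2) ^ 2 * (2 * τ) -
      2 * Real.pi * I * ((k : ℂ) + 1 / 2) * (w - τ)) =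
      cexp (Real.pi * I * τ / 2 - Real.pi * I * w) *
        cexp (-(2 * Real.pi * I * k * w) - 2 * Real.pi * I * k ^ 2 * τ) := by
    rw [← Complex.exp_add]
    congr 1
    ring
  rw [e1, e2, e3, add_neg_cancel_right]
  by_cases hk : k = 0
  · subst hk
    have : Real.sign (1 / 2) = 1 := Real.sign_of_pos (by norm_num)
    simp [periodPhase, errE, Real.sign_of_pos]
  · have hsgn : Real.sign ((k : ℝ) + 1 / 2) = Real.sign k := by
      rcases lt_or_gt_of_ne hk with h | h
      · have h1 : (k : ℝ) ≤ -1 := by exact_mod_cast (by omega : k ≤ -1)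
        rw [Real.sign_of_neg (by linarith), Real.sign_of_neg (by linarith)]
      · have h1 : (0 : ℝ) < k := by exact_mod_cast h
        rw [Real.sign_of_pos (by linarith), Real.sign_of_pos h1]
    rw [hsgn, if_neg hk, add_zero, periodPhase]
    ring

/-! ### The decomposition of `ℳ(a, c; τ)` -/

lemma zeta_sq (a : ℤ) (c : ℕ) : zeta a c ^ 2 = cexp (2 * Real.pi * I * (2 * (a : ℂ) / c)) := by
  rw [zeta, ← Complex.exp_nat_mul]
  congr 1
  push_cast
  ring

lemma zeta_two_mul (a : ℤ) (c : ℕ) : zeta (2 * a) c = zeta a c ^ 2 := by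
  rw [zeta_sq, zeta]
  push_cast
  rfl

lemma one_sub_zeta_sq_mul_ne_zero {a : ℤ} {c : ℕ} (hc : 0 < c) (hac : ¬ (c : ℤ) ∣ 2 * a) (τ : ℍ)
    (r : ℤ) : (1 - zeta a c * nome τ ^ r) * (1 + zeta a c * nome τ ^ r) ≠ 0 := by
  have h := offLattice_two_mul_div hc hac (twice τ) r
  rw [coe_twice, nome_two_mul, ← zeta_sq] at h
  convert h using 1
  rw [← zpow_natCast (nome τ) 2, ← zpow_mul, mul_comm _ r, zpow_mul, zpow_natCast]
  ring

lemma mu_half_period (a : ℤ) (c : ℕ) (τ : ℍ) :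
    cexp (-(2 * Real.pi * I * τ) / 4) * mu (2 * (a : ℂ) / c) τ (2 * τ) =
      I * zeta a c * (qPochInf (-nome τ) (nome τ) / qPochInf (nome τ) (nome τ)) *
        ∑' r, tripleTerm (nome τ ^ 2) (nome τ ^ 3) r / (1 - zeta a c ^ 2 * (nome τ ^ 2) ^ r) := by
  have h0 := norm_nome_lt_one τ.im_pos
  have hq := qPochInf_ne_zero_of_norm_lt h0 h0
  have e1 : cexp (Real.pi * I * (2 * (a : ℂ) / c)) = zeta a c := by
    rw [zeta]
    congr 1
    ring
  have e2 : nome τ ^ 2 * nome τ = nome τ ^ 3 := by ring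
  have e3 : cexp (-(2 * Real.pi * I * τ) / 4) = cexp (-(Real.pi * I * τ / 2)) := by
    congr 1
    ring
  have e4 : ModularForm.eta (2 * τ : ℂ) / ModularForm.eta (τ : ℂ) ^ 2 =
      qPochInf (-nome τ) (nome τ) / qPochInf (nome τ) (nome τ) := by
    rw [eta_eq, eta_eq, nome_two_mul, ← qPochInf_neg_mul_self h0, mul_pow, ← Complex.exp_nat_mul,
      show Real.pi * I * (2 * (τ : ℂ)) / 12 = (2 : ℕ) * (Real.pi * I * τ / 12) by push_cast; ring]
    have := Complex.exp_ne_zero ((2 : ℕ) * (Real.pi * I * τ / 12))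
    field_simp
  have h1 : ModularForm.eta (2 * τ : ℂ) ≠ 0 := eta_ne_zero (twice τ)
  have h2 := eta_ne_zero τ
  have h3 := Complex.exp_ne_zero (-(Real.pi * I * τ / 2))
  rw [mu_eq_appell, appell, theta_half_period τ.im_pos, e1, e3, ← e4, ← zeta_sq, nome_two_mul,
    show cexp (2 * Real.pi * I * τ) = nome τ from rfl, e2]
  have hI := I_ne_zero
  field_simp
  rw [I_sq]
  ring

lemma N_eq (a : ℤ) (c : ℕ) (τ : ℍ) : N a c τ =
    I * zeta a c * (qPochInf (-nome τ) (nome τ) / qPochInf (nome τ) (nome τ)) *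
      (∑' r, tripleTerm (nome τ ^ 2) (nome τ ^ 3) r / (1 - zeta a c ^ 2 * (nome τ ^ 2) ^ r)) +
    I / 2 * (zeta a c)⁻¹ * (1 - I * (Real.sqrt 2 : ℂ) * periodIntegral a c τ) := by
  have h2 : (Real.sqrt 2 : ℂ) ≠ 0 := by
    rw [Ne, ofReal_eq_zero]
    positivity
  have h22 : (Real.sqrt 2 : ℂ) ^ 2 = 2 := by
    rw [← ofReal_pow, Real.sq_sqrt zero_le_two]
    norm_num
  have hS := (hasSum_periodIntegral a c τ).mul_left (-I * (Real.sqrt 2 : ℂ))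
  have hS' : HasSum (fun k : ℤ => ((Real.sign k - errE (k * Real.sqrt (2 * (2 * τ.im))) : ℝ) : ℂ) *
      periodPhase ((2 * (a : ℝ) / (c : ℝ) : ℝ) : ℂ) τ k)
      (-I * (Real.sqrt 2 : ℂ) * periodIntegral a c τ) := by
    refine hS.congr_fun fun k => ?_
    field_simp
    rw [I_sq]
    ring
  have hR := zwegersR_half_period _ τ hS'
  have e : ((2 * (a : ℝ) / (c : ℝ) : ℝ) : ℂ) = 2 * (a : ℂ) / c := by push_cast; rfl
  rw [e] at hR
  rw [N, muTilde, mul_add, mu_half_period, hR, zeta, ← Complex.exp_neg]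
  have e2 : cexp (-(2 * Real.pi * I * τ) / 4) *
      cexp (Real.pi * I * τ / 2 - Real.pi * I * (2 * (a : ℂ) / c)) =
      cexp (-(2 * Real.pi * I * ((a : ℂ) / c))) := by
    rw [← Complex.exp_add]
    congr 1
    ring
  rw [← e2]
  ring

/-- The Appell sums of `tsum_rank_eq_appell` and `N_eq` match, the non-holomorphic parts are the
same integral, and the constant `1` of the rank series is the `1` contributed by the term `k = 0` of
`R`. -/
theorem M_eq {a : ℤ} {c : ℕ} (hc : 0 < c) (hac : ¬ (c : ℤ) ∣ 2 * a) (τ : ℍ) :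
    M a c τ = 2 * zeta a c * ((1 - zeta a c) / (1 + zeta a c)) * (P a c τ - I * N a c τ) := by
  have h0 := norm_nome_lt_one τ.im_pos
  have hz : zeta a c ≠ 0 := Complex.exp_ne_zero _
  have h1 := one_sub_zeta_sq_mul_ne_zero hc hac τ
  have hO := tsum_rank_eq_appell h0 (nome_ne_zero τ) hz
    (fun r => left_ne_zero_of_mul (h1 r)) (fun r => right_ne_zero_of_mul (h1 r))
  have hO' : rankGen (zeta a c) τ = _ := hO
  rw [M, hO', N_eq, P, zeta_two_mul]
  generalize (1 - zeta a c) / (1 + zeta a c) = w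
  generalize ∑' r, tripleTerm (nome τ ^ 2) (nome τ ^ 3) r /
    (1 - zeta a c ^ 2 * (nome τ ^ 2) ^ r) = T
  generalize qPochInf (-nome τ) (nome τ) * qPochInf (nome τ ^ 2) (nome τ ^ 2) ^ 2 /
    (qPochInf (nome τ) (nome τ) * jacProd (zeta a c ^ 2) (nome τ ^ 2)) = U
  generalize qPochInf (-nome τ) (nome τ) / qPochInf (nome τ) (nome τ) = V
  generalize periodIntegral a c τ = J
  field_simp
  linear_combination (2 * zeta a c ^ 2 * V * T + (1 - I * Real.sqrt 2 * J)) * w * I_sq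

end OverpartitionRank

end

theorem corollary3p3 (a : ℤ) (c : ℕ) (hc : 0 < c) (hac : ¬ (c : ℤ) ∣ 2 * a)
    (A : SL(2, ℤ)) (hA2 : A ∈ Gamma0 2) (hAc2 : A ∈ Gamma0 (c ^ 2)) (hAc : A ∈ Gamma1 c)
    (τ : ℍ) :
    OverpartitionRank.N a c (A • τ) =
        OverpartitionRank.multiplier A hA2 * OverpartitionRank.sqrtDenom A τ *
          OverpartitionRank.N a c τ ∧
      OverpartitionRank.P a c (A • τ) =
        OverpartitionRank.nu (OverpartitionRank.upTwo A hA2) / OverpartitionRank.nu A ^ 2 *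
          OverpartitionRank.sqrtDenom A τ * OverpartitionRank.P a c τ ∧
      OverpartitionRank.P a c (A • τ) =
        OverpartitionRank.multiplier A hA2 * OverpartitionRank.sqrtDenom A τ *
          OverpartitionRank.P a c τ ∧
      OverpartitionRank.M a c (A • τ) =
        OverpartitionRank.multiplier A hA2 * OverpartitionRank.sqrtDenom A τ *
          OverpartitionRank.M a c τ := by
  have hP := OverpartitionRank.P_smul hc hac hA2 hAc2 hAc τ
  have hN := OverpartitionRank.N_smul hc hac hA2 hAc2 hAc τ
  refine ⟨hN, hP, ?_, ?_⟩
  · rw [hP, OverpartitionRank.multiplier_eq]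
  · rw [OverpartitionRank.M_eq hc hac, OverpartitionRank.M_eq hc hac, hN, hP,
      OverpartitionRank.multiplier_eq]
    ring
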